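/- \textbf{Conventions.} A word-length function on a group $G$ is a function $L:G\to[0,\infty)$ with $L(1)=0$, $L(g^{-1})=L(g)$, $L(gh)\le L(g)+L(h)$. A short-exact sequence of groups with word-length $(K,L_K)\rightarrowtail(G,L_G)\twoheadrightarrow(N,L_N)$ is a short-exact sequence of groups in which $L_K$ is the restriction of $L_G$ and $L_N(n)=\min\{L_G(g)\mid g\mapsto n\}$. All groups are countable. A \emph{p.s. $G$-module} is a $\mathbb{Q}[G]$-module $M$ with semi-norms $\{\eta_x\}_{x\in\Lambda}$ indexed by a countable set $\Lambda$ with a right $G$-action $(x,g)\mapsto xg$, such that (i) for all $x_1,\dots,x_r\in\Lambda$ ($r\ge1$) and positive integers $\lambda_1,\dots,\lambda_r$ there are $y\in\Lambda$ and a constant $C$ with $\sum\lambda_i\eta_{x_i}\le C\eta_y$; (ii) there are constants $C,n$ such that for every $x'\in\Lambda$ there is $x\in\Lambda$ with $\eta_{x'g}(hm)\le C(1+L(h))^n\eta_{xgh}(m)$ for all $g,h\in G$, $m\in M$. A homomorphism $f:M\to M'$ of p.s. $G$-modules is a $\mathbb{Q}[G]$-linear map for which there is an $n$ such that for every $x'\in\Lambda_{M'}$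 there are $x\in\Lambda_M$ and $C$ with $\eta_{x'g}(f(a))\le C(1+\eta_{xg}(a))^n(1+L(g))^n$ for all $g\in G$, $a\in M$. An \emph{admissible epimorphism} is a surjective homomorphism of p.s. $G$-modules that has a $\mathbb{Q}$-linear, not necessarily equivariant section $s$ which is p-bounded in the sense that there is an $n$ such that for every index $x$ there are an index $y$ and $C$ with $\eta_x(s(a))\le C(1+\eta_y(a))^n$ for all $a$. Let $EG_*$ be the bar resolution of $\mathbb{Q}$ over $\mathbb{Q}[G]$, with $\mathbb{Q}$-basis of $EG_n$ the tuples $t=(g_0,g_1,\dots,g_n)$, $G$ acting on the left of $g_0$, and weight $|t|=1+\sum_{i\ge 0}L(g_i)$. Let $PHom_G(EG_n,M)\subset Hom_G(EG_n,M)$ consist of the equivariant $f$ of polynomial growth on the basis: there is an $m$ such that for every $x\in\Lambda_M$ there is $C$ with $\eta_{xg}(f(t))\le C(1+|t|)^m(1+L(g))^m$ for all $g\in G$ and all basis elements $t$. Let $PH^*(G;M)$ and $H^*(G;M)$ be the cohomology of $PHom_G(EG_*,M)$ and of $Hom_G(EG_*,M)$. We say that $G$ \emph{has p-bounded cohomology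 with coefficients in $M$} if the natural map $PH^i(G;M)\to H^i(G;M)$ is an isomorphism for all $i\ge0$. Now let $(K,L_K)\rightarrowtail(G,L_G)\twoheadrightarrow(N,L_N)$ be a short-exact sequence of groups with word-length and $A$ a p.s. $N$-module; $A$ is also a p.s. $G$-module via $G\to N$ and a p.s. $K$-module with trivial action. The module $(K\backslash EG)_k$ has $\mathbb{Q}$-basis the tuples $t=(n,g_1,\dots,g_k)\in N\times G^k$, of weight $|t|=L_N(n)+1+\sum L_G(g_i)$. Let $PHom((K\backslash EG)_k,A)$ be the space of all $\mathbb{Q}$-linear maps $f$ (not necessarily equivariant) for which there is an $m$ such that for every $x\in\Lambda_A$ there is $C$ with $\eta_x(f(t))\le C(1+|t|)^m$ for all basis elements $t$. The group $N$ acts by $(nf)(t)=nf(n^{-1}t)$, the semi-norms are $\eta_{(x,U)}(f)=\sum_{t\in U}\eta_x(f(t))$ for $x\in\Lambda_A$ and finite sets $U$ of basis elements, and $N$ acts on the indices by $(x,U)n=(xn,n^{-1}U)$. Let $\delta^k$ be the coboundary of this cocomplex; $\ker\delta^k$ is a p.s. $N$-module by restriction, and $PH^k(K;A)=\ker\delta^k/\operatorname{im}\delta^{k-1}$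 is a $\mathbb{Q}[N]$-module. \textbf{Hypothesis H.} For every $k\ge0$, $PH^k(K;A)$ admits a p.s. $N$-module structure for which $\ker\delta^k\twoheadrightarrow PH^k(K;A)$ is an admissible epimorphism. \textbf{Corollary.} Assume Hypothesis H, and let each $PH^k(K;A)$ carry a structure as in it. Suppose that $K$ has p-bounded cohomology with coefficients in $A$ (so that $PH^i(K;A)=H^i(K;A)$), and that $N$ has p-bounded cohomology with coefficients in $PH^i(K;A)$ for every $i\ge0$. Then $G$ has p-bounded cohomology with coefficients in $A$, i.e. $PH^i(G;A)\to H^i(G;A)$ is an isomorphism for all $i\ge 0$. -/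

import Mathlib

universe w

namespace PBdd

noncomputable section

/-- A word-length function on a group. -/
structure WordLength (G : Type*) [Group G] where
  /-- the underlying function -/
  toFun : G → ℝ
  nonneg : ∀ g, 0 ≤ toFun g
  map_one : toFun 1 = 0
  map_inv : ∀ g, toFun g⁻¹ = toFun g
  map_mul_le : ∀ g h, toFun (g * h) ≤ toFun g + toFun h

instance {G : Type*} [Group G] : CoeFun (WordLength G) (fun _ => G → ℝ) := ⟨WordLength.toFun⟩

/-- A homomorphism of groups with word-length:
`L' (f g) = min {L h | f h = f g}` for all `g`. -/
def IsWordLengthHom {G G' : Type*} [Group G] [Group G'] (L : WordLength G) (L' : WordLength G')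
    (f : G →* G') : Prop :=
  ∀ g, IsLeast {r : ℝ | ∃ h, f h = f g ∧ L h = r} (L' (f g))

theorem IsWordLengthHom.le {G G' : Type*} [Group G] [Group G'] {L : WordLength G}
    {L' : WordLength G'} {f : G →* G'} (hf : IsWordLengthHom L L' f) (g : G) :
    L' (f g) ≤ L g :=
  (hf g).2 ⟨g, rfl, rfl⟩

/-- A short-exact sequence `K ↣ G ↠ N` of groups with word-length. -/
structure IsWordLengthExtension {K G N : Type*} [Group K] [Group G] [Group N]
    (LK : WordLength K) (LG : WordLength G) (LN : WordLength N) (ι : K →* G) (π : G →* N) :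
    Prop where
  injective : Function.Injective ι
  exact : ι.range = π.ker
  surjective : Function.Surjective π
  hom_left : IsWordLengthHom LK LG ι
  hom_right : IsWordLengthHom LG LN π

theorem IsWordLengthExtension.le_comp {K G N : Type*} [Group K] [Group G] [Group N]
    {LK : WordLength K} {LG : WordLength G} {LN : WordLength N} {ι : K →* G} {π : G →* N}
    (hE : IsWordLengthExtension LK LG LN ι π) (k : K) : LN ((π.comp ι) k) ≤ LK k :=
  (hE.hom_right.le (ι k)).trans (hE.hom_left.le k)

/-- The structure of a p-semi-normed `G`-module on a `ℚ[G]`-module `(V, ρ)`: a collection of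
semi-norms `η x`, indexed by a countable `G`-set.  The group acts on the index set from the right
(`act x g`), which is what makes `bounded` compatible with `g (h m) = (g h) m`; the model case is
`η (act x g) m = η x (g m)`. -/
structure PSStructure {G V : Type*} [Group G] [AddCommGroup V] [Module ℚ V]
    (L : WordLength G) (ρ : Representation ℚ G V) where
  /-- the index set of the semi-norms -/
  Idx : Type w
  countable : Countable Idx
  /-- the right action of the group on the index set -/
  act : Idx → G → Idx
  act_one : ∀ x, act x 1 = x
  act_mul : ∀ x g h, act x (g * h) = act (act x g) h
  /-- the semi-norms -/
  η : Idx → Seminorm ℚ V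
  directed : ∀ (k : ℕ) (x : Fin (k + 1) → Idx) (c : Fin (k + 1) → ℕ+),
    ∃ (C : ℝ) (y : Idx), ∀ m, ∑ i, ((c i : ℕ) : ℝ) * η (x i) m ≤ C * η y m
  bounded : ∃ (C : ℝ) (n : ℕ), ∀ x', ∃ x, ∀ g h m,
    η (act x' g) (ρ h m) ≤ C * (1 + L h) ^ n * η (act x (g * h)) m

section Structures

variable {G V W : Type*} [Group G] [AddCommGroup V] [Module ℚ V] [AddCommGroup W] [Module ℚ W]
  {L : WordLength G} {ρ : Representation ℚ G V} {σ : Representation ℚ G W}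

/-- Restriction of a p-semi-normed module along a length-nonincreasing group homomorphism. -/
def PSStructure.comap {H : Type*} [Group H] {LH : WordLength H}
    (M : PSStructure.{w} L ρ) (φ : H →* G) (hφ : ∀ h, L (φ h) ≤ LH h) :
    PSStructure.{w} LH (MonoidHom.comp ρ φ : Representation ℚ H V) where
  Idx := M.Idx
  countable := M.countable
  act x h := M.act x (φ h)
  act_one x := by rw [map_one, M.act_one]
  act_mul x g h := by rw [map_mul, M.act_mul]
  η := M.η
  directed := M.directed
  bounded := by
    obtain ⟨C, n, hC⟩ := M.bounded
    refine ⟨|C|, n, fun x' => ?_⟩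
    obtain ⟨x, hx⟩ := hC x'
    refine ⟨x, fun g h m => ?_⟩
    have h1 := hx (φ g) (φ h) m
    rw [map_mul]
    refine h1.trans ?_
    have h0 := L.nonneg (φ h)
    have := hφ h
    gcongr
    exact le_abs_self C

/-- The p-semi-normed structure on a module `W` induced by an equivariant map `f : W → V` (used for
inclusions of submodules): the semi-norms of `W` are the restrictions of those of `V`. -/
def PSStructure.induced (M : PSStructure.{w} L ρ) (f : W →ₗ[ℚ] V)
    (hf : ∀ g m, f (σ g m) = ρ g (f m)) : PSStructure.{w} L σ where
  Idx := M.Idx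
  countable := M.countable
  act := M.act
  act_one := M.act_one
  act_mul := M.act_mul
  η x := (M.η x).comp f
  directed k x c := by
    obtain ⟨C, y, h⟩ := M.directed k x c
    exact ⟨C, y, fun m => h (f m)⟩
  bounded := by
    obtain ⟨C, n, hC⟩ := M.bounded
    refine ⟨C, n, fun x' => ?_⟩
    obtain ⟨x, hx⟩ := hC x'
    refine ⟨x, fun g h m => ?_⟩
    simpa [hf] using hx g h (f m)

/-- A `ℚ`-linear map between p-semi-normed `G`-modules is p-bounded (uniformly in `g ∈ G`). -/
def IsPBoundedHom (M : PSStructure L ρ) (M' : PSStructure L σ) (f : V →ₗ[ℚ] W) : Prop :=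
  ∃ n : ℕ, ∀ x', ∃ x, ∃ C : ℝ, ∀ g a,
    M'.η (M'.act x' g) (f a) ≤ C * (1 + M.η (M.act x g) a) ^ n * (1 + L g) ^ n

/-- A `ℚ`-linear map is p-bounded as a map of p-semi-normed modules, the group being forgotten. -/
def IsPBoundedLinear (M : PSStructure L ρ) (M' : PSStructure L σ) (f : V →ₗ[ℚ] W) : Prop :=
  ∃ n : ℕ, ∀ x', ∃ x, ∃ C : ℝ, ∀ a, M'.η x' (f a) ≤ C * (1 + M.η x a) ^ n

/-- An admissible epimorphism: a surjective homomorphism of p-semi-normed `G`-modules that admits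
a (not necessarily equivariant) section of p-semi-normed modules. -/
structure IsAdmissibleEpi (M : PSStructure L ρ) (M' : PSStructure L σ) (f : V →ₗ[ℚ] W) :
    Prop where
  equivariant : ∀ g m, f (ρ g m) = σ g (f m)
  surjective : Function.Surjective f
  bounded : IsPBoundedHom M M' f
  section' : ∃ s : W →ₗ[ℚ] V, f ∘ₗ s = LinearMap.id ∧ IsPBoundedLinear M' M s

/-- A map from a weighted set `(X, wt)` to a p-semi-normed module is p-bounded, the group being
forgotten. -/
def IsPBoundedFun (M : PSStructure L ρ) {X : Type*} (wt : X → ℝ) (f : X → V) : Prop :=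
  ∃ n : ℕ, ∀ x, ∃ C : ℝ, ∀ t, M.η x (f t) ≤ C * (1 + wt t) ^ n

/-- A map from a weighted set `(X, wt)` to a p-semi-normed `G`-module is p-bounded (uniformly in
`g ∈ G`). -/
def IsPBoundedFunG (M : PSStructure L ρ) {X : Type*} (wt : X → ℝ) (f : X → V) : Prop :=
  ∃ n : ℕ, ∀ x, ∃ C : ℝ, ∀ g t, M.η (M.act x g) (f t) ≤ C * (1 + wt t) ^ n * (1 + L g) ^ n

end Structures

/-! Bar complexes.  For a homomorphism `ν : G → Q`, `BarBasis Q G n` is a `ℚ`-basis of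
`ℚ[Q] ⊗ ℚ[G]^{⊗ n}`.  For `ν = id` this is the `n`-th term of the bar resolution `EG`, and for a
surjection `ν = π : G → N` with kernel `K` it is the `n`-th term of `K \ EG`.  Linear maps from
these free modules to `V` are given by arbitrary functions on the basis. -/

/-- The set of tuples `(q, g₁, …, gₙ)`. -/
abbrev BarBasis (Q G : Type*) (n : ℕ) := Q × (Fin n → G)

section Bar

variable {Q G V : Type*} [Group Q] [Group G] [AddCommGroup V] [Module ℚ V]

/-- The weight `|q • (1, g₁, …, gₙ)| = L q + (1 + ∑ L gᵢ)`. -/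
def barWeight (LQ : WordLength Q) (LG : WordLength G) (n : ℕ) (t : BarBasis Q G n) : ℝ :=
  LQ t.1 + (1 + ∑ i, LG (t.2 i))

theorem barWeight_nonneg (LQ : WordLength Q) (LG : WordLength G) (n : ℕ) (t : BarBasis Q G n) :
    0 ≤ barWeight LQ LG n t := by
  have := LQ.nonneg t.1
  have : 0 ≤ ∑ i, LG (t.2 i) := Finset.sum_nonneg fun i _ => LG.nonneg _
  simp only [barWeight]
  linarith

/-- `Q` acts on the basis by left multiplication in the left-most coordinate. -/
def barAct (X : Type*) (n : ℕ) (q : Q) : BarBasis Q X n ≃ BarBasis Q X n :=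
  (Equiv.mulLeft q).prodCongr (Equiv.refl _)

/-- The coboundary, dual to
`d (q, g₁, …, gₙ₊₁) = (q ν(g₁), g₂, …) + ∑ (-1)ⁱ (q, …, gᵢ gᵢ₊₁, …) + (-1)ⁿ⁺¹ (q, g₁, …, gₙ)`. -/
def barD (V : Type*) [AddCommGroup V] [Module ℚ V] (ν : G →* Q) (n : ℕ) :
    (BarBasis Q G n → V) →ₗ[ℚ] (BarBasis Q G (n + 1) → V) where
  toFun φ t := φ (t.1 * ν (t.2 0), fun i => t.2 i.succ) +
    ∑ j : Fin (n + 1), (-1 : ℚ) ^ ((j : ℕ) + 1) • φ (t.1, Fin.contractNth j (· * ·) t.2)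
  map_add' φ ψ := by
    ext t
    simp [Finset.sum_add_distrib, add_add_add_comm]
  map_smul' r φ := by
    ext t
    simp [Finset.smul_sum, smul_comm r]

/-- The action `(q φ)(t) = q φ(q⁻¹ t)` on cochains. -/
def barRep (X : Type*) (ρ : Representation ℚ Q V) (n : ℕ) :
    Representation ℚ Q (BarBasis Q X n → V) where
  toFun q :=
    { toFun := fun φ t => ρ q (φ (barAct X n q⁻¹ t))
      map_add' := fun φ ψ => by ext t; simp
      map_smul' := fun r φ => by ext t; simp }
  map_one' := by
    ext φ t
    simp [barAct]
  map_mul' p q := by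
    ext φ t
    have : barAct X n (p * q)⁻¹ t = barAct X n q⁻¹ (barAct X n p⁻¹ t) := by
      ext <;> simp [barAct, mul_assoc]
    simp [this, -mul_inv_rev]

theorem barRep_apply {Q X V : Type*} [Group Q] [AddCommGroup V] [Module ℚ V]
    (ρ : Representation ℚ Q V) (n : ℕ) (q : Q) (φ : BarBasis Q X n → V) (t : BarBasis Q X n) :
    barRep X ρ n q φ t = ρ q (φ (barAct X n q⁻¹ t)) := rfl

theorem barD_barRep (ν : G →* Q) (ρ : Representation ℚ Q V) (n : ℕ) (q : Q)
    (φ : BarBasis Q G n → V) :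
    barD V ν n (barRep G ρ n q φ) = barRep G ρ (n + 1) q (barD V ν n φ) := by
  ext t
  simp [barD, barRep_apply, barAct, mul_assoc]

/-! Cohomology of a graded family `X` of spaces of cochains. -/

/-- The cocycles in `X n`. -/
def cocycles (ν : G →* Q) (X : ∀ n, Submodule ℚ (BarBasis Q G n → V)) (n : ℕ) :
    Submodule ℚ (BarBasis Q G n → V) :=
  X n ⊓ LinearMap.ker (barD V ν n)

/-- The coboundaries of elements of `X (n - 1)`. -/
def coboundaries (ν : G →* Q) (X : ∀ n, Submodule ℚ (BarBasis Q G n → V)) :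
    ∀ n, Submodule ℚ (BarBasis Q G n → V)
  | 0 => ⊥
  | n + 1 => (X n).map (barD V ν n)

theorem coboundaries_mono (ν : G →* Q) {X Y : ∀ n, Submodule ℚ (BarBasis Q G n → V)}
    (h : ∀ n, X n ≤ Y n) : ∀ n, coboundaries ν X n ≤ coboundaries ν Y n
  | 0 => le_rfl
  | n + 1 => Submodule.map_mono (h n)

/-- The cohomology of the cochains in `X`: cocycles modulo coboundaries. -/
abbrev Cohomology (ν : G →* Q) (X : ∀ n, Submodule ℚ (BarBasis Q G n → V)) (n : ℕ) :=
  cocycles ν X n ⧸ (coboundaries ν X n).submoduleOf (cocycles ν X n)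

/-- The map on cohomology induced by an inclusion `X ≤ Y` of spaces of cochains. -/
def cohomologyMap (ν : G →* Q) {X Y : ∀ n, Submodule ℚ (BarBasis Q G n → V)}
    (h : ∀ n, X n ≤ Y n) (n : ℕ) : Cohomology ν X n →ₗ[ℚ] Cohomology ν Y n :=
  Submodule.mapQ _ _ (Submodule.inclusion (inf_le_inf_right _ (h n)))
    (fun _ hz => coboundaries_mono ν h n hz)

end Bar

section GroupCohomology

variable {G V : Type*} [Group G] [AddCommGroup V] [Module ℚ V]
  {L : WordLength G} {ρ : Representation ℚ G V}

/-- `Hom_G(EG_n, V)`: the equivariant cochains. -/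
def homG (ρ : Representation ℚ G V) (n : ℕ) : Submodule ℚ (BarBasis G G n → V) :=
  (barRep G ρ n).invariants

/-- `PHom_G(EG_n, V)`: the equivariant cochains that are p-bounded on the weighted basis. -/
def pHomG (M : PSStructure L ρ) (n : ℕ) : Submodule ℚ (BarBasis G G n → V) where
  carrier := {φ | φ ∈ homG ρ n ∧ IsPBoundedFunG M (barWeight L L n) φ}
  zero_mem' := ⟨zero_mem _, 0, fun x => ⟨0, fun g t => by simp⟩⟩
  add_mem' := by
    rintro φ ψ ⟨hφ, n₁, h₁⟩ ⟨hψ, n₂, h₂⟩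
    refine ⟨add_mem hφ hψ, n₁ + n₂, fun x => ?_⟩
    obtain ⟨C₁, h₁⟩ := h₁ x
    obtain ⟨C₂, h₂⟩ := h₂ x
    refine ⟨|C₁| + |C₂|, fun g t => ?_⟩
    have hw : 1 ≤ 1 + barWeight L L n t := by linarith [barWeight_nonneg L L n t]
    have hl : 1 ≤ 1 + L g := by linarith [L.nonneg g]
    have e₁ : C₁ * (1 + barWeight L L n t) ^ n₁ * (1 + L g) ^ n₁ ≤
        |C₁| * (1 + barWeight L L n t) ^ (n₁ + n₂) * (1 + L g) ^ (n₁ + n₂) := by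
      gcongr <;> first | exact le_abs_self _ | assumption | omega
    have e₂ : C₂ * (1 + barWeight L L n t) ^ n₂ * (1 + L g) ^ n₂ ≤
        |C₂| * (1 + barWeight L L n t) ^ (n₁ + n₂) * (1 + L g) ^ (n₁ + n₂) := by
      gcongr <;> first | exact le_abs_self _ | assumption | omega
    have := map_add_le_add (M.η (M.act x g)) (φ t) (ψ t)
    have := h₁ g t
    have := h₂ g t
    simp only [Pi.add_apply]
    linarith
  smul_mem' := by
    rintro r φ ⟨hφ, n₁, h₁⟩
    refine ⟨Submodule.smul_mem _ r hφ, n₁, fun x => ?_⟩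
    obtain ⟨C₁, h₁⟩ := h₁ x
    refine ⟨‖r‖ * C₁, fun g t => ?_⟩
    simp only [Pi.smul_apply, map_smul_eq_mul, mul_assoc]
    exact mul_le_mul_of_nonneg_left (by simpa [mul_assoc] using h₁ g t) (norm_nonneg r)

/-- `H^n(G; V)`, computed by the bar resolution. -/
abbrev H (ρ : Representation ℚ G V) (n : ℕ) := Cohomology (MonoidHom.id G) (homG ρ) n

/-- `PH^n(G; V)`, the p-bounded cohomology, computed by the bar resolution. -/
abbrev PH (M : PSStructure L ρ) (n : ℕ) := Cohomology (MonoidHom.id G) (pHomG M) n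

/-- The natural map `PH^n(G; V) → H^n(G; V)`. -/
def toH (M : PSStructure L ρ) (n : ℕ) : PH M n →ₗ[ℚ] H ρ n :=
  cohomologyMap (MonoidHom.id G) (X := pHomG M) (Y := homG ρ) (fun _ _ hφ => And.left hφ) n

/-- `G` has p-bounded cohomology with coefficients in `V`: the natural map `PH^n → H^n` is an
isomorphism for all `n`. -/
def HasPBoundedCohomology (M : PSStructure L ρ) : Prop :=
  ∀ n, Function.Bijective (toH M n)

end GroupCohomology

/-! The `N`-module `PH^k(K; A)` for an extension `K ↣ G ↠ N` and a p-semi-normed `N`-module `A`,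
computed by the complex `PHom(K \ EG, A)`. -/

section Fibre

variable {G N A : Type*} [Group G] [Group N] [AddCommGroup A] [Module ℚ A]
  {LN : WordLength N} {ρ : Representation ℚ N A}

theorem seminorm_sum_apply {V T : Type*} [AddCommGroup V] [Module ℚ V] (U : Finset T)
    (η : T → Seminorm ℚ V) (v : V) : (∑ t ∈ U, η t) v = ∑ t ∈ U, η t v := by
  induction U using Finset.cons_induction with
  | empty => simp
  | cons a s ha ih => simp [Finset.sum_cons, ih]

/-- The p-semi-normed `N`-module structure on functions from the basis of `(K \ EG)_k` to `A`,
where `X = G` is the set of entries: semi-norms `η_(x, U) f = ∑_{t ∈ U} η_x (f t)`, index action `(x, U) g = (x g, g⁻¹ U)`. -/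
def PSStructure.cochains (M : PSStructure.{w} LN ρ) (X : Type*) [Countable X] [Countable N]
    (k : ℕ) : PSStructure LN (barRep X ρ k) where
  Idx := M.Idx × Finset (BarBasis N X k)
  countable := by
    have := M.countable
    infer_instance
  act x g := (M.act x.1 g, x.2.map (barAct X k g⁻¹).toEmbedding)
  act_one x := by
    have : (barAct X k (1 : N)).toEmbedding = Function.Embedding.refl (BarBasis N X k) := by
      ext t <;> simp [barAct]
    simp [M.act_one, this]
  act_mul x g h := by
    have : (barAct X k (g * h)⁻¹).toEmbedding =
        (barAct X k g⁻¹).toEmbedding.trans (barAct X k h⁻¹).toEmbedding := by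
      ext t <;> simp [barAct, mul_assoc]
    simp only [M.act_mul, this, Finset.map_map]
  η x := ∑ t ∈ x.2, (M.η x.1).comp (LinearMap.proj t)
  directed j x c := by
    classical
    obtain ⟨C, y, hC⟩ := M.directed j (fun i => (x i).1) c
    refine ⟨C, (y, Finset.univ.biUnion fun i => (x i).2), fun f => ?_⟩
    simp only [seminorm_sum_apply, Seminorm.comp_apply, LinearMap.proj_apply]
    calc ∑ i, ((c i : ℕ) : ℝ) * ∑ t ∈ (x i).2, M.η (x i).1 (f t)
        ≤ ∑ i, ((c i : ℕ) : ℝ) *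
            ∑ t ∈ Finset.univ.biUnion fun i => (x i).2, M.η (x i).1 (f t) := by
          refine Finset.sum_le_sum fun i _ => mul_le_mul_of_nonneg_left ?_ (Nat.cast_nonneg _)
          exact Finset.sum_le_sum_of_subset_of_nonneg
            (Finset.subset_biUnion_of_mem (fun i => (x i).2) (Finset.mem_univ i))
            fun _ _ _ => apply_nonneg _ _
      _ = ∑ t ∈ Finset.univ.biUnion fun i => (x i).2,
            ∑ i, ((c i : ℕ) : ℝ) * M.η (x i).1 (f t) := by
          simp only [Finset.mul_sum]
          exact Finset.sum_comm
      _ ≤ C * ∑ t ∈ Finset.univ.biUnion fun i => (x i).2, M.η y (f t) := by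
          rw [Finset.mul_sum]
          exact Finset.sum_le_sum fun t _ => hC (f t)
  bounded := by
    obtain ⟨C, n, hC⟩ := M.bounded
    refine ⟨C, n, fun x' => ?_⟩
    obtain ⟨x, hx⟩ := hC x'.1
    refine ⟨(x, x'.2), fun g h f => ?_⟩
    simp only [seminorm_sum_apply, Seminorm.comp_apply, LinearMap.proj_apply, Finset.sum_map,
      barRep_apply]
    rw [Finset.mul_sum]
    refine Finset.sum_le_sum fun t _ => ?_
    have e : barAct X k h⁻¹ ((barAct X k g⁻¹).toEmbedding t) =
        (barAct X k (g * h)⁻¹).toEmbedding t := by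
      ext <;> simp [barAct, mul_assoc]
    rw [e]
    exact hx g h _

/-- `PHom((K \ EG)_k, A)`: the p-bounded maps of p-semi-normed modules; `N` is forgotten here. -/
def pHom (M : PSStructure LN ρ) (LG : WordLength G) (k : ℕ) :
    Submodule ℚ (BarBasis N G k → A) where
  carrier := {φ | IsPBoundedFun M (barWeight LN LG k) φ}
  zero_mem' := ⟨0, fun x => ⟨0, fun t => by simp⟩⟩
  add_mem' := by
    rintro φ ψ ⟨n₁, h₁⟩ ⟨n₂, h₂⟩
    refine ⟨n₁ + n₂, fun x => ?_⟩
    obtain ⟨C₁, h₁⟩ := h₁ x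
    obtain ⟨C₂, h₂⟩ := h₂ x
    refine ⟨|C₁| + |C₂|, fun t => ?_⟩
    have hw : 1 ≤ 1 + barWeight LN LG k t := by linarith [barWeight_nonneg LN LG k t]
    have e₁ : C₁ * (1 + barWeight LN LG k t) ^ n₁ ≤
        |C₁| * (1 + barWeight LN LG k t) ^ (n₁ + n₂) := by
      gcongr <;> first | exact le_abs_self _ | assumption | omega
    have e₂ : C₂ * (1 + barWeight LN LG k t) ^ n₂ ≤
        |C₂| * (1 + barWeight LN LG k t) ^ (n₁ + n₂) := by
      gcongr <;> first | exact le_abs_self _ | assumption | omega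
    have := map_add_le_add (M.η x) (φ t) (ψ t)
    have := h₁ t
    have := h₂ t
    simp only [Pi.add_apply]
    linarith
  smul_mem' := by
    rintro r φ ⟨n₁, h₁⟩
    refine ⟨n₁, fun x => ?_⟩
    obtain ⟨C₁, h₁⟩ := h₁ x
    refine ⟨‖r‖ * C₁, fun t => ?_⟩
    simp only [Pi.smul_apply, map_smul_eq_mul, mul_assoc]
    exact mul_le_mul_of_nonneg_left (h₁ t) (norm_nonneg r)

theorem pHom_invariant (M : PSStructure LN ρ) (LG : WordLength G) (k : ℕ) (g : N) :
    pHom M LG k ≤ (pHom M LG k).comap (barRep G ρ k g) := by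
  rintro φ ⟨n, h⟩
  obtain ⟨C, m, hC⟩ := M.bounded
  refine ⟨n, fun x' => ?_⟩
  obtain ⟨x, hx⟩ := hC x'
  obtain ⟨D, hD⟩ := h (M.act x g)
  refine ⟨|C| * (1 + LN g) ^ m * (|D| * (1 + LN g) ^ n), fun t => ?_⟩
  have hg := LN.nonneg g
  have hw : barWeight LN LG k (barAct G k g⁻¹ t) ≤ LN g + barWeight LN LG k t := by
    have h₁ := LN.map_mul_le g⁻¹ t.1
    rw [LN.map_inv] at h₁
    simp only [barWeight, barAct, Equiv.prodCongr_apply, Prod.map_fst, Prod.map_snd,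
      Equiv.coe_mulLeft, Equiv.refl_apply]
    linarith
  have w₀ := barWeight_nonneg LN LG k t
  have w₁ := barWeight_nonneg LN LG k (barAct G k g⁻¹ t)
  have h₁ := hx 1 g (φ (barAct G k g⁻¹ t))
  rw [M.act_one, one_mul] at h₁
  have h₂ := hD (barAct G k g⁻¹ t)
  rw [barRep_apply]
  calc _ ≤ _ := h₁
    _ ≤ |C| * (1 + LN g) ^ m * (|D| * ((1 + LN g) * (1 + barWeight LN LG k t)) ^ n) := by
      gcongr
      · exact le_abs_self C
      · refine h₂.trans ?_
        gcongr
        · exact le_abs_self D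
        · nlinarith
    _ = _ := by rw [mul_pow]; ring

/-- `ker δ^k` in the complex `PHom(K \ EG, A)`. -/
abbrev fibreKer (M : PSStructure LN ρ) (LG : WordLength G) (π : G →* N) (k : ℕ) :
    Submodule ℚ (BarBasis N G k → A) :=
  cocycles π (pHom M LG) k

theorem fibreKer_invariant (M : PSStructure LN ρ) (LG : WordLength G) (π : G →* N) (k : ℕ)
    (g : N) : fibreKer M LG π k ≤ (fibreKer M LG π k).comap (barRep G ρ k g) := by
  rintro φ ⟨h₁, h₂⟩
  refine ⟨pHom_invariant M LG k g h₁, ?_⟩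
  have h₂ : barD A π k φ = 0 := h₂
  simp [barD_barRep, h₂]

/-- The `N`-action on `ker δ^k`. -/
def fibreKerRep (M : PSStructure LN ρ) (LG : WordLength G) (π : G →* N) (k : ℕ) :
    Representation ℚ N (fibreKer M LG π k) :=
  (barRep G ρ k).subrepresentation (fibreKer M LG π k) (fibreKer_invariant M LG π k)

/-- `ker δ^k` as a p-semi-normed `N`-module, by restriction from all cochains. -/
def fibreKerStructure [Countable G] [Countable N] (M : PSStructure LN ρ) (LG : WordLength G)
    (π : G →* N) (k : ℕ) : PSStructure LN (fibreKerRep M LG π k) :=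
  (M.cochains G k).induced (fibreKer M LG π k).subtype (fun _ _ => rfl)

/-- `PH^k(K; A) = ker δ^k / im δ^(k-1)`. -/
abbrev fibrePH (M : PSStructure LN ρ) (LG : WordLength G) (π : G →* N) (k : ℕ) :=
  Cohomology π (pHom M LG) k

theorem fibreIm_invariant (M : PSStructure LN ρ) (LG : WordLength G) (π : G →* N) (k : ℕ)
    (g : N) : (coboundaries π (pHom M LG) k).submoduleOf (fibreKer M LG π k) ≤
      ((coboundaries π (pHom M LG) k).submoduleOf (fibreKer M LG π k)).comap
        (fibreKerRep M LG π k g) := by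
  intro φ hφ
  cases k with
  | zero =>
    have h0 : (φ : BarBasis N G 0 → A) = 0 := hφ
    have : φ = 0 := Subtype.ext h0
    simp [this]
  | succ k =>
    obtain ⟨ψ, hψ, e⟩ := hφ
    exact ⟨barRep G ρ k g ψ, pHom_invariant M LG k g hψ, by rw [barD_barRep, e]; rfl⟩

/-- The `N`-action on `PH^k(K; A)`. -/
def fibrePHRep (M : PSStructure LN ρ) (LG : WordLength G) (π : G →* N) (k : ℕ) :
    Representation ℚ N (fibrePH M LG π k) :=
  (fibreKerRep M LG π k).quotient _ (fibreIm_invariant M LG π k)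

/-- The projection `ker δ^k → PH^k(K; A)`. -/
def fibreProj (M : PSStructure LN ρ) (LG : WordLength G) (π : G →* N) (k : ℕ) :
    fibreKer M LG π k →ₗ[ℚ] fibrePH M LG π k :=
  Submodule.mkQ _

end Fibre

end

end PBdd

/-! An isomorphism `PH^* → H^*` in all degrees means that the cochains of all kinds modulo the
cochains of polynomial growth form an acyclic complex (`RelAcyclic`,
`hasPBoundedCohomology_iff`).  So the corollary needs no spectral sequence, only a statement on
double complexes `C` with a subcomplex `P`: if the rows of `C / P` resolve `E / PE` and the vertical
cohomology of `C / P` is horizontally acyclic, then `E / PE` is acyclic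
(`exists_augmentation_boundary`).  The double complexes are spaces of equivariant functions of two
tuples, `P` consists of those that grow polynomially in both variables jointly, and the rows are
contracted by inserting a vertex (`biP_rows`).  For equivariant cochains, uniformity of the growth
in the group is automatic (`IsPBoundedFun.uniform`).

The double complex is used twice.

* Tuples of `K` against tuples of `G`.  The columns are contracted by inserting the left-most vertex
  of the first variable, and the hypothesis on `K` says that the remaining complex is acyclic.  Since
  `G` retracts onto `K` equivariantly with linear growth, all cochains on `K \ EG` modulo those of
  polynomial growth form an acyclic complex (`fibre_relAcyclic`).
* Tuples of `N` against the basis of `K \ EG`.  The rows resolve the `N`-invariant cochains on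
  `K \ EG`, which compute the cohomology of `G` (`relAcyclic_of_invCochains`).  The columns compute
  `PH^q(K; A)`, and the hypothesis on `N` should make them horizontally acyclic
  (`columns_of_fibre`).  The difficulty is that the primitives supplied by the hypothesis on `K`
  depend on a cochain in no controlled way, so that growth in both variables jointly is lost.

Joint control comes from the coefficients.  If all seminorms of `A` vanish, then every cochain has
polynomial growth and there is nothing to prove.  Otherwise a vector of positive seminorm turns
rational functionals on chains into cochains with values in `A`, and acyclicity of the fibre becomes
scalar control: a rational functional whose coboundary has polynomial growth is bounded on cycles by
a weighted `ℓ¹`-norm (`scalarControl_of_relAcyclic`).  This forces the homology of `K \ EG` to be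
finite-dimensional (`ScalarControl.finite`) and, by the Hahn–Banach theorem over `ℚ` and uniform
boundedness, forces boundaries to have fillings of polynomially controlled size
(`ScalarControl.exists_filling`).  As chains are free on the basis, the fillings can be taken linear
(`ScalarControl.hasFilling`).  Evaluating a family of cochains on the translates of such fillings
gives primitives with joint control (`exists_bounded_primitive`), and a class in `PH^q(K; A)` is
determined by its finitely many periods (`periodClass`).  The p-bounded section in the hypothesis on
`PH^q(K; A)` bounds the periods by the seminorms of the class, so that equivariant families of
classes of polynomial growth lift to families of cocycles with joint control
(`exists_bounded_lift`). -/

namespace PBdd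

noncomputable section

/-! ### The bar differential and its contraction -/

section BarContraction

variable {Q G V W : Type*} [Group Q] [Group G] [AddCommGroup V] [Module ℚ V]
  [AddCommGroup W] [Module ℚ W]

theorem contractNth_zero_cons {X : Type*} (op : X → X → X) {n : ℕ} (a : X) (g : Fin (n + 1) → X) :
    Fin.contractNth (0 : Fin (n + 2)) op (Fin.cons a g) =
      (Fin.cons (op a (g 0)) (fun i => g i.succ) : Fin (n + 1) → X) := by
  funext k
  refine Fin.cases ?_ (fun k => ?_) k
  · rw [Fin.contractNth_apply_of_eq _ _ _ _ rfl]
    simp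
  · rw [Fin.contractNth_apply_of_gt _ _ _ _ (by simp)]
    simp

theorem contractNth_succ_cons {X : Type*} (op : X → X → X) {n : ℕ} (j : Fin (n + 1)) (a : X)
    (g : Fin (n + 1) → X) :
    Fin.contractNth j.succ op (Fin.cons a g) =
      (Fin.cons a (Fin.contractNth j op g) : Fin (n + 1) → X) := by
  funext k
  refine Fin.cases ?_ (fun k => ?_) k
  · rw [Fin.contractNth_apply_of_lt _ _ _ _ (by simp)]
    simp
  · rcases lt_trichotomy (k : ℕ) j with h | h | h
    · rw [Fin.contractNth_apply_of_lt _ _ _ _ (by simpa using h), Fin.cons_succ,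
        Fin.contractNth_apply_of_lt _ _ _ _ h, ← Fin.succ_castSucc, Fin.cons_succ]
    · rw [Fin.contractNth_apply_of_eq _ _ _ _ (by simpa using h), Fin.cons_succ,
        ← Fin.succ_castSucc,
        Fin.cons_succ, Fin.cons_succ, Fin.contractNth_apply_of_eq _ _ _ _ h]
    · rw [Fin.contractNth_apply_of_gt _ _ _ _ (by simpa using h), Fin.cons_succ, Fin.cons_succ,
        Fin.contractNth_apply_of_gt _ _ _ _ h]

theorem barD_apply (ν : G →* Q) (n : ℕ) (φ : BarBasis Q G n → V) (t : BarBasis Q G (n + 1)) :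
    barD V ν n φ t = φ (t.1 * ν (t.2 0), fun i => t.2 i.succ) +
      ∑ j : Fin (n + 1), (-1 : ℚ) ^ ((j : ℕ) + 1) • φ (t.1, Fin.contractNth j (· * ·) t.2) := rfl

/-- The differential commutes with linear maps of the coefficients. -/
theorem barD_comp (ν : G →* Q) (n : ℕ) (f : V →ₗ[ℚ] W) (φ : BarBasis Q G n → V)
    (t : BarBasis Q G (n + 1)) :
    barD W ν n (fun s => f (φ s)) t = f (barD V ν n φ t) := by
  simp [barD_apply]

/-- The differential commutes with changes of the group of left-most coordinates. -/
theorem barD_pullback {Q' : Type*} [Group Q'] (ν : G →* Q) (ν' : G →* Q') (f : Q' → Q)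
    (hf : ∀ q g, f (q * ν' g) = f q * ν g) (n : ℕ) (φ : BarBasis Q G n → V)
    (t : BarBasis Q' G (n + 1)) :
    barD V ν' n (fun s => φ (f s.1, s.2)) t = barD V ν n φ (f t.1, t.2) := by
  simp [barD_apply, hf]

/-- Inserting `b` as the left-most vertex contracts the bar resolution. -/
theorem barD_insert (n : ℕ) (φ : BarBasis Q Q (n + 1) → V) (b : Q) (t : BarBasis Q Q (n + 1)) :
    barD V (MonoidHom.id Q) (n + 1) φ (b, Fin.cons (b⁻¹ * t.1) t.2) =
      φ t - barD V (MonoidHom.id Q) n (fun s => φ (b, Fin.cons (b⁻¹ * s.1) s.2)) t := by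
  rw [barD_apply, barD_apply, Fin.sum_univ_succ]
  simp only [Fin.cons_zero, Fin.cons_succ, MonoidHom.id_apply, mul_inv_cancel_left,
    contractNth_zero_cons, contractNth_succ_cons, Fin.val_zero, Fin.val_succ]
  have e : ∀ j : Fin (n + 1), (-1 : ℚ) ^ ((j : ℕ) + 1 + 1) = - (-1 : ℚ) ^ ((j : ℕ) + 1) :=
    fun j => by ring
  simp only [e, neg_smul, Finset.sum_neg_distrib, zero_add, pow_one, one_smul, mul_assoc]
  abel

theorem barD_insert_zero (φ : BarBasis Q Q 0 → V) (b : Q) (t : BarBasis Q Q 0) :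
    barD V (MonoidHom.id Q) 0 φ (b, Fin.cons (b⁻¹ * t.1) t.2) = φ t - φ (b, t.2) := by
  have h1 : ∀ g : Fin 0 → Q, g = t.2 := fun g => Subsingleton.elim _ _
  simp [barD_apply, h1, sub_eq_add_neg]

theorem barD_barD_id (n : ℕ) (φ : BarBasis Q Q n → V) :
    barD V (MonoidHom.id Q) (n + 1) (barD V (MonoidHom.id Q) n φ) = 0 := by
  induction n with
  | zero =>
    funext t
    -- every basis element is obtained by an insertion
    obtain ⟨s, hs⟩ : ∃ s : BarBasis Q Q 1, t = (t.1, Fin.cons (t.1⁻¹ * s.1) s.2) :=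
      ⟨(t.1 * t.2 0, fun i => t.2 i.succ), by
        refine Prod.ext rfl (funext fun k => ?_)
        refine Fin.cases ?_ (fun k => ?_) k <;> simp⟩
    rw [hs, barD_insert]
    have : (fun s : BarBasis Q Q 0 =>
        barD V (MonoidHom.id Q) 0 φ (t.1, Fin.cons (t.1⁻¹ * s.1) s.2)) =
        φ - fun s => φ (t.1, s.2) := by
      funext s
      exact barD_insert_zero φ _ s
    rw [this, map_sub]
    have h1 : ∀ g : Fin 0 → Q, g = fun i => i.elim0 := fun g => Subsingleton.elim _ _
    simp [barD_apply, h1]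
  | succ n ih =>
    funext t
    obtain ⟨s, hs⟩ : ∃ s : BarBasis Q Q (n + 2), t = (t.1, Fin.cons (t.1⁻¹ * s.1) s.2) :=
      ⟨(t.1 * t.2 0, fun i => t.2 i.succ), by
        refine Prod.ext rfl (funext fun k => ?_)
        refine Fin.cases ?_ (fun k => ?_) k <;> simp⟩
    rw [hs, barD_insert]
    have : (fun s : BarBasis Q Q (n + 1) =>
        barD V (MonoidHom.id Q) (n + 1) φ (t.1, Fin.cons (t.1⁻¹ * s.1) s.2)) =
        φ - barD V (MonoidHom.id Q) n (fun s => φ (t.1, Fin.cons (t.1⁻¹ * s.1) s.2)) := by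
      funext s
      exact barD_insert n φ _ s
    rw [this, map_sub, ih, sub_zero, sub_self]
    rfl

theorem barD_barD (ν : G →* Q) (n : ℕ) (φ : BarBasis Q G n → V) :
    barD V ν (n + 1) (barD V ν n φ) = 0 := by
  funext t
  -- pull back along `g ↦ q ν(g)`, where `q` is the left-most coordinate of `t`
  have hf : ∀ q g : G, t.1 * ν (q * (MonoidHom.id G) g) = (t.1 * ν q) * ν g := fun q g => by
    simp [mul_assoc]
  have h := congrFun (barD_barD_id n (fun s : BarBasis G G n => φ (t.1 * ν s.1, s.2))) (1, t.2)
  have h1 : barD V (MonoidHom.id G) n (fun s : BarBasis G G n => φ (t.1 * ν s.1, s.2)) =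
      fun s => barD V ν n φ (t.1 * ν s.1, s.2) :=
    funext fun s => barD_pullback ν (MonoidHom.id G) (fun g => t.1 * ν g) hf n φ s
  rw [h1, barD_pullback ν (MonoidHom.id G) (fun g => t.1 * ν g) hf (n + 1) (barD V ν n φ)] at h
  simpa using h

end BarContraction

/-! ### Relative acyclicity -/

section RelAcyclic

variable {Q G V : Type*} [Group Q] [Group G] [AddCommGroup V] [Module ℚ V]

/-- Acyclicity of the quotient complex `Y / X`: a cochain of `Y` with coboundary in `X` is
cohomologous in `Y` to a cochain of `X`. -/
def RelAcyclic (ν : G →* Q) (X Y : ∀ n, Submodule ℚ (BarBasis Q G n → V)) : Prop :=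
  ∀ n, ∀ φ ∈ Y n, barD V ν n φ ∈ X (n + 1) → ∃ b ∈ coboundaries ν Y n, φ - b ∈ X n

theorem barD_of_mem_coboundaries (ν : G →* Q) (Y : ∀ n, Submodule ℚ (BarBasis Q G n → V)) {n : ℕ}
    {b : BarBasis Q G n → V} (hb : b ∈ coboundaries ν Y n) : barD V ν n b = 0 := by
  cases n with
  | zero =>
    have : b = 0 := hb
    rw [this, map_zero]
  | succ n =>
    obtain ⟨c, -, rfl⟩ := hb
    exact barD_barD ν n c

theorem relAcyclic_of_bijective (ν : G →* Q) {X Y : ∀ n, Submodule ℚ (BarBasis Q G n → V)}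
    (hXY : ∀ n, X n ≤ Y n)
    (h : ∀ n, Function.Bijective (cohomologyMap ν hXY n)) : RelAcyclic ν X Y := by
  intro n φ hφ hdφ
  obtain ⟨ψ, hψ, e⟩ : barD V ν n φ ∈ coboundaries ν X (n + 1) := by
    let z : cocycles ν X (n + 1) := ⟨barD V ν n φ, hdφ, barD_barD ν n φ⟩
    have hz : cohomologyMap ν hXY (n + 1) (Submodule.Quotient.mk z) = 0 := by
      refine (Submodule.Quotient.mk_eq_zero _).2 ?_
      exact ⟨φ, hφ, rfl⟩
    have hz' := (h (n + 1)).1 (hz.trans (map_zero _).symm)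
    exact (Submodule.Quotient.mk_eq_zero
      ((coboundaries ν X (n + 1)).submoduleOf (cocycles ν X (n + 1)))).1 hz'
  have hc : φ - ψ ∈ cocycles ν Y n := by
    refine ⟨sub_mem hφ (hXY n hψ), ?_⟩
    change barD V ν n (φ - ψ) = 0
    rw [map_sub, e, sub_self]
  obtain ⟨v, hv⟩ := (h n).2 (Submodule.Quotient.mk ⟨φ - ψ, hc⟩)
  obtain ⟨χ, rfl⟩ := Submodule.Quotient.mk_surjective _ v
  have hb := (Submodule.Quotient.eq _).1 hv.symm
  refine ⟨φ - ψ - χ, hb, ?_⟩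
  have : φ - (φ - ψ - χ) = ψ + χ := by abel
  rw [this]
  exact add_mem hψ χ.2.1

theorem RelAcyclic.bijective {ν : G →* Q} {X Y : ∀ n, Submodule ℚ (BarBasis Q G n → V)}
    (hXY : ∀ n, X n ≤ Y n) (h : RelAcyclic ν X Y) (n : ℕ) :
    Function.Bijective (cohomologyMap ν hXY n) := by
  constructor
  · rw [injective_iff_map_eq_zero]
    intro v hv
    obtain ⟨φ, rfl⟩ := Submodule.Quotient.mk_surjective _ v
    have hφ : (φ : BarBasis Q G n → V) ∈ coboundaries ν Y n :=
      (Submodule.Quotient.mk_eq_zero ((coboundaries ν Y n).submoduleOf (cocycles ν Y n))).1 hv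
    refine (Submodule.Quotient.mk_eq_zero _).2 ?_
    change (φ : BarBasis Q G n → V) ∈ coboundaries ν X n
    cases n with
    | zero => exact hφ
    | succ n =>
      obtain ⟨ψ, hψ, e⟩ := hφ
      obtain ⟨b, hb, hx⟩ := h n ψ hψ (by rw [e]; exact φ.2.1)
      exact ⟨ψ - b, hx, by rw [map_sub, barD_of_mem_coboundaries ν Y hb, sub_zero, e]⟩
  · intro v
    obtain ⟨φ, rfl⟩ := Submodule.Quotient.mk_surjective _ v
    have hd : barD V ν n φ = 0 := φ.2.2
    obtain ⟨b, hb, hx⟩ := h n φ φ.2.1 (by rw [hd]; exact zero_mem _)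
    refine ⟨Submodule.Quotient.mk ⟨φ - b, hx, ?_⟩, ?_⟩
    · change barD V ν n (φ - b) = 0
      rw [map_sub, hd, barD_of_mem_coboundaries ν Y hb, sub_zero]
    · refine (Submodule.Quotient.eq _).2 ?_
      change (φ - b - φ : BarBasis Q G n → V) ∈ coboundaries ν Y n
      have : (φ - b - φ : BarBasis Q G n → V) = -b := by abel
      rw [this]
      exact neg_mem hb

/-- Transfer of relative acyclicity along pullback in the left-most coordinate. -/
theorem RelAcyclic.transfer {Q' : Type*} [Group Q'] {ν : G →* Q} {ν' : G →* Q'} {f : Q' → Q}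
    (hf : ∀ q g, f (q * ν' g) = f q * ν g) {X Y : ∀ n, Submodule ℚ (BarBasis Q G n → V)}
    {X' Y' : ∀ n, Submodule ℚ (BarBasis Q' G n → V)}
    (hX : ∀ n (φ : BarBasis Q G n → V), φ ∈ X n ↔ (fun s => φ (f s.1, s.2)) ∈ X' n)
    (hY : ∀ n (ψ : BarBasis Q' G n → V), ψ ∈ Y' n ↔ ∃ φ ∈ Y n, ψ = fun s => φ (f s.1, s.2))
    (h : RelAcyclic ν' X' Y') : RelAcyclic ν X Y := by
  intro n φ hφ hdφ
  obtain ⟨b, hb, hx⟩ := h n (fun s => φ (f s.1, s.2)) ((hY n _).2 ⟨φ, hφ, rfl⟩) (by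
    have := (hX _ _).1 hdφ
    convert this using 1
    exact funext fun s => barD_pullback ν ν' f hf n φ s)
  cases n with
  | zero =>
    have hb : b = 0 := hb
    refine ⟨0, zero_mem _, (hX _ _).2 ?_⟩
    rw [hb] at hx
    simpa using hx
  | succ n =>
    obtain ⟨c, hc, rfl⟩ := hb
    obtain ⟨c', hc', rfl⟩ := (hY n c).1 hc
    refine ⟨barD V ν n c', ⟨c', hc', rfl⟩, (hX _ _).2 ?_⟩
    convert hx using 1
    funext s
    simp only [Pi.sub_apply]
    rw [barD_pullback ν ν' f hf n c' s]

/-- The converse of `RelAcyclic.transfer`. -/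
theorem RelAcyclic.pullback {Q' : Type*} [Group Q'] {ν : G →* Q} {ν' : G →* Q'} {f : Q' → Q}
    (hf : ∀ q g, f (q * ν' g) = f q * ν g)
    {X Y : ∀ n, Submodule ℚ (BarBasis Q G n → V)}
    {X' Y' : ∀ n, Submodule ℚ (BarBasis Q' G n → V)}
    (hX : ∀ n (φ : BarBasis Q G n → V), φ ∈ Y n → (φ ∈ X n ↔ (fun s => φ (f s.1, s.2)) ∈ X' n))
    (hdY : ∀ n, ∀ φ ∈ Y n, barD V ν n φ ∈ Y (n + 1))
    (hY : ∀ n (ψ : BarBasis Q' G n → V), ψ ∈ Y' n ↔ ∃ φ ∈ Y n, ψ = fun s => φ (f s.1, s.2))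
    (h : RelAcyclic ν X Y) : RelAcyclic ν' X' Y' := by
  intro n ψ hψ hdψ
  obtain ⟨φ, hφ, rfl⟩ := (hY n ψ).1 hψ
  have e : barD V ν' n (fun s => φ (f s.1, s.2)) = fun s => barD V ν n φ (f s.1, s.2) :=
    funext fun s => barD_pullback ν ν' f hf n φ s
  rw [e] at hdψ
  obtain ⟨b, hb, hx⟩ := h n φ hφ ((hX _ _ (hdY n φ hφ)).2 hdψ)
  have hbY : b ∈ Y n := by
    cases n with
    | zero =>
      have hb : b = 0 := hb
      rw [hb]
      exact zero_mem _
    | succ n =>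
      obtain ⟨c, hc, rfl⟩ := hb
      exact hdY n c hc
  refine ⟨fun s => b (f s.1, s.2), ?_, (hX _ _ (sub_mem hφ hbY)).1 hx⟩
  cases n with
  | zero =>
    have hb : b = 0 := hb
    rw [hb]
    exact zero_mem _
  | succ n =>
    obtain ⟨c, hc, rfl⟩ := hb
    exact ⟨fun s => c (f s.1, s.2), (hY n _).2 ⟨c, hc, rfl⟩,
      funext fun s => barD_pullback ν ν' f hf n c s⟩

end RelAcyclic

/-! ### Polynomially bounded functions -/

section PBoundedFun

variable {G V : Type*} [Group G] [AddCommGroup V] [Module ℚ V] {L : WordLength G}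
  {ρ : Representation ℚ G V} {M : PSStructure.{w} L ρ}

/-- A product of a scalar function and a vector-valued function of polynomial growth has polynomial
growth. -/
theorem IsPBoundedFun.smul {X : Type*} {wt : X → ℝ} {f : X → V}
    (hf : IsPBoundedFun M wt f) {a : X → ℚ}
    (ha : ∃ (C : ℝ) (n : ℕ), ∀ t, ‖a t‖ ≤ C * (1 + wt t) ^ n) :
    IsPBoundedFun M wt (fun t => a t • f t) := by
  obtain ⟨n, hf⟩ := hf
  obtain ⟨D, m, ha⟩ := ha
  refine ⟨m + n, fun x => ?_⟩
  obtain ⟨C, hC⟩ := hf x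
  refine ⟨D * C, fun t => ?_⟩
  have h1 : 0 ≤ M.η x (f t) := apply_nonneg _ _
  rw [map_smul_eq_mul]
  calc ‖a t‖ * M.η x (f t) ≤ (D * (1 + wt t) ^ m) * (C * (1 + wt t) ^ n) :=
        mul_le_mul (ha t) (hC t) h1 ((norm_nonneg _).trans (ha t))
    _ = _ := by ring

theorem IsPBoundedFun.zero {X : Type*} {wt : X → ℝ} : IsPBoundedFun M wt (fun _ => 0) :=
  ⟨0, fun _ => ⟨0, fun t => by simp⟩⟩

theorem IsPBoundedFun.add {X : Type*} {wt : X → ℝ} (hw : ∀ t, 0 ≤ wt t) {f g : X → V}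
    (hf : IsPBoundedFun M wt f) (hg : IsPBoundedFun M wt g) :
    IsPBoundedFun M wt (fun t => f t + g t) := by
  obtain ⟨n₁, h₁⟩ := hf
  obtain ⟨n₂, h₂⟩ := hg
  refine ⟨n₁ + n₂, fun x => ?_⟩
  obtain ⟨C₁, h₁⟩ := h₁ x
  obtain ⟨C₂, h₂⟩ := h₂ x
  refine ⟨|C₁| + |C₂|, fun t => ?_⟩
  have hw : 1 ≤ 1 + wt t := by linarith [hw t]
  have e₁ : C₁ * (1 + wt t) ^ n₁ ≤ |C₁| * (1 + wt t) ^ (n₁ + n₂) := by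
    gcongr <;> first | exact le_abs_self _ | assumption | omega
  have e₂ : C₂ * (1 + wt t) ^ n₂ ≤ |C₂| * (1 + wt t) ^ (n₁ + n₂) := by
    gcongr <;> first | exact le_abs_self _ | assumption | omega
  have := map_add_le_add (M.η x) (f t) (g t)
  have := h₁ t
  have := h₂ t
  linarith

theorem IsPBoundedFun.const_smul {X : Type*} {wt : X → ℝ} {f : X → V}
    (hf : IsPBoundedFun M wt f) (r : ℚ) : IsPBoundedFun M wt (fun t => r • f t) :=
  hf.smul ⟨‖r‖, 0, fun t => by simp⟩

theorem IsPBoundedFun.sum {X ι : Type*} {wt : X → ℝ} (hw : ∀ t, 0 ≤ wt t) (s : Finset ι)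
    {f : ι → X → V} (hf : ∀ i ∈ s, IsPBoundedFun M wt (f i)) :
    IsPBoundedFun M wt (fun t => ∑ i ∈ s, f i t) := by
  induction s using Finset.cons_induction with
  | empty => simpa using IsPBoundedFun.zero
  | cons a s ha ih =>
    simp only [Finset.sum_cons]
    exact (hf a (Finset.mem_cons_self a s)).add hw
      (ih fun i hi => hf i (Finset.mem_cons_of_mem hi))

theorem IsPBoundedFun.comp {X Y : Type*} {wt : X → ℝ} {wt' : Y → ℝ} (hw' : ∀ t, 0 ≤ wt' t)
    {f : Y → V} (hf : IsPBoundedFun M wt' f) (g : X → Y)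
    (hg : ∃ D : ℝ, ∀ t, 1 + wt' (g t) ≤ D * (1 + wt t)) :
    IsPBoundedFun M wt (fun t => f (g t)) := by
  obtain ⟨n, hf⟩ := hf
  obtain ⟨D, hD⟩ := hg
  refine ⟨n, fun x => ?_⟩
  obtain ⟨C, hC⟩ := hf x
  refine ⟨|C| * D ^ n, fun t => ?_⟩
  have h0 := hw' (g t)
  calc M.η x (f (g t)) ≤ C * (1 + wt' (g t)) ^ n := hC (g t)
    _ ≤ |C| * (D * (1 + wt t)) ^ n := by
      gcongr
      · exact le_abs_self C
      · exact hD t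
    _ = _ := by rw [mul_pow]; ring

theorem IsPBoundedFun.comp_le {X Y : Type*} {wt : X → ℝ} {wt' : Y → ℝ} (hw' : ∀ t, 0 ≤ wt' t)
    {f : Y → V} (hf : IsPBoundedFun M wt' f) (g : X → Y) (hg : ∀ t, wt' (g t) ≤ wt t) :
    IsPBoundedFun M wt (fun t => f (g t)) :=
  hf.comp hw' g ⟨1, fun t => by linarith [hg t]⟩

end PBoundedFun

/-! ### Weights of faces -/

section Weights

variable {Q G V : Type*} [Group Q] [Group G] [AddCommGroup V] [Module ℚ V]
  (LQ : WordLength Q) (LG : WordLength G)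

theorem sum_contractNth_le (n : ℕ) (j : Fin (n + 1)) (g : Fin (n + 1) → G) :
    ∑ i, LG (Fin.contractNth j (· * ·) g i) ≤ ∑ i, LG (g i) := by
  induction n with
  | zero => simpa using LG.nonneg _
  | succ n ih =>
    obtain ⟨a, g, rfl⟩ : ∃ a g', g = (Fin.cons a g' : Fin (n + 2) → G) :=
      ⟨g 0, fun i => g i.succ, (Fin.cons_self_tail g).symm⟩
    refine Fin.cases ?_ (fun j => ?_) j
    · rw [contractNth_zero_cons, Fin.sum_univ_succ, Fin.sum_univ_succ, Fin.sum_univ_succ]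
      simp only [Fin.cons_zero, Fin.cons_succ]
      linarith [LG.map_mul_le a (g 0)]
    · rw [contractNth_succ_cons, Fin.sum_univ_succ, Fin.sum_univ_succ]
      simp only [Fin.cons_zero, Fin.cons_succ]
      linarith [ih j g]

theorem barWeight_contractNth_le (n : ℕ) (j : Fin (n + 1)) (t : BarBasis Q G (n + 1)) :
    barWeight LQ LG n (t.1, Fin.contractNth j (· * ·) t.2) ≤ barWeight LQ LG (n + 1) t := by
  simp only [barWeight]
  linarith [sum_contractNth_le LG n j t.2]

theorem barWeight_tail_le {ν : G →* Q} (hν : ∀ g, LQ (ν g) ≤ LG g) (n : ℕ)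
    (t : BarBasis Q G (n + 1)) :
    barWeight LQ LG n (t.1 * ν (t.2 0), fun i => t.2 i.succ) ≤ barWeight LQ LG (n + 1) t := by
  simp only [barWeight, Fin.sum_univ_succ]
  linarith [LQ.map_mul_le t.1 (ν (t.2 0)), hν (t.2 0)]

theorem barWeight_translate_le (n : ℕ) (q : Q) (t : BarBasis Q G n) :
    barWeight LQ LG n (q * t.1, t.2) ≤ LQ q + barWeight LQ LG n t := by
  simp only [barWeight]
  linarith [LQ.map_mul_le q t.1]

theorem barWeight_insert_le (n : ℕ) (b : Q) (t : BarBasis Q Q n) :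
    barWeight LQ LQ (n + 1) (b, Fin.cons (b⁻¹ * t.1) t.2) ≤ 2 * LQ b + barWeight LQ LQ n t := by
  simp only [barWeight, Fin.sum_univ_succ, Fin.cons_zero, Fin.cons_succ]
  linarith [LQ.map_mul_le b⁻¹ t.1, LQ.map_inv b]

theorem le_barWeight (n : ℕ) (t : BarBasis Q G n) : LQ t.1 ≤ barWeight LQ LG n t := by
  have : 0 ≤ ∑ i, LG (t.2 i) := Finset.sum_nonneg fun i _ => LG.nonneg _
  simp only [barWeight]
  linarith

end Weights

/-! ### Equivariant cochains -/

section Equivariant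

variable {G V : Type*} [Group G] [AddCommGroup V] [Module ℚ V] {L : WordLength G}
  {ρ : Representation ℚ G V}

/-- The action of `Γ` on cochains, through a homomorphism `τ : Γ → Q`. -/
def barRepComp {Γ Q A : Type*} [Group Γ] [Group Q] [AddCommGroup A] [Module ℚ A] (H : Type*)
    (τ : Γ →* Q) (ρ : Representation ℚ Q A) (n : ℕ) : Representation ℚ Γ (BarBasis Q H n → A) :=
  MonoidHom.comp (barRep H ρ n) τ

theorem mem_invariants_barRepComp {Γ Q H A : Type*} [Group Γ] [Group Q] [AddCommGroup A] [Module ℚ A]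
    (τ : Γ →* Q) (ρ : Representation ℚ Q A) (n : ℕ) (φ : BarBasis Q H n → A) :
    φ ∈ (barRepComp H τ ρ n).invariants ↔
      ∀ γ t, φ (τ γ * t.1, t.2) = ρ (τ γ) (φ t) := by
  rw [Representation.mem_invariants]
  constructor
  · intro h γ t
    have := congrFun (h γ) (τ γ * t.1, t.2)
    rw [← this]
    change ρ (τ γ) (φ (barAct H n (τ γ)⁻¹ (τ γ * t.1, t.2))) = _
    simp [barAct]
  · intro h γ
    funext t
    change ρ (τ γ) (φ (barAct H n (τ γ)⁻¹ t)) = _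
    rw [← h γ]
    simp [barAct]

theorem mem_homG {n : ℕ} {φ : BarBasis G G n → V} :
    φ ∈ homG ρ n ↔ ∀ g t, φ (g * t.1, t.2) = ρ g (φ t) :=
  mem_invariants_barRepComp (MonoidHom.id G) ρ n φ

/-- The seminorms of a p-semi-normed module are compatible with the action: a change of index by `g`
costs as much as the action of `g`. -/
theorem PSStructure.exists_act_le (M : PSStructure.{w} L ρ) : ∃ (C : ℝ) (n : ℕ), 0 ≤ C ∧
    ∀ x', ∃ x, ∀ g v, M.η (M.act x' g) v ≤ C * (1 + L g) ^ n * M.η x (ρ g v) := by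
  obtain ⟨C, n, h⟩ := M.bounded
  refine ⟨|C|, n, abs_nonneg C, fun x' => ?_⟩
  obtain ⟨x, hx⟩ := h x'
  refine ⟨x, fun g v => ?_⟩
  have h1 := hx g g⁻¹ (ρ g v)
  rw [Representation.inv_self_apply, mul_inv_cancel, M.act_one, L.map_inv] at h1
  have := L.nonneg g
  refine h1.trans ?_
  gcongr
  exact le_abs_self C

/-- For equivariant cochains, polynomial growth is automatically uniform in the group. -/
theorem IsPBoundedFun.uniform {M : PSStructure.{w} L ρ} {n : ℕ} {φ : BarBasis G G n → V}
    (hφ : φ ∈ homG ρ n) (h : IsPBoundedFun M (barWeight L L n) φ) :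
    IsPBoundedFunG M (barWeight L L n) φ := by
  obtain ⟨C, k, hC, hM⟩ := M.exists_act_le
  obtain ⟨m, h⟩ := h
  refine ⟨k + m, fun x' => ?_⟩
  obtain ⟨x, hx⟩ := hM x'
  obtain ⟨D, hD⟩ := h x
  refine ⟨C * |D|, fun g t => ?_⟩
  have h0 := barWeight_nonneg L L n t
  have h0' := barWeight_nonneg L L n (g * t.1, t.2)
  have hg := L.nonneg g
  have h1 : 1 + barWeight L L n (g * t.1, t.2) ≤ (1 + L g) * (1 + barWeight L L n t) := by
    nlinarith [barWeight_translate_le L L n g t]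
  calc M.η (M.act x' g) (φ t) ≤ C * (1 + L g) ^ k * M.η x (ρ g (φ t)) := hx g _
    _ = C * (1 + L g) ^ k * M.η x (φ (g * t.1, t.2)) := by rw [mem_homG.1 hφ]
    _ ≤ C * (1 + L g) ^ k * (|D| * ((1 + L g) * (1 + barWeight L L n t)) ^ m) := by
      gcongr
      refine (hD _).trans ?_
      gcongr
      exact le_abs_self D
    _ = C * |D| * (1 + barWeight L L n t) ^ m * (1 + L g) ^ (k + m) := by
      rw [mul_pow, pow_add]; ring
    _ ≤ _ := by
      gcongr
      · linarith
      · omega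

theorem IsPBoundedFunG.isPBoundedFun {M : PSStructure.{w} L ρ} {X : Type*} {wt : X → ℝ}
    {φ : X → V} (h : IsPBoundedFunG M wt φ) : IsPBoundedFun M wt φ := by
  obtain ⟨n, h⟩ := h
  refine ⟨n, fun x => ?_⟩
  obtain ⟨C, hC⟩ := h x
  refine ⟨C, fun t => ?_⟩
  simpa [M.act_one, L.map_one] using hC 1 t

theorem mem_pHomG {M : PSStructure.{w} L ρ} {n : ℕ} {φ : BarBasis G G n → V} :
    φ ∈ pHomG M n ↔ φ ∈ homG ρ n ∧ IsPBoundedFun M (barWeight L L n) φ :=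
  ⟨fun h => ⟨h.1, h.2.isPBoundedFun⟩, fun h => ⟨h.1, h.2.uniform h.1⟩⟩

theorem hasPBoundedCohomology_iff {M : PSStructure.{w} L ρ} :
    HasPBoundedCohomology M ↔ RelAcyclic (MonoidHom.id G) (pHomG M) (homG ρ) :=
  ⟨fun h => relAcyclic_of_bijective _ _ h, fun h n => h.bijective _ n⟩

/-- The coboundary of an equivariant cochain is equivariant. -/
theorem barD_mem_homG {n : ℕ} {φ : BarBasis G G n → V} (h : φ ∈ homG ρ n) :
    barD V (MonoidHom.id G) n φ ∈ homG ρ (n + 1) := by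
  intro g
  rw [← barD_barRep, h g]

/-- A function on the tuples with left-most coordinate `1` extends to an equivariant cochain. -/
theorem extend_mem_homG (n : ℕ) (c : (Fin n → G) → V) :
    (fun s : BarBasis G G n => ρ s.1 (c s.2)) ∈ homG ρ n :=
  mem_homG.2 fun g t => by simp

theorem apply_eq_of_mem_homG {n : ℕ} {φ : BarBasis G G n → V} (h : φ ∈ homG ρ n)
    (s : BarBasis G G n) : φ s = ρ s.1 (φ (1, s.2)) := by
  rw [← mem_homG.1 h s.1 (1, s.2), mul_one]

end Equivariant

/-! ### Double complexes relative to a subcomplex -/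

section DoubleComplex

variable {F : ℕ → ℕ → Type*} [∀ p q, AddCommGroup (F p q)] [∀ p q, Module ℚ (F p q)]
  (dh : ∀ p q, F p q →ₗ[ℚ] F (p + 1) q) (dv : ∀ p q, F p q →ₗ[ℚ] F p (q + 1))
  (C P : ∀ p q, Submodule ℚ (F p q))

/-- The horizontal coboundaries of those elements of `C` that are vertical cocycles modulo `P`. -/
def horizontalBoundaries : ∀ p q, Submodule ℚ (F p q)
  | 0, _ => ⊥
  | p + 1, q => (C p q ⊓ (P p (q + 1)).comap (dv p q)).map (dh p q)

/-- The vertical coboundaries of those elements of `C` that lie in `Z`. -/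
def verticalBoundaries (Z : ∀ p q, Submodule ℚ (F p q)) : ∀ p q, Submodule ℚ (F p q)
  | _, 0 => ⊥
  | p, q + 1 => (C p q ⊓ Z p q).map (dv p q)

variable {dh dv C P}

/-- Suppose that the rows of `C / P` are exact in positive degrees, and that the vertical cohomology
of `C / P` is horizontally acyclic.  Then every class of `C / P` that is closed in both directions
is, up to a horizontal coboundary of a vertical cocycle, the vertical coboundary of a horizontal
cocycle. -/
theorem exists_horizontal_cocycle
    (hcomm : ∀ p q x, dv (p + 1) q (dh p q x) = dh p (q + 1) (dv p q x))
    (hdh : ∀ p q x, dh (p + 1) q (dh p q x) = 0) (hdv : ∀ p q x, dv p (q + 1) (dv p q x) = 0)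
    (hCh : ∀ p q, ∀ x ∈ C p q, dh p q x ∈ C (p + 1) q)
    (hCv : ∀ p q, ∀ x ∈ C p q, dv p q x ∈ C p (q + 1))
    (hPh : ∀ p q, ∀ x ∈ P p q, dh p q x ∈ P (p + 1) q)
    (hPv : ∀ p q, ∀ x ∈ P p q, dv p q x ∈ P p (q + 1))
    (rows : ∀ p q, ∀ x ∈ C (p + 1) q, dh (p + 1) q x ∈ P (p + 2) q →
      ∃ y ∈ C p q, x - dh p q y ∈ P (p + 1) q)
    (columns : ∀ p q, ∀ x ∈ C p q, dv p q x ∈ P p (q + 1) → dh p q x ∈ P (p + 1) q →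
      ∃ b ∈ horizontalBoundaries dh dv C P p q,
        ∃ b' ∈ verticalBoundaries dv C (fun _ _ => ⊤) p q, x - b - b' ∈ P p q)
    (q p : ℕ) (x : F p q) (hx : x ∈ C p q) (hvx : dv p q x ∈ P p (q + 1))
    (hhx : dh p q x ∈ P (p + 1) q) :
    ∃ b ∈ horizontalBoundaries dh dv C P p q,
      ∃ b' ∈ verticalBoundaries dv C (fun p q => (P (p + 1) q).comap (dh p q)) p q,
        x - b - b' ∈ P p q := by
  induction q generalizing p with
  | zero => exact columns p 0 x hx hvx hhx
  | succ q ih =>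
    obtain ⟨b, hb, b', ⟨w, hw, rfl⟩, h⟩ := columns p (q + 1) x hx hvx hhx
    have hwC : w ∈ C p q := hw.1
    have hdb : dh p (q + 1) b = 0 := by
      cases p with
      | zero =>
        have hb : b = 0 := hb
        rw [hb, map_zero]
      | succ p =>
        obtain ⟨y, -, rfl⟩ := hb
        exact hdh p _ y
    have h1 : dv (p + 1) q (dh p q w) ∈ P (p + 1) (q + 1) := by
      have h2 := sub_mem hhx (hPh _ _ _ h)
      rw [map_sub, map_sub, hdb, sub_zero, sub_sub_cancel] at h2
      rwa [hcomm]
    obtain ⟨b₁, ⟨y', hy', rfl⟩, b₁', hb₁', h3⟩ := ih (p + 1) (dh p q w) (hCh _ _ _ hwC) h1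
      (by rw [hdh]; exact zero_mem _)
    obtain ⟨e, heC, hde, he⟩ : ∃ e ∈ C p q, dv p q e = 0 ∧ dh p q e - b₁' ∈ P (p + 1) q := by
      cases q with
      | zero =>
        have hb₁' : b₁' = 0 := hb₁'
        exact ⟨0, zero_mem _, map_zero _, by rw [hb₁', map_zero, sub_zero]; exact zero_mem _⟩
      | succ q =>
        obtain ⟨w', hw', rfl⟩ := hb₁'
        obtain ⟨v, hv, hvw⟩ := rows p q w' hw'.1 hw'.2
        refine ⟨dv p q v, hCv _ _ _ hv, hdv _ _ _, ?_⟩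
        have := neg_mem (hPv _ _ _ hvw)
        rwa [map_sub, neg_sub, hcomm] at this
    refine ⟨b, hb, dv p q (w - y' - e), ⟨w - y' - e, ⟨sub_mem (sub_mem hwC hy'.1) heC, ?_⟩, rfl⟩, ?_⟩
    · change dh p q (w - y' - e) ∈ P (p + 1) q
      have : dh p q (w - y' - e) =
          dh p q w - dh p q y' - b₁' - (dh p q e - b₁') := by
        rw [map_sub, map_sub]; abel
      rw [this]
      exact sub_mem h3 he
    · have : x - b - dv p q (w - y' - e) = (x - b - dv p q w) + dv p q y' := by
        rw [map_sub, map_sub, hde]; abel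
      rw [this]
      exact add_mem h hy'.2

/-- If moreover the rows of `C / P` are resolutions of a complex `E / PE`, then `E / PE` is
acyclic. -/
theorem exists_augmentation_boundary {E : ℕ → Type*} [∀ q, AddCommGroup (E q)]
    [∀ q, Module ℚ (E q)] {dE : ∀ q, E q →ₗ[ℚ] E (q + 1)} {ε : ∀ q, E q →ₗ[ℚ] F 0 q}
    {CE PE : ∀ q, Submodule ℚ (E q)}
    (hcomm : ∀ p q x, dv (p + 1) q (dh p q x) = dh p (q + 1) (dv p q x))
    (hdh : ∀ p q x, dh (p + 1) q (dh p q x) = 0) (hdv : ∀ p q x, dv p (q + 1) (dv p q x) = 0)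
    (hCh : ∀ p q, ∀ x ∈ C p q, dh p q x ∈ C (p + 1) q)
    (hCv : ∀ p q, ∀ x ∈ C p q, dv p q x ∈ C p (q + 1))
    (hPh : ∀ p q, ∀ x ∈ P p q, dh p q x ∈ P (p + 1) q)
    (hPv : ∀ p q, ∀ x ∈ P p q, dv p q x ∈ P p (q + 1))
    (rows : ∀ p q, ∀ x ∈ C (p + 1) q, dh (p + 1) q x ∈ P (p + 2) q →
      ∃ y ∈ C p q, x - dh p q y ∈ P (p + 1) q)
    (columns : ∀ p q, ∀ x ∈ C p q, dv p q x ∈ P p (q + 1) → dh p q x ∈ P (p + 1) q →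
      ∃ b ∈ horizontalBoundaries dh dv C P p q,
        ∃ b' ∈ verticalBoundaries dv C (fun _ _ => ⊤) p q, x - b - b' ∈ P p q)
    (hε : ∀ q e, dv 0 q (ε q e) = ε (q + 1) (dE q e)) (hdε : ∀ q e, dh 0 q (ε q e) = 0)
    (hεC : ∀ q, ∀ e ∈ CE q, ε q e ∈ C 0 q) (hεP : ∀ q e, ε q e ∈ P 0 q ↔ e ∈ PE q)
    (rows₀ : ∀ q, ∀ x ∈ C 0 q, dh 0 q x ∈ P 1 q → ∃ e ∈ CE q, x - ε q e ∈ P 0 q) :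
    (∀ e ∈ CE 0, dE 0 e ∈ PE 1 → e ∈ PE 0) ∧
      ∀ q, ∀ e ∈ CE (q + 1), dE (q + 1) e ∈ PE (q + 2) → ∃ e' ∈ CE q, e - dE q e' ∈ PE (q + 1) := by
  have key : ∀ q, ∀ e ∈ CE q, dE q e ∈ PE (q + 1) →
      ∃ b' ∈ verticalBoundaries dv C (fun p q => (P (p + 1) q).comap (dh p q)) 0 q,
        ε q e - b' ∈ P 0 q := by
    intro q e he hde
    obtain ⟨b, hb, b', hb', h⟩ := exists_horizontal_cocycle hcomm hdh hdv hCh hCv hPh hPv rows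
      columns q 0 (ε q e) (hεC q e he) (by rw [hε]; exact (hεP _ _).2 hde)
      (by rw [hdε]; exact zero_mem _)
    have hb : b = 0 := hb
    rw [hb, sub_zero] at h
    exact ⟨b', hb', h⟩
  constructor
  · intro e he hde
    obtain ⟨b', hb', h⟩ := key 0 e he hde
    have hb' : b' = 0 := hb'
    rw [hb', sub_zero] at h
    exact (hεP _ _).1 h
  · intro q e he hde
    obtain ⟨_, ⟨w, hw, rfl⟩, h⟩ := key (q + 1) e he hde
    obtain ⟨e', he', h'⟩ := rows₀ q w hw.1 hw.2
    refine ⟨e', he', (hεP _ _).1 ?_⟩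
    have h2 := hPv _ _ _ h'
    have : ε (q + 1) (e - dE q e') = (ε (q + 1) e - dv 0 q w) + dv 0 q (w - ε q e') := by
      rw [map_sub, map_sub, hε]; abel
    rw [this]
    exact add_mem h h2

end DoubleComplex

/-! ### The double complex of a homomorphism -/

theorem barRepComp_translate {Γ Q H A : Type*} [Group Γ] [Group Q] [AddCommGroup A] [Module ℚ A]
    (τ : Γ →* Q) {ρ : Representation ℚ Q A} (n : ℕ) (γ : Γ) (φ : BarBasis Q H n → A)
    (t : BarBasis Q H n) : barRepComp H τ ρ n γ φ (τ γ * t.1, t.2) = ρ (τ γ) (φ t) := by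
  change ρ (τ γ) (φ (barAct H n (τ γ)⁻¹ (τ γ * t.1, t.2))) = _
  simp [barAct]

theorem mem_biC {Γ Q H A : Type*} [Group Γ] [Group Q] [AddCommGroup A] [Module ℚ A]
    {τ : Γ →* Q} {ρ : Representation ℚ Q A} {p q : ℕ} {c : BarBasis Γ Γ p → BarBasis Q H q → A} :
    c ∈ homG (barRepComp H τ ρ q) p ↔
      ∀ γ s t, c (γ * s.1, s.2) (τ γ * t.1, t.2) = ρ (τ γ) (c s t) := by
  rw [mem_homG]
  refine forall_congr' fun γ => forall_congr' fun s => ?_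
  constructor
  · intro h t
    rw [h, barRepComp_translate]
  · intro h
    funext t
    have := h (((τ γ)⁻¹ * t.1, t.2))
    simp only [mul_inv_cancel_left] at this
    rw [this, ← barRepComp_translate]
    simp

section BiComplex

variable {Γ Q H A : Type*} [Group Γ] [Group Q] [Group H] [AddCommGroup A] [Module ℚ A]
  (LΓ : WordLength Γ) {L : WordLength Q} (LH : WordLength H) (τ : Γ →* Q) (ν : H →* Q)
  {ρ : Representation ℚ Q A} (M : PSStructure.{w} L ρ)

theorem barD_barRepComp (n : ℕ) (γ : Γ) (φ : BarBasis Q H n → A) :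
    barD A ν n (barRepComp H τ ρ n γ φ) = barRepComp H τ ρ (n + 1) γ (barD A ν n φ) :=
  barD_barRep ν ρ n (τ γ) φ

/-- The weight of a pair of tuples. -/
def biWeight (L : WordLength Q) (p q : ℕ) (x : BarBasis Γ Γ p × BarBasis Q H q) : ℝ :=
  barWeight LΓ LΓ p x.1 + barWeight L LH q x.2

theorem biWeight_nonneg (p q : ℕ) (x : BarBasis Γ Γ p × BarBasis Q H q) :
    0 ≤ biWeight LΓ LH L p q x :=
  add_nonneg (barWeight_nonneg _ _ _ _) (barWeight_nonneg _ _ _ _)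

/-- The horizontal differential of functions of pairs of tuples. -/
abbrev biDh (Γ Q H A : Type*) [Group Γ] [Group Q] [Group H] [AddCommGroup A] [Module ℚ A]
    (p q : ℕ) : (BarBasis Γ Γ p → BarBasis Q H q → A) →ₗ[ℚ]
      (BarBasis Γ Γ (p + 1) → BarBasis Q H q → A) :=
  barD (BarBasis Q H q → A) (MonoidHom.id Γ) p

/-- The vertical differential of functions of pairs of tuples. -/
def biDv (Γ A : Type*) [Group Γ] [AddCommGroup A] [Module ℚ A] (ν : H →* Q) (p q : ℕ) :
    (BarBasis Γ Γ p → BarBasis Q H q → A) →ₗ[ℚ] (BarBasis Γ Γ p → BarBasis Q H (q + 1) → A) :=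
  (barD A ν q).compLeft (BarBasis Γ Γ p)

theorem biDv_apply (p q : ℕ) (c : BarBasis Γ Γ p → BarBasis Q H q → A) (s : BarBasis Γ Γ p) :
    biDv Γ A ν p q c s = barD A ν q (c s) := rfl

theorem biDh_apply (p q : ℕ) (c : BarBasis Γ Γ p → BarBasis Q H q → A) (s : BarBasis Γ Γ (p + 1))
    (t : BarBasis Q H q) :
    biDh Γ Q H A p q c s t = barD A (MonoidHom.id Γ) p (fun s => c s t) s :=
  (barD_comp (MonoidHom.id Γ) p (LinearMap.proj t : (BarBasis Q H q → A) →ₗ[ℚ] A) c s).symm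

theorem biDv_biDh (p q : ℕ) (c : BarBasis Γ Γ p → BarBasis Q H q → A) :
    biDv Γ A ν (p + 1) q (biDh Γ Q H A p q c) = biDh Γ Q H A p (q + 1) (biDv Γ A ν p q c) := by
  funext s
  exact (barD_comp (MonoidHom.id Γ) p (barD A ν q) c s).symm

variable (H ρ) in
/-- The equivariant functions of pairs of tuples. -/
abbrev biC (p q : ℕ) : Submodule ℚ (BarBasis Γ Γ p → BarBasis Q H q → A) :=
  homG (barRepComp H τ ρ q) p

/-- The equivariant functions of pairs of tuples that grow polynomially in both variables
jointly. -/
def biP (p q : ℕ) : Submodule ℚ (BarBasis Γ Γ p → BarBasis Q H q → A) where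
  carrier := {c | c ∈ biC H τ ρ p q ∧
    IsPBoundedFun M (biWeight LΓ LH L p q) (fun x => c x.1 x.2)}
  zero_mem' := ⟨zero_mem _, IsPBoundedFun.zero⟩
  add_mem' h h' := ⟨add_mem h.1 h'.1, h.2.add (biWeight_nonneg LΓ LH p q) h'.2⟩
  smul_mem' r _ h := ⟨Submodule.smul_mem _ r h.1, h.2.const_smul r⟩

variable (H ρ) in
/-- The invariant cochains in the second variable. -/
abbrev invCochains (q : ℕ) : Submodule ℚ (BarBasis Q H q → A) :=
  (barRepComp H τ ρ q).invariants

/-- The invariant cochains of polynomial growth in the second variable. -/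
def pInvCochains (q : ℕ) : Submodule ℚ (BarBasis Q H q → A) :=
  invCochains H τ ρ q ⊓ pHom M LH q

variable {LΓ LH τ ν M}

theorem isPBoundedFun_barD {Y : Type*} {wY : Y → ℝ} (hY : ∀ y, 0 ≤ wY y)
    {LQ : WordLength Γ} {LH : WordLength H} {ν : H →* Γ} (hν : ∀ g, LQ (ν g) ≤ LH g) (n : ℕ)
    {f : Y → BarBasis Γ H n → A}
    (hf : IsPBoundedFun M (fun x : Y × BarBasis Γ H n => wY x.1 + barWeight LQ LH n x.2)
      (fun x => f x.1 x.2)) :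
    IsPBoundedFun M (fun x : Y × BarBasis Γ H (n + 1) => wY x.1 + barWeight LQ LH (n + 1) x.2)
      (fun x => barD A ν n (f x.1) x.2) := by
  have hw : ∀ m, ∀ x : Y × BarBasis Γ H m, 0 ≤ wY x.1 + barWeight LQ LH m x.2 := fun m x =>
    add_nonneg (hY _) (barWeight_nonneg _ _ _ _)
  simp only [barD_apply]
  refine (hf.comp_le (hw n) (fun x : Y × BarBasis Γ H (n + 1) => (x.1, (x.2.1 * ν (x.2.2 0), fun i => x.2.2 i.succ)))
    fun x => ?_).add (hw _) (IsPBoundedFun.sum (hw _) _ fun j _ => ((hf.comp_le (hw n)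
      (fun x : Y × BarBasis Γ H (n + 1) => (x.1, (x.2.1, Fin.contractNth j (· * ·) x.2.2))) fun x => ?_).const_smul _))
  · simpa using barWeight_tail_le LQ LH hν n x.2
  · simpa using barWeight_contractNth_le LQ LH n j x.2

theorem biDv_mem_biC {p q : ℕ} {c : BarBasis Γ Γ p → BarBasis Q H q → A}
    (hc : c ∈ biC H τ ρ p q) : biDv Γ A ν p q c ∈ biC H τ ρ p (q + 1) := by
  rw [mem_homG] at hc ⊢
  intro γ s
  rw [biDv_apply, biDv_apply, hc, barD_barRepComp]

theorem biDv_mem_biP (hν : ∀ g, L (ν g) ≤ LH g) {p q : ℕ}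
    {c : BarBasis Γ Γ p → BarBasis Q H q → A} (hc : c ∈ biP LΓ LH τ M p q) :
    biDv Γ A ν p q c ∈ biP LΓ LH τ M p (q + 1) :=
  ⟨biDv_mem_biC hc.1, isPBoundedFun_barD (barWeight_nonneg LΓ LΓ p) hν q hc.2⟩

theorem biDh_mem_biP {p q : ℕ} {c : BarBasis Γ Γ p → BarBasis Q H q → A}
    (hc : c ∈ biP LΓ LH τ M p q) : biDh Γ Q H A p q c ∈ biP LΓ LH τ M (p + 1) q := by
  refine ⟨barD_mem_homG hc.1, ?_⟩
  have h1 := hc.2.comp_le (biWeight_nonneg LΓ LH p q)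
    (wt := fun x : BarBasis Q H q × BarBasis Γ Γ p => barWeight L LH q x.1 + barWeight LΓ LΓ p x.2)
    Prod.swap (fun x => (add_comm _ _).le)
  have h2 := (isPBoundedFun_barD (barWeight_nonneg L LH q) (ν := MonoidHom.id Γ)
    (fun _ => le_rfl) p (f := fun t s => c s t) h1).comp_le
      (fun x => add_nonneg (barWeight_nonneg _ _ _ _) (barWeight_nonneg _ _ _ _))
      (wt := biWeight LΓ LH L (p + 1) q) Prod.swap (fun x => (add_comm _ _).le)
  convert h2 using 2 with x
  exact biDh_apply p q c x.1 x.2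

variable {r : Q → Γ} {κ : ℝ}

/-- The rows are contracted by inserting the vertex `r(t)`. -/
theorem biP_rows (hr : ∀ γ x, r (τ γ * x) = γ * r x) (hκ : 0 ≤ κ) (hrL : ∀ x, LΓ (r x) ≤ κ * L x)
    (p q : ℕ) (c : BarBasis Γ Γ (p + 1) → BarBasis Q H q → A) (hc : c ∈ biC H τ ρ (p + 1) q)
    (hdc : biDh Γ Q H A (p + 1) q c ∈ biP LΓ LH τ M (p + 2) q) :
    ∃ y ∈ biC H τ ρ p q, c - biDh Γ Q H A p q y ∈ biP LΓ LH τ M (p + 1) q := by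
  have hy : (fun s t => c (r t.1, Fin.cons ((r t.1)⁻¹ * s.1) s.2) t) ∈ biC H τ ρ p q := by
    rw [mem_biC] at hc ⊢
    intro γ s t
    rw [← hc γ]
    simp [hr, mul_assoc]
  refine ⟨_, hy, sub_mem hc (barD_mem_homG hy), ?_⟩
  have h1 := hdc.2.comp (biWeight_nonneg LΓ LH (p + 2) q) (wt := biWeight LΓ LH L (p + 1) q)
    (fun x => ((r x.2.1, Fin.cons ((r x.2.1)⁻¹ * x.1.1) x.1.2), x.2)) ⟨1 + 2 * κ, fun x => ?_⟩
  · convert h1 using 2 with x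
    rw [biDh_apply, barD_insert, Pi.sub_apply, Pi.sub_apply, biDh_apply]
  · have h2 := barWeight_insert_le LΓ (p + 1) (r x.2.1) x.1
    have h3 := hrL x.2.1
    have h4 := le_barWeight L LH q x.2
    have h5 := barWeight_nonneg LΓ LΓ (p + 1) x.1
    have h6 := barWeight_nonneg L LH q x.2
    have h7 := mul_le_mul_of_nonneg_left h4 hκ
    have h8 := mul_nonneg hκ h5
    simp only [biWeight]
    nlinarith

theorem biP_rows_zero (hr : ∀ γ x, r (τ γ * x) = γ * r x) (hκ : 0 ≤ κ)
    (hrL : ∀ x, LΓ (r x) ≤ κ * L x)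
    (q : ℕ) (c : BarBasis Γ Γ 0 → BarBasis Q H q → A) (hc : c ∈ biC H τ ρ 0 q)
    (hdc : biDh Γ Q H A 0 q c ∈ biP LΓ LH τ M 1 q) :
    ∃ e ∈ invCochains H τ ρ q, c - (fun _ => e) ∈ biP LΓ LH τ M 0 q := by
  have he : (fun t : BarBasis Q H q => c (r t.1, fun i => i.elim0) t) ∈ invCochains H τ ρ q := by
    rw [mem_biC] at hc
    rw [mem_invariants_barRepComp]
    intro γ t
    rw [← hc γ, hr]
  refine ⟨_, he, sub_mem hc (fun γ => funext fun s => he γ), ?_⟩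
  have h1 := hdc.2.comp (biWeight_nonneg LΓ LH 1 q) (wt := biWeight LΓ LH L 0 q)
    (fun x => ((r x.2.1, Fin.cons ((r x.2.1)⁻¹ * x.1.1) x.1.2), x.2)) ⟨1 + 2 * κ, fun x => ?_⟩
  · convert h1 using 2 with x
    rw [biDh_apply, barD_insert_zero, Pi.sub_apply, Pi.sub_apply]
    congr 4
    exact Subsingleton.elim _ _
  · have h2 := barWeight_insert_le LΓ 0 (r x.2.1) x.1
    have h3 := hrL x.2.1
    have h4 := le_barWeight L LH q x.2
    have h5 := barWeight_nonneg LΓ LΓ 0 x.1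
    have h6 := barWeight_nonneg L LH q x.2
    have h7 := mul_le_mul_of_nonneg_left h4 hκ
    have h8 := mul_nonneg hκ h5
    simp only [biWeight]
    nlinarith

/-- If the vertical cohomology of the double complex is horizontally acyclic relative to joint
polynomial growth, then polynomial growth does not change the cohomology of the invariants. -/
theorem relAcyclic_of_columns (hν : ∀ g, L (ν g) ≤ LH g) (hr : ∀ γ x, r (τ γ * x) = γ * r x)
    (hκ : 0 ≤ κ) (hrL : ∀ x, LΓ (r x) ≤ κ * L x)
    (columns : ∀ p q, ∀ x ∈ biC H τ ρ p q, biDv Γ A ν p q x ∈ biP LΓ LH τ M p (q + 1) →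
      biDh Γ Q H A p q x ∈ biP LΓ LH τ M (p + 1) q →
      ∃ b ∈ horizontalBoundaries (biDh Γ Q H A) (biDv Γ A ν) (biC H τ ρ) (biP LΓ LH τ M) p q,
        ∃ b' ∈ verticalBoundaries (biDv Γ A ν) (biC H τ ρ) (fun _ _ => ⊤) p q,
          x - b - b' ∈ biP LΓ LH τ M p q) :
    RelAcyclic ν (pInvCochains LH τ M) (invCochains H τ ρ) := by
  obtain ⟨h0, h1⟩ := exists_augmentation_boundary (dh := biDh Γ Q H A) (dv := biDv Γ A ν)
    (C := biC H τ ρ) (P := biP LΓ LH τ M) (E := fun q => BarBasis Q H q → A) (dE := barD A ν)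
    (ε := fun q => LinearMap.pi fun _ => LinearMap.id) (CE := invCochains H τ ρ)
    (PE := pInvCochains LH τ M)
    (biDv_biDh ν) (fun p q x => barD_barD _ _ _)
    (fun p q x => funext fun s => barD_barD _ _ _)
    (fun p q x hx => barD_mem_homG hx) (fun p q x hx => biDv_mem_biC hx)
    (fun p q x hx => biDh_mem_biP hx) (fun p q x hx => biDv_mem_biP hν hx)
    (biP_rows hr hκ hrL) columns (fun q e => rfl)
    (fun q e => by
      funext s
      simp [barD_apply])
    (fun q e he γ => funext fun s => he γ)
    (fun q e => by
      constructor
      · intro h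
        refine ⟨fun γ => ?_, ?_⟩
        · exact congrFun (h.1 γ) ((1, fun _ => 1) : BarBasis Γ Γ 0)
        · refine h.2.comp (biWeight_nonneg LΓ LH 0 q) (wt := barWeight L LH q)
            (fun t => ((1, fun _ => 1), t)) ⟨2, fun t => ?_⟩
          have := barWeight_nonneg L LH q t
          simp only [biWeight, barWeight, LΓ.map_one] at this ⊢
          simp only [Finset.univ_eq_empty, Finset.sum_empty]
          linarith
      · intro h
        refine ⟨fun γ => funext fun s => h.1 γ, ?_⟩
        have h2 : IsPBoundedFun M (barWeight L LH q) e := h.2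
        exact h2.comp_le (barWeight_nonneg L LH q) (wt := biWeight LΓ LH L 0 q) Prod.snd
          (fun x => le_add_of_nonneg_left (barWeight_nonneg _ _ _ _)))
    (biP_rows_zero hr hκ hrL)
  intro q e he hde
  cases q with
  | zero => exact ⟨0, zero_mem _, by simpa using h0 e he hde⟩
  | succ q =>
    obtain ⟨e', he', h⟩ := h1 q e he hde
    exact ⟨_, ⟨e', he', rfl⟩, h⟩

end BiComplex

/-! ### From the cohomology of the kernel to the cohomology of the fibre complex -/

section ColumnContraction

variable {Γ Q A : Type*} [Group Γ] [Group Q] [AddCommGroup A] [Module ℚ A]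
  {LΓ : WordLength Γ} {L : WordLength Q} {τ : Γ →* Q}
  {ρ : Representation ℚ Q A} {M : PSStructure.{w} L ρ}

theorem barD_const_zero {H : Type*} [Group H] (ν : H →* Q) (a : A) :
    barD A ν 0 (fun _ => a) = 0 := by
  funext t
  simp [barD_apply]

theorem biWeight_insert_le (hτ : ∀ γ, L (τ γ) ≤ LΓ γ) (p q : ℕ)
    (x : BarBasis Γ Γ p × BarBasis Q Q q) :
    1 + biWeight LΓ L L p (q + 1) (x.1, (τ x.1.1, Fin.cons ((τ x.1.1)⁻¹ * x.2.1) x.2.2)) ≤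
      3 * (1 + biWeight LΓ L L p q x) := by
  have h2 := barWeight_insert_le L q (τ x.1.1) x.2
  have h3 := hτ x.1.1
  have h4 := le_barWeight LΓ LΓ p x.1
  have h6 := barWeight_nonneg L L q x.2
  simp only [biWeight]
  linarith

/-- If the second variable ranges over the bar resolution of `Q`, then the columns are contracted by
inserting the image of the left-most vertex of the first variable.  What remains is the complex
that computes the cohomology of `Γ`. -/
theorem columns_of_relAcyclic (hτ : ∀ γ, L (τ γ) ≤ LΓ γ)
    (h : RelAcyclic (MonoidHom.id Γ) (pHomG (M.comap τ hτ))
      (homG (MonoidHom.comp ρ τ : Representation ℚ Γ A)))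
    (p q : ℕ) (x : BarBasis Γ Γ p → BarBasis Q Q q → A) (hx : x ∈ biC Q τ ρ p q)
    (hvx : biDv Γ A (MonoidHom.id Q) p q x ∈ biP LΓ L τ M p (q + 1))
    (hhx : biDh Γ Q Q A p q x ∈ biP LΓ L τ M (p + 1) q) :
    ∃ b ∈ horizontalBoundaries (biDh Γ Q Q A) (biDv Γ A (MonoidHom.id Q)) (biC Q τ ρ)
      (biP LΓ L τ M) p q,
      ∃ b' ∈ verticalBoundaries (biDv Γ A (MonoidHom.id Q)) (biC Q τ ρ) (fun _ _ => ⊤) p q,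
        x - b - b' ∈ biP LΓ L τ M p q := by
  have hx' := mem_biC.1 hx
  cases q with
  | succ q =>
    have hy : (fun s t => x s (τ s.1, Fin.cons ((τ s.1)⁻¹ * t.1) t.2)) ∈ biC Q τ ρ p q := by
      rw [mem_biC]
      intro γ s t
      rw [← hx' γ]
      simp [mul_assoc]
    have hdy := biDv_mem_biC (ν := MonoidHom.id Q) hy
    refine ⟨0, zero_mem _, _, ⟨_, ⟨hy, trivial⟩, rfl⟩, ?_⟩
    rw [sub_zero]
    refine ⟨sub_mem hx hdy, ?_⟩
    have h1 := hvx.2.comp (biWeight_nonneg LΓ L p (q + 2)) (wt := biWeight LΓ L L p (q + 1))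
      (fun x => (x.1, (τ x.1.1, Fin.cons ((τ x.1.1)⁻¹ * x.2.1) x.2.2)))
      ⟨3, biWeight_insert_le hτ p (q + 1)⟩
    convert h1 using 2 with z
    rw [biDv_apply, barD_insert, Pi.sub_apply, Pi.sub_apply, biDv_apply]
  | zero =>
    let e : BarBasis Γ Γ p → A := fun s => x s (τ s.1, fun i => i.elim0)
    have he : e ∈ homG (MonoidHom.comp ρ τ : Representation ℚ Γ A) p := by
      rw [mem_homG]
      intro γ s
      change x (γ * s.1, s.2) (τ (γ * s.1), fun i => i.elim0) = ρ (τ γ) _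
      rw [map_mul]
      exact hx' γ s (τ s.1, fun i => i.elim0)
    have hmem : ∀ {p : ℕ} {f : BarBasis Γ Γ p → A},
        f ∈ homG (MonoidHom.comp ρ τ : Representation ℚ Γ A) p →
        (fun s (_ : BarBasis Q Q 0) => f s) ∈ biC Q τ ρ p 0 := fun hf =>
      mem_biC.2 fun γ s _ => mem_homG.1 hf γ s
    have hP : ∀ {p : ℕ} {f : BarBasis Γ Γ p → A}, f ∈ pHomG (M.comap τ hτ) p →
        (fun s (_ : BarBasis Q Q 0) => f s) ∈ biP LΓ L τ M p 0 := by
      intro p f hf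
      rw [mem_pHomG] at hf
      refine ⟨hmem hf.1, ?_⟩
      have h2 : IsPBoundedFun M (barWeight LΓ LΓ p) f := hf.2
      exact h2.comp_le (barWeight_nonneg LΓ LΓ p) Prod.fst
        (fun x => le_add_of_nonneg_right (barWeight_nonneg _ _ _ _))
    have hxe : x - (fun s _ => e s) ∈ biP LΓ L τ M p 0 := by
      refine ⟨sub_mem hx (hmem he), ?_⟩
      have h1 := hvx.2.comp (biWeight_nonneg LΓ L p 1) (wt := biWeight LΓ L L p 0)
        (fun x => (x.1, (τ x.1.1, Fin.cons ((τ x.1.1)⁻¹ * x.2.1) x.2.2)))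
        ⟨3, biWeight_insert_le hτ p 0⟩
      convert h1 using 2 with z
      rw [biDv_apply, barD_insert_zero, Pi.sub_apply, Pi.sub_apply]
      rw [show z.2.2 = fun i => i.elim0 from Subsingleton.elim _ _]
    have hde : barD A (MonoidHom.id Γ) p e ∈ pHomG (M.comap τ hτ) (p + 1) := by
      rw [mem_pHomG]
      refine ⟨barD_mem_homG he, ?_⟩
      have h1 := sub_mem hhx (biDh_mem_biP hxe)
      rw [map_sub, sub_sub_cancel] at h1
      have h2 := h1.2.comp (biWeight_nonneg LΓ L (p + 1) 0) (wt := barWeight LΓ LΓ (p + 1))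
        (fun s => (s, (1, fun i => i.elim0))) ⟨2, fun s => ?_⟩
      · change IsPBoundedFun M (barWeight LΓ LΓ (p + 1)) _
        convert h2 using 2 with s
        rw [biDh_apply]
      · have := barWeight_nonneg LΓ LΓ (p + 1) s
        simp only [biWeight, barWeight, L.map_one] at this ⊢
        simp only [Finset.univ_eq_empty, Finset.sum_empty]
        linarith
    obtain ⟨b, hb, hbe⟩ := h p e he hde
    have key : ∀ b₀, (fun s _ => b s) = b₀ → x - b₀ - 0 ∈ biP LΓ L τ M p 0 := by
      rintro _ rfl
      have h3 := add_mem hxe (hP hbe)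
      convert h3 using 1
      funext s t
      simp only [Pi.add_apply, Pi.sub_apply, Pi.zero_apply]
      abel
    cases p with
    | zero =>
      have hb : b = 0 := hb
      exact ⟨0, zero_mem _, 0, zero_mem _, key 0 (by rw [hb]; rfl)⟩
    | succ p =>
      obtain ⟨b₁, hb₁, rfl⟩ := hb
      refine ⟨_, ⟨fun s _ => b₁ s, ⟨hmem hb₁, ?_⟩, rfl⟩, 0, zero_mem _, key _ ?_⟩
      · change biDv Γ A (MonoidHom.id Q) p 0 (fun s _ => b₁ s) ∈ biP LΓ L τ M p 1
        have : biDv Γ A (MonoidHom.id Q) p 0 (fun s _ => b₁ s) = 0 :=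
          funext fun s => barD_const_zero (MonoidHom.id Q) (b₁ s)
        rw [this]
        exact zero_mem _
      · funext s t
        rw [biDh_apply]

end ColumnContraction

section Extension

variable {K G N A : Type*} [Group K] [Group G] [Group N] [AddCommGroup A] [Module ℚ A]
  {LK : WordLength K} {LG : WordLength G} {LN : WordLength N} {ι : K →* G} {π : G →* N}

/-- A set-theoretic section of minimal length. -/
theorem IsWordLengthExtension.exists_section (hE : IsWordLengthExtension LK LG LN ι π) :
    ∃ σ : N → G, (∀ n, π (σ n) = n) ∧ ∀ n, LG (σ n) = LN n := by
  have : ∀ n, ∃ g, π g = n ∧ LG g = LN n := by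
    intro n
    obtain ⟨g, rfl⟩ := hE.surjective n
    exact (hE.hom_right g).1
  choose σ h1 h2 using this
  exact ⟨σ, h1, h2⟩

theorem IsWordLengthExtension.length_eq (hE : IsWordLengthExtension LK LG LN ι π) (k : K) :
    LG (ι k) = LK k := by
  obtain ⟨h, e, e'⟩ := (hE.hom_left k).1
  rw [← e', hE.injective e]

theorem IsWordLengthExtension.comp_eq_one (hE : IsWordLengthExtension LK LG LN ι π) (k : K) :
    π (ι k) = 1 := by
  have : ι k ∈ π.ker := hE.exact ▸ ⟨k, rfl⟩
  exact this

/-- A `K`-equivariant retraction `G → K` of linear growth. -/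
theorem IsWordLengthExtension.exists_retraction (hE : IsWordLengthExtension LK LG LN ι π) :
    ∃ r : G → K, (∀ k g, r (ι k * g) = k * r g) ∧ ∀ g, LK (r g) ≤ 2 * LG g := by
  obtain ⟨σ, h1, h2⟩ := hE.exists_section
  have : ∀ g, ∃ k, ι k = g * (σ (π g))⁻¹ := by
    intro g
    have : g * (σ (π g))⁻¹ ∈ π.ker := by
      rw [MonoidHom.mem_ker, map_mul, map_inv, h1, mul_inv_cancel]
    rwa [← hE.exact] at this
  choose r hr using this
  refine ⟨r, fun k g => hE.injective ?_, fun g => ?_⟩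
  · rw [hr, map_mul ι, hr, map_mul π, hE.comp_eq_one, one_mul, mul_assoc]
  · rw [← hE.length_eq, hr]
    have h3 := LG.map_mul_le g (σ (π g))⁻¹
    rw [LG.map_inv, h2] at h3
    linarith [hE.hom_right.le g]

variable {ρ : Representation ℚ N A} {M : PSStructure.{w} LN ρ}

theorem isPBoundedFun_pullback_iff (hE : IsWordLengthExtension LK LG LN ι π) {n : ℕ}
    {φ : BarBasis N G n → A} :
    IsPBoundedFun M (barWeight LG LG n) (fun s => φ (π s.1, s.2)) ↔
      IsPBoundedFun M (barWeight LN LG n) φ := by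
  obtain ⟨σ, h1, h2⟩ := hE.exists_section
  constructor
  · intro h
    have h3 := h.comp_le (barWeight_nonneg LG LG n) (wt := barWeight LN LG n)
      (fun t : BarBasis N G n => (σ t.1, t.2)) (fun t => by simp only [barWeight, h2]; rfl)
    simpa only [h1] using h3
  · intro h
    exact h.comp_le (barWeight_nonneg LN LG n) (fun s : BarBasis G G n => (π s.1, s.2))
      (fun s => by
        have := hE.hom_right.le s.1
        simp only [barWeight]
        linarith)

/-- The p-bounded cochains on `K \ EG` compute the cohomology of `K`. -/
theorem fibre_relAcyclic (hE : IsWordLengthExtension LK LG LN ι π)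
    (hK : HasPBoundedCohomology (M.comap (LH := LK) (π.comp ι) hE.le_comp)) :
    RelAcyclic π (pHom M LG) (fun _ => ⊤) := by
  obtain ⟨r, hr, hrL⟩ := hE.exists_retraction
  obtain ⟨σ, h1, h2⟩ := hE.exists_section
  have hι : ∀ k, LG (ι k) ≤ LK k := fun k => (hE.length_eq k).le
  have hK' := hasPBoundedCohomology_iff.1 hK
  have h := relAcyclic_of_columns (LΓ := LK) (LH := LG) (τ := ι) (ν := MonoidHom.id G)
    (M := M.comap (LH := LG) π hE.hom_right.le) (r := r) (κ := 2) (fun g => le_rfl) hr (by norm_num)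
    hrL (columns_of_relAcyclic hι hK')
  refine RelAcyclic.transfer (f := π) (fun q g => map_mul π q g) (fun n φ => ?_) (fun n ψ => ?_) h
  · constructor
    · intro hφ
      refine ⟨(mem_invariants_barRepComp ι _ n _).2 fun k t => ?_,
        (isPBoundedFun_pullback_iff hE).2 hφ⟩
      change _ = ρ (π (ι k)) _
      simp only [map_mul, hE.comp_eq_one, one_mul, map_one, Module.End.one_apply]
    · intro hφ
      exact (isPBoundedFun_pullback_iff hE).1 hφ.2
  · rw [mem_invariants_barRepComp]
    constructor
    · intro hψ
      refine ⟨fun t => ψ (σ t.1, t.2), trivial, funext fun s => ?_⟩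
      have : s.1 * (σ (π s.1))⁻¹ ∈ ι.range := by
        rw [hE.exact, MonoidHom.mem_ker, map_mul, map_inv, h1, mul_inv_cancel]
      obtain ⟨k, hk⟩ := this
      have h3 := hψ k (σ (π s.1), s.2)
      have h4 : (MonoidHom.comp ρ π : Representation ℚ G A) (ι k) = 1 := by
        change ρ (π (ι k)) = 1
        rw [hE.comp_eq_one, map_one]
      rw [h4, Module.End.one_apply, hk, inv_mul_cancel_right] at h3
      exact h3
    · rintro ⟨φ, -, rfl⟩ k t
      change _ = ρ (π (ι k)) _
      simp only [map_mul, hE.comp_eq_one, one_mul, map_one, Module.End.one_apply]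

/-- Cochains on `EG` and `N`-invariant cochains on `K \ EG` have the same p-bounded cohomology. -/
theorem relAcyclic_of_invCochains (hE : IsWordLengthExtension LK LG LN ι π)
    (h : RelAcyclic π (pInvCochains LG (MonoidHom.id N) M) (invCochains G (MonoidHom.id N) ρ)) :
    RelAcyclic (MonoidHom.id G) (pHomG (M.comap (LH := LG) π hE.hom_right.le))
      (homG (MonoidHom.comp ρ π : Representation ℚ G A)) := by
  obtain ⟨σ, h1, h2⟩ := hE.exists_section
  have hpull : ∀ {n} {φ : BarBasis N G n → A}, φ ∈ invCochains G (MonoidHom.id N) ρ n →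
      (fun s : BarBasis G G n => φ (π s.1, s.2)) ∈
        homG (MonoidHom.comp ρ π : Representation ℚ G A) n := by
    intro n φ hφ
    rw [mem_invariants_barRepComp] at hφ
    rw [mem_homG]
    intro g t
    change φ (π (g * t.1), t.2) = ρ (π g) _
    rw [map_mul]
    exact hφ (π g) (π t.1, t.2)
  refine RelAcyclic.pullback (f := π) (fun q g => map_mul π q g) (fun n φ hφ => ?_)
    (fun n φ hφ => ?_) (fun n ψ => ?_) h
  · rw [mem_pHomG]
    constructor
    · intro h
      exact ⟨hpull hφ, (isPBoundedFun_pullback_iff hE).2 h.2⟩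
    · intro h
      exact ⟨hφ, (isPBoundedFun_pullback_iff hE).1 h.2⟩
  · intro n
    rw [← barD_barRepComp, hφ n]
  · constructor
    · intro hψ
      rw [mem_homG] at hψ
      have hσ : ∀ (s : G) (g : Fin n → G), ψ (σ (π s), g) = ψ (s, g) := by
        intro s g
        have h3 := hψ (s * (σ (π s))⁻¹) (σ (π s), g)
        have h4 : (MonoidHom.comp ρ π : Representation ℚ G A) (s * (σ (π s))⁻¹) = 1 := by
          change ρ (π _) = 1
          rw [map_mul, map_inv, h1, mul_inv_cancel, map_one]
        rw [h4, Module.End.one_apply, inv_mul_cancel_right] at h3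
        exact h3.symm
      refine ⟨fun t => ψ (σ t.1, t.2), ?_, funext fun s => (hσ s.1 s.2).symm⟩
      rw [mem_invariants_barRepComp]
      intro n t
      have h5 := hψ (σ n) (σ t.1, t.2)
      rw [← hσ, map_mul, h1, h1] at h5
      rw [MonoidHom.id_apply, h5]
      change ρ (π (σ n)) _ = _
      rw [h1]
    · rintro ⟨φ, hφ, rfl⟩
      exact hpull hφ

end Extension

/-! ### The Hahn–Banach theorem and uniform boundedness over the rational numbers -/

section HahnBanach

/-- One step of the Hahn–Banach extension. -/
theorem exists_lt_extension {E : Type*} [AddCommGroup E] [Module ℚ E] (p : Seminorm ℚ E)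
    (f : E →ₗ.[ℚ] ℝ) (hf : ∀ x : f.domain, f x ≤ p x) (hdom : f.domain ≠ ⊤) :
    ∃ g, f < g ∧ ∀ x : g.domain, g x ≤ p x := by
  obtain ⟨y, -, hy⟩ : ∃ y ∈ (⊤ : Submodule ℚ E), y ∉ f.domain :=
    SetLike.exists_of_lt (lt_top_iff_ne_top.2 hdom)
  obtain ⟨c, hc₁, hc₂⟩ : ∃ c : ℝ, (∀ x : f.domain, f x - p (x - y) ≤ c) ∧
      ∀ x : f.domain, c ≤ p (x + y) - f x := by
    obtain ⟨c, hc₁, hc₂⟩ := exists_between_of_forall_le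
      (Set.range_nonempty fun x : f.domain => f x - p (x - y))
      (Set.range_nonempty fun x : f.domain => p (x + y) - f x) (by
        rintro _ ⟨x, rfl⟩ _ ⟨x', rfl⟩
        have h1 := hf (x + x')
        rw [f.map_add] at h1
        have h2 := map_add_le_add p ((x : E) - y) (x' + y)
        have h3 : (x : E) - y + (x' + y) = ((x + x' : f.domain) : E) := by
          rw [Submodule.coe_add]; abel
        rw [h3] at h2
        linarith)
    exact ⟨c, fun x => hc₁ ⟨x, rfl⟩, fun x => hc₂ ⟨x, rfl⟩⟩
  refine ⟨f.supSpanSingleton y c hy, ?_, ?_⟩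
  · refine lt_iff_le_not_ge.2 ⟨f.left_le_sup _ _, fun H => ?_⟩
    replace H := LinearPMap.domain_mono.monotone H
    rw [LinearPMap.domain_supSpanSingleton, sup_le_iff, Submodule.span_le,
      Set.singleton_subset_iff] at H
    exact hy H.2
  · rintro ⟨z, hz⟩
    rcases Submodule.mem_sup.1 hz with ⟨x, hx, y', hy', rfl⟩
    rcases Submodule.mem_span_singleton.1 hy' with ⟨r, rfl⟩
    rw [LinearPMap.supSpanSingleton_apply_mk _ _ _ _ _ hx, RingHom.id_apply]
    change f ⟨x, hx⟩ + r • c ≤ p (x + r • y)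
    have hx' : ∀ s : ℚ, s ≠ 0 → f ⟨x, hx⟩ = s * f (s⁻¹ • ⟨x, hx⟩) := by
      intro s hs
      rw [f.map_smul, Rat.smul_def, ← mul_assoc, ← Rat.cast_mul, mul_inv_cancel₀ hs, Rat.cast_one,
        one_mul]
    rcases lt_trichotomy r 0 with hr | rfl | hr
    · have h1 := hc₁ ((-r)⁻¹ • ⟨x, hx⟩)
      have h2 : p (x + r • y) = (-r : ℚ) * p (((-r)⁻¹ • (⟨x, hx⟩ : f.domain) : f.domain) - y) := by
        have h3 : x + r • y = (-r) • (((-r)⁻¹ • (⟨x, hx⟩ : f.domain) : f.domain) - y) := by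
          rw [smul_sub, Submodule.coe_smul, smul_smul, mul_inv_cancel₀ (by linarith), one_smul,
            neg_smul, sub_neg_eq_add]
        conv_lhs => rw [h3]
        rw [map_smul_eq_mul, ← Rat.norm_cast_real, Real.norm_of_nonneg]
        exact_mod_cast (by linarith : (0 : ℚ) ≤ -r)
      have hr' : (0 : ℝ) < ((-r : ℚ) : ℝ) := by exact_mod_cast (by linarith : (0 : ℚ) < -r)
      rw [h2, hx' (-r) (by linarith), Rat.smul_def]
      have h4 := mul_le_mul_of_nonneg_left h1 hr'.le
      push_cast at h4 ⊢
      linarith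
    · simpa using hf ⟨x, hx⟩
    · have h1 := hc₂ (r⁻¹ • ⟨x, hx⟩)
      have h2 : p (x + r • y) = (r : ℚ) * p ((r⁻¹ • (⟨x, hx⟩ : f.domain) : f.domain) + y) := by
        have h3 : x + r • y = r • ((r⁻¹ • (⟨x, hx⟩ : f.domain) : f.domain) + y) := by
          rw [smul_add, Submodule.coe_smul, smul_smul, mul_inv_cancel₀ hr.ne', one_smul]
        conv_lhs => rw [h3]
        rw [map_smul_eq_mul, ← Rat.norm_cast_real, Real.norm_of_nonneg]
        exact_mod_cast hr.le
      have hr' : (0 : ℝ) < (r : ℝ) := by exact_mod_cast hr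
      rw [h2, hx' r hr.ne', Rat.smul_def]
      have h4 := mul_le_mul_of_nonneg_left h1 hr'.le
      linarith

/-- The Hahn–Banach theorem for real-valued functionals on a rational vector space. -/
theorem exists_functional_le {E : Type*} [AddCommGroup E] [Module ℚ E] (p : Seminorm ℚ E)
    (x₀ : E) : ∃ f : E →ₗ[ℚ] ℝ, (∀ x, |f x| ≤ p x) ∧ f x₀ = p x₀ := by
  by_cases h0 : p x₀ = 0
  · exact ⟨0, fun x => by simp, by simp [h0]⟩
  have hx₀ : x₀ ≠ 0 := fun h => h0 (by rw [h, map_zero])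
  let f₀ : E →ₗ.[ℚ] ℝ := LinearPMap.mkSpanSingleton x₀ (p x₀) hx₀
  set S := {f : E →ₗ.[ℚ] ℝ | ∀ x : f.domain, f x ≤ p x}
  have hf₀ : f₀ ∈ S := by
    rintro ⟨x, hx⟩
    obtain ⟨r, rfl⟩ := Submodule.mem_span_singleton.1 hx
    have : f₀ ⟨r • x₀, hx⟩ = r • p x₀ := LinearPMap.mkSpanSingleton'_apply _ _ _ _ _
    rw [this]
    change r • p x₀ ≤ p (r • x₀)
    rw [map_smul_eq_mul, Rat.smul_def, ← Rat.norm_cast_real]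
    exact mul_le_mul_of_nonneg_right (le_abs_self _) (apply_nonneg _ _)
  have hSc : ∀ c, c ⊆ S → IsChain (· ≤ ·) c → ∀ y ∈ c, ∃ ub ∈ S, ∀ z ∈ c, z ≤ ub := by
    intro c hcs c_chain y hy
    have cne : c.Nonempty := ⟨y, hy⟩
    have hcd : DirectedOn (· ≤ ·) c := c_chain.directedOn
    refine ⟨LinearPMap.sSup c hcd, ?_, fun _ => LinearPMap.le_sSup hcd⟩
    rintro ⟨x, hx⟩
    have hdir : DirectedOn (· ≤ ·) (LinearPMap.domain '' c) :=
      directedOn_image.2 (hcd.mono LinearPMap.domain_mono.monotone)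
    rcases (Submodule.mem_sSup_of_directed (cne.image _) hdir).1 hx with ⟨_, ⟨f, hfc, rfl⟩, hfx⟩
    have h1 : f ≤ LinearPMap.sSup c hcd := LinearPMap.le_sSup _ hfc
    have h2 : f ⟨x, hfx⟩ = LinearPMap.sSup c hcd ⟨x, hx⟩ := h1.2 rfl
    rw [← h2]
    exact hcs hfc ⟨x, hfx⟩
  obtain ⟨q, hpq, hqs, hq⟩ := zorn_le_nonempty₀ S hSc f₀ hf₀
  have hdom : q.domain = ⊤ := by
    by_contra hne
    obtain ⟨g, hg, hgS⟩ := exists_lt_extension p q hqs hne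
    exact hg.not_ge (hq hgS hg.le)
  let f : E →ₗ[ℚ] ℝ := q.toFun ∘ₗ LinearMap.codRestrict q.domain LinearMap.id
    (fun x => hdom ▸ Submodule.mem_top)
  have hf : ∀ x, f x ≤ p x := fun x => hqs ⟨x, _⟩
  refine ⟨f, fun x => abs_le.2 ⟨?_, hf x⟩, ?_⟩
  · have := hf (-x)
    rw [map_neg, map_neg_eq_map] at this
    linarith
  · have h1 : f₀ ⟨x₀, Submodule.mem_span_singleton_self x₀⟩ = p x₀ :=
      LinearPMap.mkSpanSingleton_apply ℚ ℚ hx₀ _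
    rw [← h1]
    exact (hpq.2 rfl).symm

/-- A sequence in a rational seminormed space that is dominated by the positive numbers `a j` when
tested against each functional is dominated by a multiple of them in norm. -/
theorem exists_norm_le_of_functionals {E : Type*} [SeminormedAddCommGroup E] [NormedSpace ℚ E]
    (z : ℕ → E) (a : ℕ → ℝ) (ha : ∀ j, 0 < a j)
    (h : ∀ f : E →L[ℚ] ℝ, ∃ C : ℝ, ∀ j, |f (z j)| ≤ C * a j) :
    ∃ D : ℝ, ∀ j, ‖z j‖ ≤ D * a j := by
  let ev : ℕ → (E →L[ℚ] ℝ) →L[ℝ] ℝ := fun j =>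
    LinearMap.mkContinuous
      { toFun := fun f => (a j)⁻¹ * f (z j)
        map_add' := fun f g => by simp [mul_add]
        map_smul' := fun r f => by simp; ring } ((a j)⁻¹ * ‖z j‖) (fun f => by
          have h1 := f.le_opNorm (z j)
          have h2 := inv_pos.2 (ha j)
          simp only [LinearMap.coe_mk, AddHom.coe_mk, norm_mul, Real.norm_of_nonneg h2.le]
          calc (a j)⁻¹ * ‖f (z j)‖ ≤ (a j)⁻¹ * (‖f‖ * ‖z j‖) := by gcongr
            _ = _ := by ring)
  have hev : ∀ j f, ev j f = (a j)⁻¹ * f (z j) := fun j f => rfl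
  obtain ⟨D, hD⟩ := banach_steinhaus (g := ev) (fun f => by
    obtain ⟨C, hC⟩ := h f
    refine ⟨C, fun j => ?_⟩
    rw [hev, norm_mul, norm_inv, Real.norm_of_nonneg (ha j).le, inv_mul_le_iff₀ (ha j), mul_comm]
    exact hC j)
  refine ⟨D, fun j => ?_⟩
  obtain ⟨f, hf, hfz⟩ := exists_functional_le (normSeminorm ℚ E) (z j)
  have hf' : ∀ x, ‖f x‖ ≤ 1 * ‖x‖ := fun x => by simpa using hf x
  have h1 : ‖f.mkContinuous 1 hf'‖ ≤ 1 := LinearMap.mkContinuous_norm_le _ zero_le_one _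
  have h2 := (ev j).le_of_opNorm_le (hD j) (f.mkContinuous 1 hf')
  have hD0 : 0 ≤ D := (norm_nonneg _).trans (hD j)
  rw [hev, norm_mul, norm_inv, Real.norm_of_nonneg (ha j).le, inv_mul_le_iff₀ (ha j)] at h2
  have h3 : (f.mkContinuous 1 hf') (z j) = ‖z j‖ := hfz
  rw [h3, norm_norm] at h2
  calc ‖z j‖ ≤ a j * (D * ‖f.mkContinuous 1 hf'‖) := h2
    _ ≤ a j * (D * 1) := by
      have := (ha j).le
      gcongr
    _ = _ := by ring

/-- The dual form of a filling inequality: the elements `∂ (z j)` have preimages of controlled size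
if each bounded functional that factors through `∂` is controlled on the `z j`. -/
theorem exists_filling_of_functionals {E F : Type*} [AddCommGroup E] [Module ℚ E] [AddCommGroup F]
    [Module ℚ F] (d : E →ₗ[ℚ] F) (p : Seminorm ℚ E) (z : ℕ → E) (a : ℕ → ℝ) (ha : ∀ j, 0 < a j)
    (h : ∀ f : E →ₗ[ℚ] ℝ, (∀ x, d x = 0 → f x = 0) → (∃ C : ℝ, ∀ x, |f x| ≤ C * p x) →
      ∃ C : ℝ, ∀ j, |f (z j)| ≤ C * a j) :
    ∃ D : ℝ, ∀ j, ∃ x, d x = d (z j) ∧ p x ≤ D * a j := by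
  let _ : SeminormedAddCommGroup E := p.toAddGroupSeminorm.toSeminormedAddCommGroup
  let _ : NormedSpace ℚ E := { norm_smul_le := fun r x => (map_smul_eq_mul p r x).le }
  have hn : ∀ x : E, ‖x‖ = p x := fun _ => rfl
  obtain ⟨D, hD⟩ := exists_norm_le_of_functionals (E := E ⧸ LinearMap.ker d)
    (fun j => Submodule.Quotient.mk (z j)) a ha (fun f => by
      refine h (f.toLinearMap ∘ₗ (LinearMap.ker d).mkQ) (fun x hx => ?_) ⟨‖f‖, fun x => ?_⟩
      · have : (LinearMap.ker d).mkQ x = 0 := (Submodule.Quotient.mk_eq_zero _).2 hx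
        simp [this]
      · have h1 := f.le_opNorm (Submodule.Quotient.mk x)
        have h2 : ‖(Submodule.Quotient.mk x : E ⧸ LinearMap.ker d)‖ ≤ ‖x‖ :=
          Submodule.Quotient.norm_mk_le _ _
        exact h1.trans (mul_le_mul_of_nonneg_left h2 (norm_nonneg _)))
  refine ⟨D + 1, fun j => ?_⟩
  obtain ⟨x, hx, hx'⟩ := Submodule.Quotient.norm_mk_lt
    (Submodule.Quotient.mk (z j) : E ⧸ LinearMap.ker d) (ha j)
  refine ⟨x, ?_, ?_⟩
  · have := (Submodule.Quotient.eq _).1 hx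
    rwa [LinearMap.mem_ker, map_sub, sub_eq_zero] at this
  · rw [← hn]
    linarith [hD j]

end HahnBanach

/-! ### Weighted chain complexes over the rational numbers -/

theorem seminorm_sum_le {V ι : Type*} [AddCommGroup V] [Module ℚ V] (p : Seminorm ℚ V)
    (s : Finset ι) (v : ι → V) : p (∑ i ∈ s, v i) ≤ ∑ i ∈ s, p (v i) :=
  Finset.le_sum_of_subadditive p (map_zero p).le (map_add_le_add p) s v

section ChainNorm

variable {X : Type*}

/-- The weighted `ℓ¹`-norm `∑ |z_t| (1 + wt t)ᵐ` of a rational chain. -/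
def chainNorm (wt : X → ℝ) (hwt : ∀ t, 0 ≤ wt t) (m : ℕ) : Seminorm ℚ (X →₀ ℚ) :=
  Seminorm.of (fun z => z.sum fun t a => ‖a‖ * (1 + wt t) ^ m)
    (fun z z' => by
      classical
      have h0 : ∀ t, 0 ≤ (1 + wt t) ^ m := fun t => by have := hwt t; positivity
      rw [Finsupp.sum_of_support_subset _ Finsupp.support_add _ (by simp),
        Finsupp.sum_of_support_subset z (Finset.subset_union_left (s₂ := z'.support)) _ (by simp),
        Finsupp.sum_of_support_subset z' (Finset.subset_union_right (s₁ := z.support)) _ (by simp),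
        ← Finset.sum_add_distrib]
      refine Finset.sum_le_sum fun t _ => ?_
      rw [← add_mul]
      exact mul_le_mul_of_nonneg_right (norm_add_le _ _) (h0 t))
    (fun r z => by
      rw [Finsupp.sum_of_support_subset (r • z) Finsupp.support_smul _ (by simp), Finsupp.sum,
        Finset.mul_sum]
      refine Finset.sum_congr rfl fun t _ => ?_
      rw [Finsupp.smul_apply, smul_eq_mul, norm_mul, mul_assoc])

variable {wt : X → ℝ} {hwt : ∀ t, 0 ≤ wt t}

theorem chainNorm_apply (m : ℕ) (z : X →₀ ℚ) :
    chainNorm wt hwt m z = ∑ t ∈ z.support, ‖z t‖ * (1 + wt t) ^ m := rfl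

theorem chainNorm_single (m : ℕ) (t : X) :
    chainNorm wt hwt m (Finsupp.single t 1) = (1 + wt t) ^ m := by
  change (Finsupp.single t (1 : ℚ)).sum (fun t a => ‖a‖ * (1 + wt t) ^ m) = _
  rw [Finsupp.sum_single_index (by simp), norm_one, one_mul]

theorem chainNorm_mono {m m' : ℕ} (h : m ≤ m') (z : X →₀ ℚ) :
    chainNorm wt hwt m z ≤ chainNorm wt hwt m' z := by
  rw [chainNorm_apply, chainNorm_apply]
  refine Finset.sum_le_sum fun t _ => mul_le_mul_of_nonneg_left ?_ (norm_nonneg _)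
  exact pow_le_pow_right₀ (by linarith [hwt t]) h

theorem chainNorm_pos (m : ℕ) {z : X →₀ ℚ} (hz : z ≠ 0) : 0 < chainNorm wt hwt m z := by
  rw [chainNorm_apply]
  refine Finset.sum_pos (fun t ht => ?_) (Finsupp.support_nonempty_iff.2 hz)
  have := hwt t
  have := norm_pos_iff.2 (Finsupp.mem_support_iff.1 ht)
  positivity

/-- A linear map on chains is bounded as soon as it is bounded on the basis. -/
theorem seminorm_le_chainNorm {W : Type*} [AddCommGroup W] [Module ℚ W] (p : Seminorm ℚ W)
    (f : (X →₀ ℚ) →ₗ[ℚ] W) {D : ℝ} {m : ℕ}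
    (h : ∀ t, p (f (Finsupp.single t 1)) ≤ D * (1 + wt t) ^ m) (z : X →₀ ℚ) :
    p (f z) ≤ D * chainNorm wt hwt m z := by
  have hz : f z = ∑ t ∈ z.support, z t • f (Finsupp.single t 1) := by
    conv_lhs => rw [← Finsupp.sum_single z, Finsupp.sum, map_sum]
    refine Finset.sum_congr rfl fun t _ => ?_
    rw [← map_smul, Finsupp.smul_single, smul_eq_mul, mul_one]
  rw [hz, chainNorm_apply, Finset.mul_sum]
  refine (seminorm_sum_le p _ _).trans (Finset.sum_le_sum fun t _ => ?_)
  rw [map_smul_eq_mul]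
  calc ‖z t‖ * p (f (Finsupp.single t 1)) ≤ ‖z t‖ * (D * (1 + wt t) ^ m) := by
        gcongr
        exact h t
    _ = _ := by ring

end ChainNorm

/-- A linear map that vanishes on the kernel of `d` factors through `d`. -/
theorem exists_comp_eq {E F W : Type*} [AddCommGroup E] [Module ℚ E] [AddCommGroup F]
    [Module ℚ F] [AddCommGroup W] [Module ℚ W] (d : E →ₗ[ℚ] F) (f : E →ₗ[ℚ] W)
    (h : ∀ x, d x = 0 → f x = 0) : ∃ φ : F →ₗ[ℚ] W, ∀ x, φ (d x) = f x := by
  obtain ⟨s, hs⟩ := d.rangeRestrict.exists_rightInverse_of_surjective d.range_rangeRestrict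
  obtain ⟨φ, hφ⟩ := LinearMap.exists_extend (f ∘ₗ s)
  refine ⟨φ, fun x => ?_⟩
  have h1 : φ (d x) = f (s (d.rangeRestrict x)) := LinearMap.congr_fun hφ (d.rangeRestrict x)
  have h2 : d.rangeRestrict (s (d.rangeRestrict x)) = d.rangeRestrict x :=
    LinearMap.congr_fun hs _
  have h3 : d (s (d.rangeRestrict x) - x) = 0 := by
    rw [map_sub, sub_eq_zero]
    exact congrArg Subtype.val h2
  have h4 := h _ h3
  rw [map_sub, sub_eq_zero] at h4
  rw [h1, h4]

section WeightedComplex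

variable {X : ℕ → Type*} (d : ∀ n, (X (n + 1) →₀ ℚ) →ₗ[ℚ] (X n →₀ ℚ)) (wt : ∀ n, X n → ℝ)
  (hwt : ∀ n t, 0 ≤ wt n t)

/-- The cycles of a complex of rational chains. -/
def chainCycles : ∀ n, Submodule ℚ (X n →₀ ℚ)
  | 0 => ⊤
  | n + 1 => LinearMap.ker (d n)

/-- The complex satisfies scalar control if each rational functional whose coboundary has polynomial
growth is bounded on cycles by a weighted norm. -/
def ScalarControl : Prop :=
  ∀ n (φ : (X n →₀ ℚ) →ₗ[ℚ] ℚ),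
    (∃ (C : ℝ) (k : ℕ), ∀ t, ‖φ (d n (Finsupp.single t 1))‖ ≤ C * (1 + wt (n + 1) t) ^ k) →
    ∃ (C : ℝ) (k : ℕ), ∀ z ∈ chainCycles d n, ‖φ z‖ ≤ C * chainNorm (wt n) (hwt n) k z

/-- The chains are projected to the cycles, with polynomial control in each weighted norm. -/
def HasCycleProjection (n : ℕ) : Prop :=
  ∀ m : ℕ, ∃ (D : ℝ) (k : ℕ) (ζ : (X n →₀ ℚ) →ₗ[ℚ] (X n →₀ ℚ)),
    (∀ t, chainNorm (wt n) (hwt n) m (ζ (Finsupp.single t 1)) ≤ D * (1 + wt n t) ^ k) ∧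
    (∀ z, ζ z ∈ chainCycles d n) ∧ ∀ z ∈ chainCycles d n, ζ z = z

/-- The boundaries are filled linearly, with polynomial control in each weighted norm. -/
def HasFilling (n : ℕ) : Prop :=
  ∀ m : ℕ, ∃ (D : ℝ) (k : ℕ) (h : (X n →₀ ℚ) →ₗ[ℚ] (X (n + 1) →₀ ℚ)),
    (∀ t, chainNorm (wt (n + 1)) (hwt (n + 1)) m (h (Finsupp.single t 1)) ≤ D * (1 + wt n t) ^ k) ∧
    ∀ z, d n (h (d n z)) = d n z

/-- The homology is spanned by finitely many classes, detected by cocycles of polynomial growth. -/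
def HasFiniteDuality (n : ℕ) : Prop :=
  ∃ (r : ℕ) (z : Fin r → (X n →₀ ℚ)) (c : Fin r → (X n →₀ ℚ) →ₗ[ℚ] ℚ),
    (∀ i, z i ∈ chainCycles d n) ∧ (∀ i y, c i (d n y) = 0) ∧
    (∀ i, ∃ (C : ℝ) (k : ℕ), ∀ t, ‖c i (Finsupp.single t 1)‖ ≤ C * (1 + wt n t) ^ k) ∧
    ∀ y ∈ chainCycles d n, ∃ y', y - ∑ i, c i y • z i = d n y'

variable {d wt hwt}

theorem d_mem_chainCycles (hdd : ∀ n y, d n (d (n + 1) y) = 0) (n : ℕ) (y : X (n + 1) →₀ ℚ) :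
    d n y ∈ chainCycles d n := by
  cases n with
  | zero => trivial
  | succ n => exact hdd n y

/-- Under scalar control the homology is finite-dimensional: on an infinite-dimensional space some
functional grows faster than each weighted norm. -/
theorem ScalarControl.finite (hdd : ∀ n y, d n (d (n + 1) y) = 0) (h : ScalarControl d wt hwt)
    (n : ℕ) : Module.Finite ℚ
      (chainCycles d n ⧸ (LinearMap.range (d n)).submoduleOf (chainCycles d n)) := by
  set Z := chainCycles d n
  set B := (LinearMap.range (d n)).submoduleOf Z
  by_contra hfin
  let b := Module.Basis.ofVectorSpace ℚ (Z ⧸ B)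
  have hinf : Infinite (Module.Basis.ofVectorSpaceIndex ℚ (Z ⧸ B)) := by
    by_contra hI
    rw [not_infinite_iff_finite] at hI
    exact hfin (Module.Finite.of_basis b)
  let e := Infinite.natEmbedding (Module.Basis.ofVectorSpaceIndex ℚ (Z ⧸ B))
  have hz : ∀ j, ∃ z : Z, (Submodule.Quotient.mk z : Z ⧸ B) = b (e j) := fun j =>
    Submodule.Quotient.mk_surjective _ _
  choose z hz using hz
  -- a functional that is larger than `j` times the `j`-th norm on the `j`-th cycle
  let v : ℕ → ℚ := fun j => (⌊(j : ℝ) * chainNorm (wt n) (hwt n) j (z j)⌋₊ + 1 : ℕ)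
  have hv : ∀ j : ℕ, (j : ℝ) * chainNorm (wt n) (hwt n) j (z j) < ‖v j‖ := by
    intro j
    have : ‖v j‖ = (⌊(j : ℝ) * chainNorm (wt n) (hwt n) j (z j)⌋₊ + 1 : ℕ) := by
      rw [← Rat.norm_cast_real, Rat.cast_natCast, Real.norm_natCast]
    rw [this]
    push_cast
    exact Nat.lt_floor_add_one _
  let φ₀ : (Z ⧸ B) →ₗ[ℚ] ℚ := b.constr ℚ (Function.extend e v 0)
  obtain ⟨φ, hφ⟩ := LinearMap.exists_extend (φ₀ ∘ₗ B.mkQ)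
  have hφ' : ∀ y : Z, φ y = φ₀ (Submodule.Quotient.mk y) := fun y => LinearMap.congr_fun hφ y
  have hφz : ∀ j, φ (z j) = v j := by
    intro j
    rw [hφ', hz, Module.Basis.constr_basis, e.injective.extend_apply]
  obtain ⟨C, k, hC⟩ := h n φ ⟨0, 0, fun t => by
    have h1 := hφ' ⟨_, d_mem_chainCycles hdd n (Finsupp.single t 1)⟩
    rw [(Submodule.Quotient.mk_eq_zero _).2 (show _ ∈ B from ⟨_, rfl⟩), map_zero] at h1
    rw [h1]
    simp⟩
  let j := max k ⌈C⌉₊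
  have h1 := hC (z j) (z j).2
  rw [hφz] at h1
  have h2 : chainNorm (wt n) (hwt n) k (z j) ≤ chainNorm (wt n) (hwt n) j (z j) :=
    chainNorm_mono (le_max_left _ _) _
  have h3 : C ≤ j := (Nat.le_ceil C).trans (by exact_mod_cast le_max_right _ _)
  have h4 : (0 : ℝ) ≤ j := Nat.cast_nonneg _
  have h5 : 0 ≤ chainNorm (wt n) (hwt n) k (z j) := apply_nonneg _ _
  have h6 : C * chainNorm (wt n) (hwt n) k (z j) ≤ j * chainNorm (wt n) (hwt n) j (z j) :=
    mul_le_mul h3 h2 h5 h4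
  exact absurd (hv j) (not_lt.2 (h1.trans h6))

/-- Finitely many cycles span the homology, with dual functionals that are bounded on cycles. -/
theorem ScalarControl.exists_periods (hdd : ∀ n y, d n (d (n + 1) y) = 0)
    (h : ScalarControl d wt hwt) (n : ℕ) :
    ∃ (r : ℕ) (z : Fin r → (X n →₀ ℚ)) (φ : Fin r → (X n →₀ ℚ) →ₗ[ℚ] ℚ),
      (∀ i, z i ∈ chainCycles d n) ∧ (∀ i y, φ i (d n y) = 0) ∧
      (∀ i, ∃ (C : ℝ) (k : ℕ), ∀ y ∈ chainCycles d n,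
        ‖φ i y‖ ≤ C * chainNorm (wt n) (hwt n) k y) ∧
      ∀ y ∈ chainCycles d n, ∃ y', y - ∑ i, φ i y • z i = d n y' := by
  have hfin := h.finite hdd n
  set Z := chainCycles d n
  set B := (LinearMap.range (d n)).submoduleOf Z
  let b := Module.finBasis ℚ (Z ⧸ B)
  have hz : ∀ i, ∃ z : Z, (Submodule.Quotient.mk z : Z ⧸ B) = b i := fun j =>
    Submodule.Quotient.mk_surjective _ _
  choose z hz using hz
  have hφ : ∀ i, ∃ φ : (X n →₀ ℚ) →ₗ[ℚ] ℚ, ∀ y : Z, φ y = b.coord i (Submodule.Quotient.mk y) := by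
    intro i
    obtain ⟨φ, hφ⟩ := LinearMap.exists_extend (b.coord i ∘ₗ B.mkQ)
    exact ⟨φ, fun y => LinearMap.congr_fun hφ y⟩
  choose φ hφ using hφ
  have hφd : ∀ i y, φ i (d n y) = 0 := by
    intro i y
    have h1 := hφ i ⟨_, d_mem_chainCycles hdd n y⟩
    rwa [(Submodule.Quotient.mk_eq_zero _).2 (show _ ∈ B from ⟨_, rfl⟩), map_zero] at h1
  refine ⟨_, fun i => z i, φ, fun i => (z i).2, hφd, fun i => ?_, fun y hy => ?_⟩
  · exact h n (φ i) ⟨0, 0, fun t => by simp [hφd]⟩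
  · have h1 : (⟨y, hy⟩ - ∑ i, φ i y • z i : Z) ∈ B := by
      rw [← Submodule.Quotient.mk_eq_zero, Submodule.Quotient.mk_sub, sub_eq_zero]
      have h2 : (Submodule.Quotient.mk (∑ i, φ i y • z i) : Z ⧸ B) = ∑ i, φ i y • b i := by
        rw [← Submodule.mkQ_apply, map_sum]
        exact Finset.sum_congr rfl fun i _ => by rw [map_smul, Submodule.mkQ_apply, hz]
      rw [h2]
      have h3 := b.sum_repr (Submodule.Quotient.mk ⟨y, hy⟩)
      rw [← h3]
      exact Finset.sum_congr rfl fun i _ => by rw [hφ i ⟨y, hy⟩]; rfl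
    obtain ⟨y', hy'⟩ := h1
    refine ⟨y', ?_⟩
    rw [hy']
    simp

/-- Under scalar control, boundaries have fillings of polynomially controlled size.  Otherwise the
uniform boundedness principle gives a real functional on boundaries, bounded with respect to the
size of fillings, that violates scalar control; rounding its values on the basis changes it by a
bounded amount and makes it rational. -/
theorem ScalarControl.exists_filling (hdd : ∀ n y, d n (d (n + 1) y) = 0)
    (hd : ∀ n m, ∃ D : ℝ, ∀ t, chainNorm (wt n) (hwt n) m (d n (Finsupp.single t 1)) ≤
      D * (1 + wt (n + 1) t) ^ m)
    (h : ScalarControl d wt hwt) (n m : ℕ) :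
    ∃ (D : ℝ) (k : ℕ), ∀ y, ∃ x, d n x = d n y ∧
      chainNorm (wt (n + 1)) (hwt (n + 1)) m x ≤ D * chainNorm (wt n) (hwt n) k (d n y) := by
  by_contra! hcon
  -- The `j`-th counterexample refers to the `j`-th norm; these norms increase, so a bound by any one
  -- of them concerns all but finitely many counterexamples.
  choose y hy using fun j : ℕ => hcon j j
  let a : ℕ → ℝ := fun j => chainNorm (wt n) (hwt n) j (d n (y j))
  have ha : ∀ j, 0 < a j := by
    intro j
    refine chainNorm_pos j fun h0 => ?_
    have := hy j 0 (by rw [map_zero, h0])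
    rw [h0, map_zero, map_zero, mul_zero] at this
    exact lt_irrefl _ this
  obtain ⟨D, hD⟩ := exists_filling_of_functionals (d n)
    (chainNorm (wt (n + 1)) (hwt (n + 1)) m) y a ha (fun f hf hfC => by
      obtain ⟨K, hK⟩ := hfC
      obtain ⟨φ, hφ⟩ := exists_comp_eq (d n) f hf
      let φ' : (X n →₀ ℚ) →ₗ[ℚ] ℚ :=
        Finsupp.linearCombination ℚ fun t => ((⌊φ (Finsupp.single t 1)⌋ : ℤ) : ℚ)
      have hdiff : ∀ z, |φ z - (φ' z : ℝ)| ≤ chainNorm (wt n) (hwt n) 0 z := by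
        intro z
        have h1 := seminorm_le_chainNorm (wt := wt n) (hwt := hwt n) (normSeminorm ℚ ℝ)
          (φ - (Algebra.linearMap ℚ ℝ) ∘ₗ φ') (D := 1) (m := 0) (fun t => by
            have h2 : (φ - (Algebra.linearMap ℚ ℝ) ∘ₗ φ') (Finsupp.single t 1) =
                Int.fract (φ (Finsupp.single t 1)) := by
              simp [φ']
            rw [h2, coe_normSeminorm, Real.norm_of_nonneg (Int.fract_nonneg _)]
            simpa using (Int.fract_lt_one (φ (Finsupp.single t 1))).le) z
        rw [one_mul] at h1
        exact h1
      obtain ⟨B, hB⟩ := hd n 0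
      obtain ⟨C, k, hC⟩ := h n φ' ⟨|K| + B, m, fun t => by
        have h1 := hdiff (d n (Finsupp.single t 1))
        rw [hφ] at h1
        have h2 := hK (Finsupp.single t 1)
        have h3 : chainNorm (wt (n + 1)) (hwt (n + 1)) m (Finsupp.single t 1) ≤
            1 * (1 + wt (n + 1) t) ^ m := by
          rw [chainNorm_single, one_mul]
        have h4 := hB t
        have h5 : 1 ≤ (1 + wt (n + 1) t) ^ m := one_le_pow₀ (by linarith [hwt (n + 1) t])
        have h6 : 0 ≤ B := by
          rw [pow_zero, mul_one] at h4
          exact (apply_nonneg _ _).trans h4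
        rw [← Rat.norm_cast_real, Real.norm_eq_abs]
        have h7 := abs_sub_abs_le_abs_sub
          ((φ' (d n (Finsupp.single t 1)) : ℚ) : ℝ) (f (Finsupp.single t 1))
        rw [abs_sub_comm] at h7
        have h8 : K * chainNorm (wt (n + 1)) (hwt (n + 1)) m (Finsupp.single t 1) ≤
            |K| * (1 * (1 + wt (n + 1) t) ^ m) := by
          gcongr
          exact le_abs_self K
        rw [pow_zero, mul_one] at h4
        have h9 := mul_le_mul_of_nonneg_left h5 h6
        rw [add_mul]
        linarith⟩
      refine ⟨|C| + 1 + ∑ i ∈ Finset.range k, |f (y i)| / a i, fun j => ?_⟩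
      have hs : ∀ i ∈ Finset.range k, 0 ≤ |f (y i)| / a i := fun i _ =>
        div_nonneg (abs_nonneg _) (ha i).le
      have hs0 := Finset.sum_nonneg hs
      rcases lt_or_ge j k with hj | hj
      · have h1 := Finset.single_le_sum hs (Finset.mem_range.2 hj)
        have h2 := mul_le_mul_of_nonneg_right h1 (ha j).le
        rw [div_mul_cancel₀ _ (ha j).ne'] at h2
        have h3 := mul_nonneg (add_nonneg (abs_nonneg C) zero_le_one) (ha j).le
        rw [add_mul]
        linarith
      · have h1 := hdiff (d n (y j))
        rw [hφ] at h1
        have h2 := hC _ (d_mem_chainCycles hdd n (y j))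
        rw [← Rat.norm_cast_real, Real.norm_eq_abs] at h2
        have h3 : chainNorm (wt n) (hwt n) 0 (d n (y j)) ≤ a j := chainNorm_mono (Nat.zero_le _) _
        have h4 : C * chainNorm (wt n) (hwt n) k (d n (y j)) ≤ |C| * a j := by
          have : chainNorm (wt n) (hwt n) k (d n (y j)) ≤ a j := chainNorm_mono hj _
          gcongr
          exact le_abs_self C
        have h5 := abs_sub_abs_le_abs_sub (f (y j)) ((φ' (d n (y j)) : ℚ) : ℝ)
        have h6 := mul_nonneg hs0 (ha j).le
        rw [add_mul, add_mul]
        linarith)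
  let j := ⌈D⌉₊
  obtain ⟨x, hx, hx'⟩ := hD j
  have h1 := hy j x hx
  have h2 : D * a j ≤ j * a j := mul_le_mul_of_nonneg_right (Nat.le_ceil D) (ha j).le
  exact absurd h1 (not_lt.2 (hx'.trans h2))

/-- Linear fillings: project a basis element to the cycles, subtract its periods, and choose a
filling of the resulting boundary. -/
theorem ScalarControl.hasFilling (hdd : ∀ n y, d n (d (n + 1) y) = 0)
    (hd : ∀ n m, ∃ D : ℝ, ∀ t, chainNorm (wt n) (hwt n) m (d n (Finsupp.single t 1)) ≤
      D * (1 + wt (n + 1) t) ^ m)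
    (h : ScalarControl d wt hwt) {n : ℕ} (hζ : HasCycleProjection d wt hwt n) :
    HasFilling d wt hwt n := by
  intro m
  obtain ⟨D₁, k₁, hfill⟩ := h.exists_filling hdd hd n m
  obtain ⟨r, z, φ, hz, hφd, hφ, hspan⟩ := h.exists_periods hdd n
  choose C k hC using hφ
  let K := k₁ + ∑ i, k i
  have hK₁ : k₁ ≤ K := Nat.le_add_right _ _
  have hK : ∀ i, k i ≤ K := fun i =>
    (Finset.single_le_sum (fun i _ => Nat.zero_le (k i)) (Finset.mem_univ i)).trans
      (Nat.le_add_left _ _)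
  obtain ⟨D₂, k₂, ζ, hζb, hζZ, hζid⟩ := hζ K
  -- the projection to the boundaries
  let β : (X n →₀ ℚ) →ₗ[ℚ] (X n →₀ ℚ) := ζ - ∑ i, ((φ i ∘ₗ ζ).smulRight (z i))
  have hβ : ∀ y, β y = ζ y - ∑ i, φ i (ζ y) • z i := fun y => by simp [β]
  let E : ℝ := 1 + ∑ i, |C i| * chainNorm (wt n) (hwt n) k₁ (z i)
  have hE : 0 ≤ E := add_nonneg zero_le_one
    (Finset.sum_nonneg fun i _ => mul_nonneg (abs_nonneg _) (apply_nonneg _ _))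
  have hβn : ∀ y, chainNorm (wt n) (hwt n) k₁ (β y) ≤ E * chainNorm (wt n) (hwt n) K (ζ y) := by
    intro y
    rw [hβ]
    refine (map_sub_le_add _ _ _).trans ?_
    rw [add_mul, one_mul, Finset.sum_mul]
    refine add_le_add (chainNorm_mono hK₁ _) ?_
    refine (seminorm_sum_le _ _ _).trans (Finset.sum_le_sum fun i _ => ?_)
    rw [map_smul_eq_mul]
    have h1 : ‖φ i (ζ y)‖ ≤ |C i| * chainNorm (wt n) (hwt n) K (ζ y) := by
      refine (hC i _ (hζZ y)).trans ?_
      gcongr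
      · exact le_abs_self _
      · exact chainNorm_mono (hK i) _
    have h2 := mul_le_mul_of_nonneg_right h1
      (apply_nonneg (chainNorm (wt n) (hwt n) k₁) (z i))
    linarith
  have hfill' : ∀ t, ∃ x, d n x = β (Finsupp.single t 1) ∧
      chainNorm (wt (n + 1)) (hwt (n + 1)) m x ≤ |D₁| * (E * D₂) * (1 + wt n t) ^ k₂ := by
    intro t
    obtain ⟨y', hy'⟩ := hspan _ (hζZ (Finsupp.single t 1))
    rw [← hβ] at hy'
    obtain ⟨x, hx, hx'⟩ := hfill y'
    refine ⟨x, hx.trans hy'.symm, hx'.trans ?_⟩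
    rw [← hy', mul_assoc]
    refine mul_le_mul (le_abs_self _) ?_ (apply_nonneg _ _) (abs_nonneg _)
    refine (hβn _).trans ?_
    rw [mul_assoc]
    exact mul_le_mul_of_nonneg_left (hζb t) hE
  choose x hx hx' using hfill'
  have hdx : ∀ y, d n (Finsupp.linearCombination ℚ x y) = β y := by
    intro y
    have : d n ∘ₗ Finsupp.linearCombination ℚ x = β := by
      refine Finsupp.lhom_ext fun t a => ?_
      rw [LinearMap.comp_apply, Finsupp.linearCombination_single, map_smul, hx, ← map_smul,
        Finsupp.smul_single, smul_eq_mul, mul_one]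
    rw [← this]
    rfl
  refine ⟨|D₁| * (E * D₂), k₂, Finsupp.linearCombination ℚ x, fun t => ?_, fun y => ?_⟩
  · rw [Finsupp.linearCombination_single, one_smul]
    exact hx' t
  · rw [hdx, hβ, hζid _ (d_mem_chainCycles hdd n y)]
    simp [hφd]

theorem HasFilling.hasCycleProjection
    (hd : ∀ n m, ∃ D : ℝ, ∀ t, chainNorm (wt n) (hwt n) m (d n (Finsupp.single t 1)) ≤
      D * (1 + wt (n + 1) t) ^ m)
    {n : ℕ} (h : HasFilling d wt hwt n) : HasCycleProjection d wt hwt (n + 1) := by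
  intro m
  obtain ⟨D, k, f, hf, hfd⟩ := h m
  obtain ⟨E, hE⟩ := hd n k
  refine ⟨1 + |D| * |E|, m + k, LinearMap.id - f ∘ₗ d n, fun t => ?_, fun z => ?_, fun z hz => ?_⟩
  · have h0 := hwt (n + 1) t
    have h1 : chainNorm (wt (n + 1)) (hwt (n + 1)) m (Finsupp.single t 1) ≤
        (1 + wt (n + 1) t) ^ (m + k) := by
      rw [chainNorm_single]
      exact pow_le_pow_right₀ (by linarith) (Nat.le_add_right _ _)
    have h2 : chainNorm (wt (n + 1)) (hwt (n + 1)) m (f (d n (Finsupp.single t 1))) ≤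
        |D| * (|E| * (1 + wt (n + 1) t) ^ (m + k)) := by
      refine (seminorm_le_chainNorm (hwt := hwt n) _ f hf _).trans ?_
      refine mul_le_mul (le_abs_self _) ((hE t).trans ?_) (apply_nonneg _ _) (abs_nonneg _)
      refine mul_le_mul (le_abs_self _) ?_ (by positivity) (abs_nonneg _)
      exact pow_le_pow_right₀ (by linarith) (Nat.le_add_left _ _)
    refine (map_sub_le_add _ _ _).trans ?_
    rw [add_mul, one_mul, mul_assoc]
    exact add_le_add h1 h2
  · change d n (z - f (d n z)) = 0
    rw [map_sub, hfd, sub_self]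
  · have hz : d n z = 0 := hz
    simp [hz]

/-- Under scalar control the cycles are complemented with polynomial control.  Fillings in one degree
give the projection `z ↦ z - f (∂ z)` to the cycles in the next degree, and this in turn gives
linear fillings there. -/
theorem ScalarControl.hasCycleProjection (hdd : ∀ n y, d n (d (n + 1) y) = 0)
    (hd : ∀ n m, ∃ D : ℝ, ∀ t, chainNorm (wt n) (hwt n) m (d n (Finsupp.single t 1)) ≤
      D * (1 + wt (n + 1) t) ^ m)
    (h : ScalarControl d wt hwt) (n : ℕ) : HasCycleProjection d wt hwt n := by
  induction n with
  | zero =>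
    refine fun m => ⟨1, m, LinearMap.id, fun t => ?_, fun _ => trivial, fun _ _ => rfl⟩
    rw [LinearMap.id_apply, chainNorm_single, one_mul]
  | succ n ih => exact (h.hasFilling hdd hd ih).hasCycleProjection hd

/-- The dual functionals, composed with a projection to the cycles, are cocycles of polynomial
growth. -/
theorem ScalarControl.hasFiniteDuality (hdd : ∀ n y, d n (d (n + 1) y) = 0)
    (hd : ∀ n m, ∃ D : ℝ, ∀ t, chainNorm (wt n) (hwt n) m (d n (Finsupp.single t 1)) ≤
      D * (1 + wt (n + 1) t) ^ m)
    (h : ScalarControl d wt hwt) (n : ℕ) : HasFiniteDuality d wt n := by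
  obtain ⟨r, z, φ, hz, hφd, hφ, hspan⟩ := h.exists_periods hdd n
  choose C k hC using hφ
  choose D k' ζ hζ hζZ hζid using fun i => h.hasCycleProjection hdd hd n (k i)
  refine ⟨r, z, fun i => φ i ∘ₗ ζ i, hz, fun i y => ?_, fun i => ⟨|C i| * D i, k' i, fun t => ?_⟩,
    fun y hy => ?_⟩
  · rw [LinearMap.comp_apply, hζid i _ (d_mem_chainCycles hdd n y), hφd]
  · rw [LinearMap.comp_apply, mul_assoc]
    refine (hC i _ (hζZ i _)).trans ?_
    exact mul_le_mul (le_abs_self _) (hζ i t) (apply_nonneg _ _) (abs_nonneg _)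
  · obtain ⟨y', hy'⟩ := hspan y hy
    refine ⟨y', ?_⟩
    rw [← hy']
    congr 1
    exact Finset.sum_congr rfl fun i _ => by rw [LinearMap.comp_apply, hζid i y hy]

end WeightedComplex

/-! ### Chains on the bar basis -/

section BarChains

variable {Q G V W : Type*} [Group Q] [Group G] [AddCommGroup V] [Module ℚ V]
  [AddCommGroup W] [Module ℚ W]

/-- The boundary of bar chains: the coboundary of the universal cochain. -/
def barBoundary (ν : G →* Q) (n : ℕ) : (BarBasis Q G (n + 1) →₀ ℚ) →ₗ[ℚ] (BarBasis Q G n →₀ ℚ) :=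
  Finsupp.linearCombination ℚ (barD (BarBasis Q G n →₀ ℚ) ν n fun s => Finsupp.single s 1)

/-- The value of a cochain on a chain. -/
abbrev eval {X V : Type*} [AddCommGroup V] [Module ℚ V] (φ : X → V) : (X →₀ ℚ) →ₗ[ℚ] V :=
  Finsupp.linearCombination ℚ φ

theorem linearMap_barD (ν : G →* Q) (n : ℕ) (f : (BarBasis Q G n →₀ ℚ) →ₗ[ℚ] V)
    (t : BarBasis Q G (n + 1)) :
    barD V ν n (fun s => f (Finsupp.single s 1)) t =
      f (barBoundary ν n (Finsupp.single t 1)) := by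
  rw [barBoundary, Finsupp.linearCombination_single, one_smul, barD_comp]

theorem eval_single {X : Type*} (φ : X → V) (t : X) : eval φ (Finsupp.single t 1) = φ t := by
  rw [Finsupp.linearCombination_single, one_smul]

theorem barD_eq_eval (ν : G →* Q) (n : ℕ) (φ : BarBasis Q G n → V) (t : BarBasis Q G (n + 1)) :
    barD V ν n φ t = eval φ (barBoundary ν n (Finsupp.single t 1)) := by
  rw [← linearMap_barD]
  simp only [eval_single]

theorem linearMap_eq_eval {X : Type*} (f : (X →₀ ℚ) →ₗ[ℚ] V) (y : X →₀ ℚ) :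
    f y = eval (fun t => f (Finsupp.single t 1)) y := by
  have : f = eval (fun t => f (Finsupp.single t 1)) := by
    refine Finsupp.lhom_ext fun t a => ?_
    rw [Finsupp.linearCombination_single, ← map_smul, Finsupp.smul_single, smul_eq_mul, mul_one]
  exact LinearMap.congr_fun this y

theorem eval_barBoundary (ν : G →* Q) (n : ℕ) (φ : BarBasis Q G n → V)
    (y : BarBasis Q G (n + 1) →₀ ℚ) : eval φ (barBoundary ν n y) = eval (barD V ν n φ) y := by
  rw [← LinearMap.comp_apply, linearMap_eq_eval (eval φ ∘ₗ barBoundary ν n) y]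
  congr 2
  funext t
  rw [LinearMap.comp_apply, ← barD_eq_eval]

theorem barBoundary_barBoundary (ν : G →* Q) (n : ℕ) (y : BarBasis Q G (n + 2) →₀ ℚ) :
    barBoundary ν n (barBoundary ν (n + 1) y) = 0 := by
  rw [barBoundary, eval_barBoundary, barD_barD]
  simp

theorem eval_sub {X : Type*} (φ ψ : X → V) (y : X →₀ ℚ) :
    eval (φ - ψ) y = eval φ y - eval ψ y := by
  simp [Finsupp.linearCombination_apply, Finsupp.sum, smul_sub]

theorem eval_comp {X : Type*} (f : V →ₗ[ℚ] W) (φ : X → V) (y : X →₀ ℚ) :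
    eval (fun t => f (φ t)) y = f (eval φ y) := by
  simp [Finsupp.linearCombination_apply, Finsupp.sum]

theorem chainNorm_barBoundary_le {LQ : WordLength Q} {LG : WordLength G} {ν : G →* Q}
    (hν : ∀ g, LQ (ν g) ≤ LG g) (n m : ℕ) :
    ∃ D : ℝ, ∀ t, chainNorm (barWeight LQ LG n) (barWeight_nonneg LQ LG n) m
      (barBoundary ν n (Finsupp.single t 1)) ≤ D * (1 + barWeight LQ LG (n + 1) t) ^ m := by
  refine ⟨1 + ∑ _j : Fin (n + 1), 1, fun t => ?_⟩
  have key : ∀ s, barWeight LQ LG n s ≤ barWeight LQ LG (n + 1) t →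
      chainNorm (barWeight LQ LG n) (barWeight_nonneg LQ LG n) m (Finsupp.single s 1) ≤
        (1 + barWeight LQ LG (n + 1) t) ^ m := by
    intro s hs
    rw [chainNorm_single]
    have := barWeight_nonneg LQ LG n s
    gcongr
  rw [barBoundary, eval_single, barD_apply, add_mul, one_mul, Finset.sum_mul]
  refine (map_add_le_add _ _ _).trans (add_le_add (key _ (barWeight_tail_le LQ LG hν n t)) ?_)
  refine (seminorm_sum_le _ _ _).trans (Finset.sum_le_sum fun j _ => ?_)
  rw [map_smul_eq_mul, norm_pow, norm_neg, norm_one, one_pow]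
  gcongr
  exact key _ (barWeight_contractNth_le LQ LG n j t)

theorem eval_eq_zero_of_mem_coboundaries (ν : G →* Q) {Y : ∀ n, Submodule ℚ (BarBasis Q G n → V)}
    {n : ℕ} {b : BarBasis Q G n → V} (hb : b ∈ coboundaries ν Y n) {y : BarBasis Q G n →₀ ℚ}
    (hy : y ∈ chainCycles (barBoundary ν) n) : eval b y = 0 := by
  cases n with
  | zero =>
    have hb : b = 0 := hb
    rw [hb]
    simp
  | succ n =>
    obtain ⟨c, -, rfl⟩ := hb
    have hy : barBoundary ν n y = 0 := hy
    rw [← eval_barBoundary, hy, map_zero]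

theorem mem_coboundaries_top_of_eval (ν : G →* Q) {n : ℕ} {φ : BarBasis Q G n → V}
    (h : ∀ y ∈ chainCycles (barBoundary ν) n, eval φ y = 0) :
    φ ∈ coboundaries ν (fun _ => ⊤) n := by
  cases n with
  | zero =>
    have : φ = 0 := funext fun t => by
      rw [← eval_single φ t, h _ trivial]
      rfl
    rw [this]
    exact zero_mem _
  | succ n =>
    obtain ⟨ψ, hψ⟩ := exists_comp_eq (barBoundary ν n) (eval φ) h
    refine ⟨fun s => ψ (Finsupp.single s 1), trivial, funext fun t => ?_⟩
    rw [linearMap_barD, hψ, eval_single]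

/-- Translation of chains. -/
def translate (X : Type*) (n : ℕ) (q : Q) : (BarBasis Q X n →₀ ℚ) →ₗ[ℚ] (BarBasis Q X n →₀ ℚ) :=
  Finsupp.linearCombination ℚ fun t => Finsupp.single (q * t.1, t.2) 1

theorem translate_single {X : Type*} (n : ℕ) (q : Q) (t : BarBasis Q X n) :
    translate X n q (Finsupp.single t 1) = Finsupp.single (q * t.1, t.2) 1 :=
  eval_single _ t

theorem eval_translate {X : Type*} (n : ℕ) (q : Q) (φ : BarBasis Q X n → V)
    (y : BarBasis Q X n →₀ ℚ) :
    eval φ (translate X n q y) = eval (fun t => φ (q * t.1, t.2)) y := by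
  rw [← LinearMap.comp_apply, linearMap_eq_eval (eval φ ∘ₗ translate X n q) y]
  congr 2
  funext t
  rw [LinearMap.comp_apply, translate_single, eval_single]

theorem translate_translate {X : Type*} (n : ℕ) (q q' : Q) (y : BarBasis Q X n →₀ ℚ) :
    translate X n q (translate X n q' y) = translate X n (q * q') y := by
  rw [translate, eval_translate, translate]
  simp only [mul_assoc]

theorem translate_one {X : Type*} (n : ℕ) (y : BarBasis Q X n →₀ ℚ) : translate X n 1 y = y := by
  rw [translate]
  simp only [one_mul]
  exact (linearMap_eq_eval LinearMap.id y).symm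

theorem barBoundary_translate (ν : G →* Q) (n : ℕ) (q : Q) (y : BarBasis Q G (n + 1) →₀ ℚ) :
    barBoundary ν n (translate G (n + 1) q y) = translate G n q (barBoundary ν n y) := by
  have h := eval_barBoundary ν n (fun t => Finsupp.single (q * t.1, t.2) (1 : ℚ)) y
  refine Eq.trans ?_ h.symm
  rw [barBoundary, eval_translate]
  congr 2
  funext t
  exact (barD_pullback ν ν (fun x => q * x) (fun _ _ => (mul_assoc _ _ _).symm) n _ t).symm

theorem translate_mem_chainCycles (ν : G →* Q) (n : ℕ) (q : Q) {y : BarBasis Q G n →₀ ℚ}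
    (hy : y ∈ chainCycles (barBoundary ν) n) :
    translate G n q y ∈ chainCycles (barBoundary ν) n := by
  cases n with
  | zero => trivial
  | succ n =>
    have hy : barBoundary ν n y = 0 := hy
    change barBoundary ν n _ = 0
    rw [barBoundary_translate, hy, map_zero]

theorem chainNorm_translate_le (LQ : WordLength Q) (LG : WordLength G) (n m : ℕ) (q : Q)
    (y : BarBasis Q G n →₀ ℚ) :
    chainNorm (barWeight LQ LG n) (barWeight_nonneg LQ LG n) m (translate G n q y) ≤
      (1 + LQ q) ^ m * chainNorm (barWeight LQ LG n) (barWeight_nonneg LQ LG n) m y := by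
  refine seminorm_le_chainNorm _ _ (fun t => ?_) y
  rw [translate_single, chainNorm_single, ← mul_pow]
  have h1 := barWeight_translate_le LQ LG n q t
  have h2 := barWeight_nonneg LQ LG n t
  have h3 := barWeight_nonneg LQ LG n (q * t.1, t.2)
  have h4 := LQ.nonneg q
  gcongr
  nlinarith

/-- If some vector has positive seminorm, then p-bounded cohomology with these coefficients implies
scalar control: a rational functional times that vector is a cochain. -/
theorem scalarControl_of_relAcyclic {LQ : WordLength Q} {LG : WordLength G} {ν : G →* Q}
    {ρ : Representation ℚ Q V} {M : PSStructure.{w} LQ ρ}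
    (h : RelAcyclic ν (pHom M LG) (fun _ => ⊤)) {i : M.Idx} {a : V} (ha : M.η i a ≠ 0) :
    ScalarControl (barBoundary ν) (barWeight LQ LG) (barWeight_nonneg LQ LG) := by
  intro n φ hφ
  have ha' : 0 < M.η i a := lt_of_le_of_ne (apply_nonneg _ _) ha.symm
  have hd : barD V ν n (fun t => φ (Finsupp.single t 1) • a) =
      fun t => φ (barBoundary ν n (Finsupp.single t 1)) • a :=
    funext fun t => linearMap_barD ν n (φ.smulRight a) t
  obtain ⟨b, hb, k, hk⟩ := h n (fun t => φ (Finsupp.single t 1) • a) trivial (by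
    rw [hd]
    exact IsPBoundedFun.smul (f := fun _ => a) ⟨0, fun x => ⟨M.η x a, fun t => by simp⟩⟩ hφ)
  obtain ⟨C, hC⟩ := hk i
  refine ⟨C / M.η i a, k, fun z hz => ?_⟩
  have h1 : eval ((fun t => φ (Finsupp.single t 1) • a) - b) z = φ z • a := by
    rw [eval_sub, eval_eq_zero_of_mem_coboundaries ν hb hz, sub_zero]
    exact (linearMap_eq_eval (φ.smulRight a) z).symm
  have h2 := seminorm_le_chainNorm (hwt := barWeight_nonneg LQ LG n) (M.η i)
    (eval ((fun t => φ (Finsupp.single t 1) • a) - b)) (fun t => by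
      rw [eval_single]
      exact hC t) z
  rw [h1, map_smul_eq_mul] at h2
  rw [div_mul_eq_mul_div, le_div_iff₀ ha']
  exact h2

end BarChains

/-! ### Joint control of the fibre cohomology -/

section FibreColumns

variable {G N A : Type*} [Group G] [Group N] [AddCommGroup A] [Module ℚ A]
  {LG : WordLength G} {LN : WordLength N} {π : G →* N}
  {ρ : Representation ℚ N A} {M : PSStructure.{w} LN ρ}

theorem eval_translate_of_mem_biC {X : Type*} {p q : ℕ} {x : BarBasis N N p → BarBasis N X q → A}
    (hx : x ∈ biC X (MonoidHom.id N) ρ p q) (g : N) (s : BarBasis N N p)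
    (y : BarBasis N X q →₀ ℚ) :
    eval (x (g * s.1, s.2)) (translate X q g y) = ρ g (eval (x s) y) := by
  rw [eval_translate, ← eval_comp]
  congr 2
  funext t
  exact mem_biC.1 hx g s t

/-- A vertical coboundary that grows polynomially in both variables jointly is the coboundary of an
equivariant function with the same property: it is evaluated on the translates of a polynomially
controlled filling. -/
theorem exists_bounded_primitive
    (hfill : ∀ n, HasFilling (barBoundary π) (barWeight LN LG) (barWeight_nonneg LN LG) n)
    {p q : ℕ} {x : BarBasis N N p → BarBasis N G q → A}
    (hvx : biDv N A π p q x ∈ biP LN LG (MonoidHom.id N) M p (q + 1)) :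
    ∃ u ∈ biP LN LG (MonoidHom.id N) M p q, biDv N A π p q u = biDv N A π p q x := by
  obtain ⟨hvC, m, hm⟩ := hvx
  obtain ⟨D, k, h, hD, hdh⟩ := hfill q m
  -- the filling operator, conjugated by translation to the position of the first variable
  let T : BarBasis N N p → (BarBasis N G q →₀ ℚ) →ₗ[ℚ] (BarBasis N G (q + 1) →₀ ℚ) := fun s =>
    translate G (q + 1) s.1 ∘ₗ h ∘ₗ translate G q s.1⁻¹
  have hT : ∀ s t, T s (Finsupp.single t 1) =
      translate G (q + 1) s.1 (h (Finsupp.single (s.1⁻¹ * t.1, t.2) 1)) := fun s t => by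
    simp only [T, LinearMap.comp_apply, translate_single]
  let u : BarBasis N N p → BarBasis N G q → A := fun s t =>
    eval (biDv N A π p q x s) (T s (Finsupp.single t 1))
  have hu : ∀ s y, eval (u s) y = eval (biDv N A π p q x s) (T s y) := fun s y =>
    (linearMap_eq_eval (eval (biDv N A π p q x s) ∘ₗ T s) y).symm
  refine ⟨u, ⟨mem_biC.2 fun g s t => ?_, 2 * m + 2 * k, fun i => ?_⟩, ?_⟩
  · have h1 : T (g * s.1, s.2) (Finsupp.single (g * t.1, t.2) 1) =
        translate G (q + 1) g (T s (Finsupp.single t 1)) := by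
      rw [hT, hT, translate_translate]
      simp [mul_assoc]
    simp only [u, MonoidHom.id_apply]
    rw [h1, eval_translate_of_mem_biC hvC]
  · obtain ⟨C, hC⟩ := hm i
    refine ⟨|C| * |D|, fun ⟨s, t⟩ => ?_⟩
    set W := 1 + biWeight LN LG LN p q (s, t) with hW
    have hs := barWeight_nonneg LN LN p s
    have ht := barWeight_nonneg LN LG q t
    have hWst : W = 1 + (barWeight LN LN p s + barWeight LN LG q t) := rfl
    have hLs := le_barWeight LN LN p s
    have hLs0 := LN.nonneg s.1
    have e1 : chainNorm (barWeight LN LG (q + 1)) (barWeight_nonneg LN LG (q + 1)) m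
        (T s (Finsupp.single t 1)) ≤ W ^ m * (|D| * (W ^ 2) ^ k) := by
      rw [hT]
      refine (chainNorm_translate_le LN LG (q + 1) m s.1 _).trans ?_
      have h2 := barWeight_translate_le LN LG q s.1⁻¹ t
      rw [LN.map_inv] at h2
      have h3 := barWeight_nonneg LN LG q (s.1⁻¹ * t.1, t.2)
      have h4 : 1 + barWeight LN LG q (s.1⁻¹ * t.1, t.2) ≤ W ^ 2 := by nlinarith
      have h5 : 1 + LN s.1 ≤ W := by linarith
      have h6 : 0 ≤ W := by linarith
      refine mul_le_mul (pow_le_pow_left₀ (by linarith) h5 m) ((hD _).trans ?_)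
        (apply_nonneg _ _) (pow_nonneg h6 m)
      gcongr
      exact le_abs_self D
    have e2 := seminorm_le_chainNorm (hwt := barWeight_nonneg LN LG (q + 1)) (M.η i)
      (eval (biDv N A π p q x s)) (D := |C| * W ^ m) (m := m) (fun t' => by
        rw [eval_single]
        refine (hC (s, t')).trans ?_
        rw [mul_assoc, ← mul_pow]
        have ht' := barWeight_nonneg LN LG (q + 1) t'
        have h7 : 1 + biWeight LN LG LN p (q + 1) (s, t') ≤
            W * (1 + barWeight LN LG (q + 1) t') := by
          simp only [biWeight]
          nlinarith
        have h8 := biWeight_nonneg LN LG (L := LN) p (q + 1) (s, t')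
        gcongr
        exact le_abs_self C) (T s (Finsupp.single t 1))
    refine e2.trans ?_
    have h6 : 0 ≤ W := by linarith
    calc |C| * W ^ m * _ ≤ |C| * W ^ m * (W ^ m * (|D| * (W ^ 2) ^ k)) := by gcongr
      _ = |C| * |D| * W ^ (2 * m + 2 * k) := by
        rw [pow_add W, two_mul m, pow_add W, pow_mul]
        ring
  · funext s t
    rw [biDv_apply, barD_eq_eval, hu, biDv_apply, ← eval_barBoundary]
    have h1 : barBoundary π q (T s (barBoundary π q (Finsupp.single t 1))) =
        barBoundary π q (Finsupp.single t 1) := by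
      simp only [T, LinearMap.comp_apply]
      rw [barBoundary_translate, ← barBoundary_translate π q s.1⁻¹, hdh, barBoundary_translate,
        translate_translate, mul_inv_cancel, translate_one]
    rw [h1, ← barD_eq_eval]

/-- A vertical cochain that vanishes on cycles, for each value of the first variable, is a vertical
coboundary. -/
theorem mem_verticalBoundaries_of_eval {p q : ℕ} {x : BarBasis N N p → BarBasis N G q → A}
    (hx : x ∈ biC G (MonoidHom.id N) ρ p q)
    (h : ∀ s, ∀ y ∈ chainCycles (barBoundary π) q, eval (x s) y = 0) :
    x ∈ verticalBoundaries (biDv N A π) (biC G (MonoidHom.id N) ρ) (fun _ _ => ⊤) p q := by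
  cases q with
  | zero =>
    have : x = 0 := funext fun s => mem_coboundaries_top_of_eval π (h s)
    rw [this]
    exact zero_mem _
  | succ q =>
    have h1 : ∀ c : Fin p → N, ∃ v : BarBasis N G q → A, barD A π q v = x (1, c) := fun c => by
      obtain ⟨v, -, hv⟩ := mem_coboundaries_top_of_eval π (h (1, c))
      exact ⟨v, hv⟩
    choose v hv using h1
    refine ⟨_, ⟨extend_mem_homG (ρ := barRepComp G (MonoidHom.id N) ρ q) p v, trivial⟩,
      funext fun s => ?_⟩
    rw [biDv_apply, barD_barRepComp, hv]
    exact (apply_eq_of_mem_homG hx s).symm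

/-- For an exact cochain of polynomial growth on `K \ EG`, the primitive can be chosen to have
polynomial growth. -/
theorem mem_coboundaries_of_eval (hF : RelAcyclic π (pHom M LG) (fun _ => ⊤)) {n : ℕ}
    {φ : BarBasis N G n → A} (hφ : φ ∈ pHom M LG n)
    (h : ∀ y ∈ chainCycles (barBoundary π) n, eval φ y = 0) :
    φ ∈ coboundaries π (pHom M LG) n := by
  have h1 := mem_coboundaries_top_of_eval π h
  cases n with
  | zero => exact h1
  | succ n =>
    obtain ⟨c, -, rfl⟩ := h1
    obtain ⟨b, hb, hcb⟩ := hF n c trivial hφ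
    exact ⟨c - b, hcb, by rw [map_sub, barD_of_mem_coboundaries π _ hb, sub_zero]⟩

theorem barD_eq_zero_iff {n : ℕ} {φ : BarBasis N G n → A} :
    barD A π n φ = 0 ↔ ∀ y, eval φ (barBoundary π n y) = 0 := by
  constructor
  · intro h y
    rw [eval_barBoundary, h]
    simp
  · intro h
    funext t
    rw [barD_eq_eval, h]
    rfl

/-- The cochain `∑ cᵢ ⊗ φ(zᵢ)`, which depends only on the periods of `φ`. -/
def periodCochain {X : Type*} {r : ℕ} (z : Fin r → (X →₀ ℚ))
    (c : Fin r → (X →₀ ℚ) →ₗ[ℚ] ℚ) :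
    (X → A) →ₗ[ℚ] (X → A) where
  toFun φ t := ∑ i, c i (Finsupp.single t 1) • eval φ (z i)
  map_add' φ ψ := by
    funext t
    rw [Pi.add_apply, ← Finset.sum_add_distrib]
    refine Finset.sum_congr rfl fun i _ => ?_
    rw [← smul_add]
    congr 1
    simp [Finsupp.linearCombination_apply, Finsupp.sum, Finset.sum_add_distrib]
  map_smul' a φ := by
    funext t
    rw [Pi.smul_apply, RingHom.id_apply, Finset.smul_sum]
    refine Finset.sum_congr rfl fun i _ => ?_
    rw [smul_comm]
    congr 1
    simp only [Finsupp.linearCombination_apply, Finsupp.sum, Finset.smul_sum, Pi.smul_apply]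
    exact Finset.sum_congr rfl fun t _ => smul_comm _ _ _

theorem eval_periodCochain {X : Type*} {r : ℕ} (z : Fin r → (X →₀ ℚ))
    (c : Fin r → (X →₀ ℚ) →ₗ[ℚ] ℚ) (φ : X → A)
    (y : X →₀ ℚ) :
    eval (periodCochain z c φ) y = ∑ i, c i y • eval φ (z i) := by
  have := linearMap_eq_eval (∑ i, (c i).smulRight (eval φ (z i))) y
  simp only [LinearMap.sum_apply, LinearMap.smulRight_apply] at this
  rw [this]
  rfl

section Periods

variable {n r : ℕ} {z : Fin r → (BarBasis N G n →₀ ℚ)}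
  {c : Fin r → (BarBasis N G n →₀ ℚ) →ₗ[ℚ] ℚ}

theorem periodCochain_mem (hcd : ∀ i y, c i (barBoundary π n y) = 0)
    (hc : ∀ i, ∃ (C : ℝ) (k : ℕ), ∀ t, ‖c i (Finsupp.single t 1)‖ ≤
      C * (1 + barWeight LN LG n t) ^ k) (φ : BarBasis N G n → A) :
    periodCochain z c φ ∈ fibreKer M LG π n := by
  refine ⟨?_, ?_⟩
  · change IsPBoundedFun M _ fun t => ∑ i, c i (Finsupp.single t 1) • eval φ (z i)
    exact IsPBoundedFun.sum (barWeight_nonneg LN LG n) _ fun i _ =>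
      IsPBoundedFun.smul (f := fun _ => eval φ (z i))
        ⟨0, fun x => ⟨M.η x (eval φ (z i)), fun t => by simp⟩⟩ (hc i)
  · change barD A π n _ = 0
    rw [barD_eq_zero_iff]
    intro y
    simp [eval_periodCochain, hcd]

theorem eval_eq_periods
    (hspan : ∀ y ∈ chainCycles (barBoundary π) n, ∃ y', y - ∑ i, c i y • z i = barBoundary π n y')
    {φ : BarBasis N G n → A} (hφ : barD A π n φ = 0) {y : BarBasis N G n →₀ ℚ}
    (hy : y ∈ chainCycles (barBoundary π) n) : eval φ y = ∑ i, c i y • eval φ (z i) := by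
  obtain ⟨y', hy'⟩ := hspan y hy
  have h1 := congrArg (eval φ) hy'
  rw [barD_eq_zero_iff.1 hφ, map_sub, sub_eq_zero, map_sum] at h1
  rw [h1]
  simp only [map_smul]

variable (M LG π) in
/-- The class in `PH^n(K; A)` with the same periods as a given cochain. -/
def periodClass (hcd : ∀ i y, c i (barBoundary π n y) = 0)
    (hc : ∀ i, ∃ (C : ℝ) (k : ℕ), ∀ t, ‖c i (Finsupp.single t 1)‖ ≤
      C * (1 + barWeight LN LG n t) ^ k) : (BarBasis N G n → A) →ₗ[ℚ] fibrePH M LG π n :=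
  fibreProj M LG π n ∘ₗ (periodCochain z c).codRestrict _ (periodCochain_mem hcd hc)

theorem fibreProj_eq_zero_iff (hF : RelAcyclic π (pHom M LG) (fun _ => ⊤))
    (a : fibreKer M LG π n) : fibreProj M LG π n a = 0 ↔
      ∀ y ∈ chainCycles (barBoundary π) n, eval (a : BarBasis N G n → A) y = 0 := by
  have h1 : fibreProj M LG π n a = 0 ↔
      (a : BarBasis N G n → A) ∈ coboundaries π (pHom M LG) n :=
    Submodule.Quotient.mk_eq_zero _
  rw [h1]
  exact ⟨fun h y hy => eval_eq_zero_of_mem_coboundaries π h hy,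
    fun h => mem_coboundaries_of_eval hF a.2.1 h⟩

variable (hF : RelAcyclic π (pHom M LG) (fun _ => ⊤))
  (hcd : ∀ i y, c i (barBoundary π n y) = 0)
  (hc : ∀ i, ∃ (C : ℝ) (k : ℕ), ∀ t, ‖c i (Finsupp.single t 1)‖ ≤
      C * (1 + barWeight LN LG n t) ^ k)
  (hspan : ∀ y ∈ chainCycles (barBoundary π) n, ∃ y', y - ∑ i, c i y • z i = barBoundary π n y')

include hF hspan in
/-- On cocycles of polynomial growth the period class is the class of the cocycle. -/
theorem periodClass_of_mem (a : fibreKer M LG π n) :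
    periodClass LG π M (z := z) hcd hc a = fibreProj M LG π n a := by
  rw [periodClass, LinearMap.comp_apply, ← sub_eq_zero, ← map_sub, fibreProj_eq_zero_iff hF]
  intro y hy
  change eval (periodCochain z c a.1 - a.1) y = 0
  rw [eval_sub, eval_periodCochain, eval_eq_periods hspan a.2.2 hy, sub_self]

include hF hspan in
/-- A cocycle with given period class has the periods of each cocycle in the class. -/
theorem eval_eq_of_periodClass_eq {φ : BarBasis N G n → A} (hφ : barD A π n φ = 0)
    {a : fibreKer M LG π n} (h : fibreProj M LG π n a = periodClass LG π M (z := z) hcd hc φ)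
    {y : BarBasis N G n →₀ ℚ} (hy : y ∈ chainCycles (barBoundary π) n) :
    eval φ y = eval (a : BarBasis N G n → A) y := by
  rw [periodClass, LinearMap.comp_apply, ← sub_eq_zero, ← map_sub, fibreProj_eq_zero_iff hF] at h
  have h1 : eval (a.1 - periodCochain z c φ) y = 0 := h y hy
  rw [eval_sub, eval_periodCochain, ← eval_eq_periods hspan hφ hy, sub_eq_zero] at h1
  exact h1.symm

include hF hspan in
/-- The period class is equivariant on cocycles. -/
theorem periodClass_barRep (hz : ∀ i, z i ∈ chainCycles (barBoundary π) n)
    {φ : BarBasis N G n → A} (hφ : barD A π n φ = 0) (g : N) :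
    periodClass LG π M (z := z) hcd hc (barRep G ρ n g φ) =
      fibrePHRep M LG π n g (periodClass LG π M (z := z) hcd hc φ) := by
  have h1 : ∀ y ∈ chainCycles (barBoundary π) n, eval (φ - periodCochain z c φ) y = 0 := by
    intro y hy
    rw [eval_sub, eval_periodCochain, ← eval_eq_periods hspan hφ hy, sub_self]
  let a : fibreKer M LG π n := ⟨periodCochain z c φ, periodCochain_mem hcd hc φ⟩
  have h2 : fibrePHRep M LG π n g (periodClass LG π M (z := z) hcd hc φ) =
      fibreProj M LG π n (fibreKerRep M LG π n g a) := rfl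
  rw [h2, ← periodClass_of_mem hF hcd hc hspan, ← sub_eq_zero, ← map_sub]
  have h3 : barRep G ρ n g φ - ((fibreKerRep M LG π n g a : fibreKer M LG π n) :
      BarBasis N G n → A) = barRep G ρ n g (φ - periodCochain z c φ) := by
    rw [map_sub]
    rfl
  rw [h3]
  have h4 : ∀ y ∈ chainCycles (barBoundary π) n,
      eval (barRep G ρ n g (φ - periodCochain z c φ)) y = 0 := by
    intro y hy
    have h5 := h1 _ (translate_mem_chainCycles π n g⁻¹ hy)
    rw [eval_translate] at h5
    have h6 : barRep G ρ n g (φ - periodCochain z c φ) =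
        fun t => ρ g ((φ - periodCochain z c φ) (g⁻¹ * t.1, t.2)) := rfl
    rw [h6, eval_comp, h5, map_zero]
  rw [periodClass, LinearMap.comp_apply, fibreProj_eq_zero_iff hF]
  intro y _
  change eval (periodCochain z c _) y = 0
  rw [eval_periodCochain]
  exact Finset.sum_eq_zero fun i _ => by rw [h4 _ (hz i), smul_zero]

end Periods

end FibreColumns

/-! ### The columns of the double complex of the quotient -/

section QuotientColumns

variable {G N A : Type*} [Group G] [Group N] [Countable G] [Countable N] [AddCommGroup A]
  [Module ℚ A] {LG : WordLength G} {LN : WordLength N} {π : G →* N}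
  {ρ : Representation ℚ N A} {M : PSStructure.{w} LN ρ}

section Lift

variable {p n r : ℕ} {z : Fin r → (BarBasis N G n →₀ ℚ)}
  {c : Fin r → (BarBasis N G n →₀ ℚ) →ₗ[ℚ] ℚ}
  {S : PSStructure LN (fibrePHRep M LG π n)}
  (hS : IsAdmissibleEpi (fibreKerStructure M LG π n) S (fibreProj M LG π n))
  (hF : RelAcyclic π (pHom M LG) (fun _ => ⊤))
  (hcd : ∀ i y, c i (barBoundary π n y) = 0)
  (hc : ∀ i, ∃ (C : ℝ) (k : ℕ), ∀ t, ‖c i (Finsupp.single t 1)‖ ≤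
      C * (1 + barWeight LN LG n t) ^ k)
  (hspan : ∀ y ∈ chainCycles (barBoundary π) n, ∃ y', y - ∑ i, c i y • z i = barBoundary π n y')

include hS hF hspan in
/-- The p-bounded section of the admissible epimorphism bounds the periods of a family of cocycles
by the seminorms of their classes. -/
theorem isPBoundedFun_eval {x : BarBasis N N p → BarBasis N G n → A}
    (hx : ∀ s, barD A π n (x s) = 0)
    (hκ : IsPBoundedFun S (barWeight LN LN p) fun s => periodClass LG π M (z := z) hcd hc (x s))
    {y : BarBasis N G n →₀ ℚ} (hy : y ∈ chainCycles (barBoundary π) n) :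
    IsPBoundedFun M (barWeight LN LN p) fun s => eval (x s) y := by
  obtain ⟨σ, hσ, k, hk⟩ := hS.section'
  obtain ⟨m, hm⟩ := hκ
  refine ⟨m * k, fun i => ?_⟩
  obtain ⟨i', C, hC⟩ := hk (i, y.support)
  obtain ⟨D, hD⟩ := hm i'
  let B : ℝ := ∑ t ∈ y.support, ‖y t‖
  have hB : 0 ≤ B := Finset.sum_nonneg fun t _ => norm_nonneg _
  refine ⟨B * (|C| * (1 + |D|) ^ k), fun s => ?_⟩
  set v := periodClass LG π M (z := z) hcd hc (x s) with hv
  have h1 : eval (x s) y = eval (σ v).1 y :=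
    eval_eq_of_periodClass_eq hF hcd hc hspan (hx s) (LinearMap.congr_fun hσ v) hy
  have h2 : (fibreKerStructure M LG π n).η (i, y.support) (σ v) =
      ∑ t ∈ y.support, M.η i ((σ v).1 t) := by
    change (∑ t ∈ y.support, (M.η i).comp (LinearMap.proj t)) (σ v).1 = _
    rw [seminorm_sum_apply]
    rfl
  have h3 := hC v
  rw [h2] at h3
  have hw := barWeight_nonneg LN LN p s
  have hv0 : 0 ≤ S.η i' v := apply_nonneg _ _
  have h4 : 1 + S.η i' v ≤ (1 + |D|) * (1 + barWeight LN LN p s) ^ m := by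
    have h5 := hD s
    have h6 : 1 ≤ (1 + barWeight LN LN p s) ^ m := one_le_pow₀ (by linarith)
    have h7 : D * (1 + barWeight LN LN p s) ^ m ≤ |D| * (1 + barWeight LN LN p s) ^ m := by
      gcongr
      exact le_abs_self D
    rw [add_mul, one_mul]
    linarith
  calc M.η i (eval (x s) y) = M.η i (∑ t ∈ y.support, y t • (σ v).1 t) := by
        rw [h1, Finsupp.linearCombination_apply, Finsupp.sum]
    _ ≤ ∑ t ∈ y.support, ‖y t‖ * M.η i ((σ v).1 t) := by
        refine (seminorm_sum_le _ _ _).trans (le_of_eq ?_)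
        exact Finset.sum_congr rfl fun t _ => map_smul_eq_mul _ _ _
    _ ≤ ∑ t ∈ y.support, ‖y t‖ * ∑ t' ∈ y.support, M.η i ((σ v).1 t') := by
        refine Finset.sum_le_sum fun t ht => mul_le_mul_of_nonneg_left ?_ (norm_nonneg _)
        exact Finset.single_le_sum (f := fun t => M.η i ((σ v).1 t))
          (fun _ _ => apply_nonneg _ _) ht
    _ = B * ∑ t' ∈ y.support, M.η i ((σ v).1 t') := by rw [← Finset.sum_mul]
    _ ≤ B * (|C| * ((1 + |D|) * (1 + barWeight LN LN p s) ^ m) ^ k) := by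
        refine mul_le_mul_of_nonneg_left (h3.trans ?_) hB
        gcongr
        exact le_abs_self C
    _ = _ := by rw [mul_pow, ← pow_mul]; ring

include hS hF hspan in
/-- An equivariant family of cocycles whose classes grow polynomially has the same periods as an
equivariant family that grows polynomially in both variables jointly. -/
theorem exists_bounded_lift (hz : ∀ i, z i ∈ chainCycles (barBoundary π) n)
    {x : BarBasis N N p → BarBasis N G n → A} (hxC : x ∈ biC G (MonoidHom.id N) ρ p n)
    (hx : ∀ s, barD A π n (x s) = 0)
    (hκ : IsPBoundedFun S (barWeight LN LN p) fun s => periodClass LG π M (z := z) hcd hc (x s)) :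
    ∃ u ∈ biP LN LG (MonoidHom.id N) M p n,
      ∀ s, ∀ y ∈ chainCycles (barBoundary π) n, eval (x s - u s) y = 0 := by
  let u : BarBasis N N p → BarBasis N G n → A := fun s t =>
    ∑ i, c i (Finsupp.single (s.1⁻¹ * t.1, t.2) 1) • eval (x s) (translate G n s.1 (z i))
  have huC : u ∈ biC G (MonoidHom.id N) ρ p n := by
    refine mem_biC.2 fun g s t => ?_
    simp only [u, MonoidHom.id_apply, map_sum, map_smul]
    refine Finset.sum_congr rfl fun i _ => ?_
    rw [← translate_translate, eval_translate_of_mem_biC hxC]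
    simp [mul_assoc]
  have hsum : ∀ s i, eval (x s) (translate G n s.1 (z i)) =
      ∑ j, c j (translate G n s.1 (z i)) • eval (x s) (z j) := fun s i =>
    eval_eq_periods hspan (hx s) (translate_mem_chainCycles π n s.1 (hz i))
  have hw := biWeight_nonneg LN LG (L := LN) p n
  refine ⟨u, ⟨huC, ?_⟩, fun s y hy => ?_⟩
  · simp only [u, hsum]
    refine IsPBoundedFun.sum hw _ fun i _ => IsPBoundedFun.smul
      (f := fun x' : BarBasis N N p × BarBasis N G n =>
        ∑ j, c j (translate G n x'.1.1 (z i)) • eval (x x'.1) (z j))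
      (IsPBoundedFun.sum hw _ fun j _ => IsPBoundedFun.smul
        (f := fun x' : BarBasis N N p × BarBasis N G n => eval (x x'.1) (z j)) ?_ ?_) ?_
    · exact (isPBoundedFun_eval hS hF hcd hc hspan hx hκ (hz j)).comp_le
        (barWeight_nonneg LN LN p) Prod.fst
        (fun x' => le_add_of_nonneg_right (barWeight_nonneg _ _ _ _))
    · obtain ⟨C, k, hC⟩ := hc j
      refine ⟨|C| * chainNorm (barWeight LN LG n) (barWeight_nonneg LN LG n) k (z i), k,
        fun x' => ?_⟩
      have h1 := seminorm_le_chainNorm (hwt := barWeight_nonneg LN LG n) (normSeminorm ℚ ℚ) (c j) hC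
        (translate G n x'.1.1 (z i))
      have h2 := chainNorm_translate_le LN LG n k x'.1.1 (z i)
      have h3 := le_barWeight LN LN p x'.1
      have h4 := LN.nonneg x'.1.1
      have h5 := barWeight_nonneg LN LG n x'.2
      have h6 : (1 + LN x'.1.1) ^ k ≤ (1 + biWeight LN LG LN p n x') ^ k := by
        simp only [biWeight]
        gcongr
        linarith
      calc ‖c j (translate G n x'.1.1 (z i))‖ ≤ C * _ := h1
        _ ≤ |C| * ((1 + biWeight LN LG LN p n x') ^ k *
            chainNorm (barWeight LN LG n) (barWeight_nonneg LN LG n) k (z i)) := by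
          refine mul_le_mul (le_abs_self C) (h2.trans ?_) (apply_nonneg _ _) (abs_nonneg C)
          exact mul_le_mul_of_nonneg_right h6 (apply_nonneg _ _)
        _ = _ := by ring
    · obtain ⟨C, k, hC⟩ := hc i
      refine ⟨|C|, k, fun x' => (hC _).trans ?_⟩
      have h2 := barWeight_translate_le LN LG n x'.1.1⁻¹ x'.2
      rw [LN.map_inv] at h2
      have h3 := le_barWeight LN LN p x'.1
      have h4 := barWeight_nonneg LN LG n (x'.1.1⁻¹ * x'.2.1, x'.2.2)
      simp only [biWeight]
      gcongr
      · exact le_abs_self C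
      · linarith
  · have h1 : eval (u s) y = ∑ i, c i (translate G n s.1⁻¹ y) •
        eval (x s) (translate G n s.1 (z i)) := by
      have h2 := linearMap_eq_eval (∑ i, ((c i ∘ₗ translate G n s.1⁻¹).smulRight
        (eval (x s) (translate G n s.1 (z i))))) y
      simp only [LinearMap.sum_apply, LinearMap.smulRight_apply, LinearMap.comp_apply,
        translate_single] at h2
      rw [h2]
    obtain ⟨y', hy'⟩ := hspan _ (translate_mem_chainCycles π n s.1⁻¹ hy)
    have h3 : eval (x s) (translate G n s.1 (translate G n s.1⁻¹ y -
        ∑ i, c i (translate G n s.1⁻¹ y) • z i)) = 0 := by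
      rw [hy', ← barBoundary_translate, barD_eq_zero_iff.1 (hx s)]
    rw [map_sub, translate_translate, mul_inv_cancel, translate_one, map_sub, sub_eq_zero,
      map_sum, map_sum] at h3
    rw [eval_sub, h1, h3, sub_eq_zero]
    exact Finset.sum_congr rfl fun i _ => by rw [map_smul, map_smul]

end Lift

/-- The vertical cohomology of the double complex of the quotient is horizontally acyclic relative
to joint polynomial growth, since the quotient has p-bounded cohomology with coefficients in
`PH^q(K; A)`.  The positive seminorm of `a₀` gives scalar control of the fibre. -/
theorem columns_of_fibre (hπ : ∀ g, LN (π g) ≤ LG g)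
    (hF : RelAcyclic π (pHom M LG) (fun _ => ⊤)) {i₀ : M.Idx} {a₀ : A} (ha₀ : M.η i₀ a₀ ≠ 0)
    (S : ∀ k, PSStructure LN (fibrePHRep M LG π k))
    (hS : ∀ k, IsAdmissibleEpi (fibreKerStructure M LG π k) (S k) (fibreProj M LG π k))
    (hN : ∀ k, HasPBoundedCohomology (S k))
    (p q : ℕ) (x : BarBasis N N p → BarBasis N G q → A) (hx : x ∈ biC G (MonoidHom.id N) ρ p q)
    (hvx : biDv N A π p q x ∈ biP LN LG (MonoidHom.id N) M p (q + 1))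
    (hhx : biDh N N G A p q x ∈ biP LN LG (MonoidHom.id N) M (p + 1) q) :
    ∃ b ∈ horizontalBoundaries (biDh N N G A) (biDv N A π) (biC G (MonoidHom.id N) ρ)
      (biP LN LG (MonoidHom.id N) M) p q,
      ∃ b' ∈ verticalBoundaries (biDv N A π) (biC G (MonoidHom.id N) ρ) (fun _ _ => ⊤) p q,
        x - b - b' ∈ biP LN LG (MonoidHom.id N) M p q := by
  have hsc := scalarControl_of_relAcyclic hF ha₀
  have hdd : ∀ n y, barBoundary π n (barBoundary π (n + 1) y) = 0 := barBoundary_barBoundary π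
  have hd := chainNorm_barBoundary_le hπ
  obtain ⟨r, z, c, hz, hcd, hc, hspan⟩ := hsc.hasFiniteDuality hdd hd q
  -- correct `x` to a family of vertical cocycles
  obtain ⟨u, hu, hvu⟩ := exists_bounded_primitive
    (fun n => hsc.hasFilling hdd hd (hsc.hasCycleProjection hdd hd n)) hvx
  have hx₁C : x - u ∈ biC G (MonoidHom.id N) ρ p q := sub_mem hx hu.1
  have hx₁v : biDv N A π p q (x - u) = 0 := by rw [map_sub, hvu, sub_self]
  have hx₁h : biDh N N G A p q (x - u) ∈ biP LN LG (MonoidHom.id N) M (p + 1) q := by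
    rw [map_sub]
    exact sub_mem hhx (biDh_mem_biP hu)
  have hx₁ : ∀ s, barD A π q ((x - u) s) = 0 := fun s => congrFun hx₁v s
  -- the classes of these cocycles form an equivariant cochain with coefficients in `PH^q(K; A)`
  let κ := periodClass LG π M (z := z) hcd hc
  have hκC : (fun s => κ ((x - u) s)) ∈ homG (fibrePHRep M LG π q) p := by
    rw [mem_homG] at hx₁C ⊢
    intro g s
    rw [hx₁C g s]
    exact periodClass_barRep hF hcd hc hspan hz (hx₁ s) g
  have hdκ : barD _ (MonoidHom.id N) p (fun s => κ ((x - u) s)) =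
      fun s => κ (biDh N N G A p q (x - u) s) :=
    funext fun s => barD_comp (MonoidHom.id N) p κ _ s
  have hκP : barD _ (MonoidHom.id N) p (fun s => κ ((x - u) s)) ∈ pHomG (S q) (p + 1) := by
    rw [mem_pHomG]
    refine ⟨barD_mem_homG hκC, ?_⟩
    rw [hdκ]
    obtain ⟨m, hm⟩ := hx₁h.2
    have hker : ∀ s, biDh N N G A p q (x - u) s ∈ fibreKer M LG π q := by
      intro s
      refine ⟨⟨m, fun i => ?_⟩, ?_⟩
      · obtain ⟨C, hC⟩ := hm i
        refine ⟨|C| * (1 + barWeight LN LN (p + 1) s) ^ m, fun t => (hC (s, t)).trans ?_⟩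
        have h1 := barWeight_nonneg LN LN (p + 1) s
        have h2 := barWeight_nonneg LN LG q t
        have h3 := biWeight_nonneg LN LG (L := LN) (p + 1) q (s, t)
        have h4 : 1 + biWeight LN LG LN (p + 1) q (s, t) ≤
            (1 + barWeight LN LN (p + 1) s) * (1 + barWeight LN LG q t) := by
          simp only [biWeight]
          nlinarith
        rw [mul_assoc, ← mul_pow]
        gcongr
        exact le_abs_self C
      · have h5 := biDv_biDh π p q (x - u)
        rw [hx₁v, map_zero] at h5
        exact congrFun h5 s
    obtain ⟨k, hk⟩ := (hS q).bounded
    refine ⟨m * k, fun i' => ?_⟩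
    obtain ⟨⟨i, U⟩, C, hC⟩ := hk i'
    obtain ⟨D, hD⟩ := hm i
    let B : ℝ := ∑ t ∈ U, |D| * (1 + barWeight LN LG q t) ^ m
    have hB : 0 ≤ B := Finset.sum_nonneg fun t _ => by
      have := barWeight_nonneg LN LG q t
      positivity
    refine ⟨|C| * (1 + B) ^ k, fun s => ?_⟩
    have h1 := hC 1 ⟨_, hker s⟩
    have e1 : (fibreKerStructure M LG π q).act (i, U) 1 = (i, U) :=
      (fibreKerStructure M LG π q).act_one _
    rw [(S q).act_one, LN.map_one, add_zero, one_pow, mul_one] at h1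
    replace h1 := h1.trans_eq (congrArg (fun j => C * (1 +
      (fibreKerStructure M LG π q).η j ⟨_, hker s⟩) ^ k) e1)
    have h2 : κ (biDh N N G A p q (x - u) s) = fibreProj M LG π q ⟨_, hker s⟩ :=
      periodClass_of_mem hF hcd hc hspan ⟨_, hker s⟩
    have h3 : (fibreKerStructure M LG π q).η (i, U) ⟨_, hker s⟩ =
        ∑ t ∈ U, M.η i (biDh N N G A p q (x - u) s t) := by
      change (∑ t ∈ U, (M.η i).comp (LinearMap.proj t)) (biDh N N G A p q (x - u) s) = _
      rw [seminorm_sum_apply]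
      rfl
    have hw := barWeight_nonneg LN LN (p + 1) s
    have h4 : ∑ t ∈ U, M.η i (biDh N N G A p q (x - u) s t) ≤
        B * (1 + barWeight LN LN (p + 1) s) ^ m := by
      rw [Finset.sum_mul]
      refine Finset.sum_le_sum fun t _ => (hD (s, t)).trans ?_
      have h5 := barWeight_nonneg LN LG q t
      have h6 := biWeight_nonneg LN LG (L := LN) (p + 1) q (s, t)
      have h7 : 1 + biWeight LN LG LN (p + 1) q (s, t) ≤
          (1 + barWeight LN LG q t) * (1 + barWeight LN LN (p + 1) s) := by
        simp only [biWeight]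
        nlinarith
      rw [mul_assoc, ← mul_pow]
      gcongr
      exact le_abs_self D
    have h8 : 0 ≤ ∑ t ∈ U, M.η i (biDh N N G A p q (x - u) s t) :=
      Finset.sum_nonneg fun t _ => apply_nonneg _ _
    have h9 : 1 ≤ (1 + barWeight LN LN (p + 1) s) ^ m := one_le_pow₀ (by linarith)
    beta_reduce
    rw [h2]
    refine h1.trans ?_
    rw [h3, pow_mul, mul_assoc, ← mul_pow]
    gcongr
    · exact le_abs_self C
    · rw [add_mul, one_mul]
      linarith
  obtain ⟨b, hb, hκb⟩ := hasPBoundedCohomology_iff.1 (hN q) p _ hκC hκP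
  -- lift the primitive of the classes to vertical cocycles
  obtain ⟨b₁, hb₁, hb₁C, hb₁v, hb₁κ⟩ : ∃ b₁ ∈ horizontalBoundaries (biDh N N G A) (biDv N A π)
      (biC G (MonoidHom.id N) ρ) (biP LN LG (MonoidHom.id N) M) p q,
      b₁ ∈ biC G (MonoidHom.id N) ρ p q ∧ biDv N A π p q b₁ = 0 ∧ (fun s => κ (b₁ s)) = b := by
    cases p with
    | zero =>
      have hb : b = 0 := hb
      exact ⟨0, zero_mem _, zero_mem _, map_zero _, by rw [hb]; exact funext fun s => map_zero κ⟩
    | succ p =>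
      obtain ⟨v, hv, rfl⟩ := hb
      obtain ⟨σ, hσ, -⟩ := (hS q).section'
      let y : BarBasis N N p → BarBasis N G q → A := fun s =>
        (fibreKerRep M LG π q s.1 (σ (v (1, s.2)))).1
      have hyC : y ∈ biC G (MonoidHom.id N) ρ p q :=
        extend_mem_homG (ρ := barRepComp G (MonoidHom.id N) ρ q) p fun g => (σ (v (1, g))).1
      have hyv : biDv N A π p q y = 0 :=
        funext fun s => (fibreKerRep M LG π q s.1 (σ (v (1, s.2)))).2.2
      have hyκ : ∀ s, κ (y s) = v s := by
        intro s
        have h1 : κ (y s) = fibreProj M LG π q (fibreKerRep M LG π q s.1 (σ (v (1, s.2)))) :=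
          periodClass_of_mem hF hcd hc hspan _
        rw [h1, (hS q).equivariant, apply_eq_of_mem_homG hv s]
        congr 1
        exact LinearMap.congr_fun hσ _
      refine ⟨biDh N N G A p q y, ⟨y, ⟨hyC, ?_⟩, rfl⟩, barD_mem_homG hyC, ?_, ?_⟩
      · change biDv N A π p q y ∈ biP LN LG (MonoidHom.id N) M p (q + 1)
        rw [hyv]
        exact zero_mem _
      · rw [biDv_biDh, hyv, map_zero]
      · funext s
        rw [← barD_comp]
        simp only [hyκ]
  have hx₂C : x - u - b₁ ∈ biC G (MonoidHom.id N) ρ p q := sub_mem hx₁C hb₁C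
  have hx₂ : ∀ s, barD A π q ((x - u - b₁) s) = 0 := fun s =>
    congrFun (show biDv N A π p q (x - u - b₁) = 0 by rw [map_sub, hx₁v, hb₁v, sub_zero]) s
  have hκ₂ : IsPBoundedFun (S q) (barWeight LN LN p) fun s => κ ((x - u - b₁) s) := by
    have h1 : (fun s => κ ((x - u - b₁) s)) = (fun s => κ ((x - u) s)) - b := by
      rw [← hb₁κ]
      exact funext fun s => map_sub κ _ _
    rw [h1]
    exact (mem_pHomG.1 hκb).2
  obtain ⟨u', hu', heval⟩ := exists_bounded_lift (hS q) hF hcd hc hspan hz hx₂C hx₂ hκ₂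
  refine ⟨b₁, hb₁, x - u - b₁ - u', mem_verticalBoundaries_of_eval (sub_mem hx₂C hu'.1) heval, ?_⟩
  have : x - b₁ - (x - u - b₁ - u') = u + u' := by abel
  rw [this]
  exact add_mem hu hu'

end QuotientColumns

end

end PBdd

theorem corollary1p1p19 {K G N A : Type*} [Group K] [Group G] [Group N]
    [Countable G] [Countable N] [AddCommGroup A] [Module ℚ A]
    (LK : PBdd.WordLength K) (LG : PBdd.WordLength G) (LN : PBdd.WordLength N)
    (ι : K →* G) (π : G →* N) (hE : PBdd.IsWordLengthExtension LK LG LN ι π)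
    (ρ : Representation ℚ N A) (M : PBdd.PSStructure LN ρ)
    (S : ∀ k, PBdd.PSStructure LN (PBdd.fibrePHRep M LG π k))
    (hS : ∀ k, PBdd.IsAdmissibleEpi (PBdd.fibreKerStructure M LG π k) (S k)
      (PBdd.fibreProj M LG π k))
    (hK : PBdd.HasPBoundedCohomology (M.comap (LH := LK) (π.comp ι) hE.le_comp))
    (hN : ∀ k, PBdd.HasPBoundedCohomology (S k)) :
    PBdd.HasPBoundedCohomology (M.comap (LH := LG) π hE.hom_right.le) := by
  rw [PBdd.hasPBoundedCohomology_iff]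
  by_cases h0 : ∃ i a, M.η i a ≠ 0
  · obtain ⟨i, a, ha⟩ := h0
    refine PBdd.relAcyclic_of_invCochains hE ?_
    exact PBdd.relAcyclic_of_columns (LΓ := LN) (r := id) (κ := 1) hE.hom_right.le
      (fun _ _ => rfl) zero_le_one (fun _ => (one_mul _).ge)
      (PBdd.columns_of_fibre hE.hom_right.le (PBdd.fibre_relAcyclic hE hK) ha S hS hN)
  · -- if all seminorms vanish, then each cochain has polynomial growth
    push Not at h0
    intro n φ hφ _
    refine ⟨0, zero_mem _, ?_⟩
    rw [sub_zero]
    refine ⟨hφ, 0, fun i => ⟨0, fun g t => ?_⟩⟩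
    rw [zero_mul, zero_mul]
    exact (h0 _ _).le
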